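/- Let $S$ be a compact Sasakian manifold of dimension $2m+1$: a compact smooth manifold with a Riemannian metric $g$ and a complex structure $J$ on the cone $C(S)=S\times\mathbb{R}_{>0}$ such that $(C(S),\,dr^2+r^2g,\,J)$ is a Kähler manifold and $\mathcal{L}_{r\partial/\partial r}J=0$. Identify $S$ with $\{r=1\}\subset C(S)$, and let $\xi=J(r\frac{\partial}{\partial r})$ be the Reeb field, $\eta=g(\xi,\cdot)$ the contact form, $D=\ker\eta$ the contact bundle, and $g^T=g|_D$ the transverse Kähler metric, with transverse complex structure $J|_D$. A smooth function $u\colon S\to\mathbb{C}$ is basic if $\xi u=0$. (A $1$-form $\alpha$ is basic if $\alpha(\xi)=0$ and $\mathcal{L}_\xi\alpha=0$.) For basic $u$ let $d_Bu=du$, and let $\bar\partial_Bu=\frac12(du+\sqrt{-1}\,du\circ J)$ on $D$, extended by $0$ along $\xi$; this is the $(0,1)$-part of $du$. On basic functions and on basic $1$-forms use the Hermitian $L^2$ inner products $$\langle u,v\rangle=\int_S u\,\bar v\;d\mathrm{vol}_g,\qquad \langle\alpha,\beta\rangle=\int_S g^T(\alpha,\bar\beta)\;d\mathrm{vol}_g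 ,$$ where $g^T$ is extended complex bilinearly to complex covectors on $D$. For $T=d_B$ or $T=\bar\partial_B$, the adjoint $T^*$ sends a basic $1$-form $\alpha$ to the basic function $T^*\alpha$ with $\langle Tv,\alpha\rangle=\langle v,T^*\alpha\rangle$ for all basic functions $v$. Since $d_B^*$ and $\bar\partial_B^*$ vanish on functions, the basic Laplacian and the basic Dolbeault Laplacian on basic functions are $$\triangle^B u=d_B^*d_Bu,\qquad \square^B u=\bar\partial_B^*\bar\partial_Bu .$$ Let $\triangle_g=d^*d$ be the (nonnegative) Riemannian Laplacian on functions, in local coordinates $\triangle_gu=-\frac{1}{\sqrt{\det g}}\,\partial_i\big(\sqrt{\det g}\,g^{ij}\,\partial_ju\big)$. Then for every basic function $u$ on $S$ the adjoint values $d_B^*d_Bu$ and $\bar\partial_B^*\bar\partial_Bu$ exist and are unique, and $$\triangle_g u=\triangle^B u=2\,\square^B u .$$ -/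

import Mathlib

open scoped Manifold ContDiff

namespace Sasaki

/-! ## Riemannian manifolds: coordinates, Laplacian, integration -/

section Riemannian

/-- Smooth Riemannian metrics on an `n`-dimensional manifold. -/
abbrev Metric (n : ℕ) (S : Type*) [TopologicalSpace S]
    [ChartedSpace (EuclideanSpace ℝ (Fin n)) S] [IsManifold (𝓡 n) ∞ S] :=
  Bundle.ContMDiffRiemannianMetric (𝓡 n) ∞ (EuclideanSpace ℝ (Fin n))
    (fun p : S => TangentSpace (𝓡 n) p)

/-- Complex-valued `1`-forms (no smoothness imposed). -/
abbrev OneForm (n : ℕ) (S : Type*) [TopologicalSpace S]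
    [ChartedSpace (EuclideanSpace ℝ (Fin n)) S] :=
  ∀ p : S, TangentSpace (𝓡 n) p →L[ℝ] ℂ

variable {n : ℕ} {S : Type*} [TopologicalSpace S] [ChartedSpace (EuclideanSpace ℝ (Fin n)) S]

/-- The `i`-th coordinate vector field `∂ᵢ` of the chart at `c`, at the point with
coordinates `y`. -/
noncomputable def coordVec (c : S) (y : EuclideanSpace ℝ (Fin n)) (i : Fin n) :
    TangentSpace (𝓡 n) ((extChartAt (𝓡 n) c).symm y) :=
  mfderiv 𝓘(ℝ, EuclideanSpace ℝ (Fin n)) (𝓡 n) (extChartAt (𝓡 n) c).symm y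
    (EuclideanSpace.single i (1 : ℝ))

instance (p : S) : FiniteDimensional ℝ (TangentSpace (𝓡 n) p) :=
  inferInstanceAs (FiniteDimensional ℝ (EuclideanSpace ℝ (Fin n)))

/-- The differential of a complex-valued function. -/
noncomputable def d (u : S → ℂ) : OneForm n S := fun p => mfderiv (𝓡 n) 𝓘(ℝ, ℂ) u p

variable [IsManifold (𝓡 n) ∞ S]

/-- The matrix `g_{ij} = g(∂ᵢ, ∂ⱼ)` of the metric in the chart at `c`. -/
noncomputable def gram (g : Metric n S) (c : S) (y : EuclideanSpace ℝ (Fin n)) :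
    Matrix (Fin n) (Fin n) ℝ :=
  Matrix.of fun i j => g.inner ((extChartAt (𝓡 n) c).symm y) (coordVec c y i) (coordVec c y j)

/-- The Riemannian density `√(det g_{ij})` in the chart at `c`. -/
noncomputable def density (g : Metric n S) (c : S) (y : EuclideanSpace ℝ (Fin n)) : ℝ :=
  Real.sqrt (gram g c y).det

/-- The (nonnegative) Laplace-Beltrami operator of `g` on complex-valued functions,
`Δ_g u = - (det g)^{-1/2} ∂ᵢ ((det g)^{1/2} g^{ij} ∂ⱼ u)`, computed at `p` in the chart at `p`. -/
noncomputable def laplacian (g : Metric n S) (u : S → ℂ) (p : S) : ℂ :=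
  let y₀ : EuclideanSpace ℝ (Fin n) := extChartAt (𝓡 n) p p
  (-(((density g p y₀)⁻¹ : ℝ) : ℂ)) * ∑ i : Fin n,
    fderiv ℝ (fun y : EuclideanSpace ℝ (Fin n) =>
      ∑ j : Fin n, ((density g p y * (gram g p y)⁻¹ i j : ℝ) : ℂ) *
        fderiv ℝ (fun z => u ((extChartAt (𝓡 n) p).symm z)) y (EuclideanSpace.single j (1 : ℝ)))
      y₀ (EuclideanSpace.single i (1 : ℝ))

/-- A smooth partition of unity subordinate to the charts, used to integrate. -/
noncomputable def chartPartition (n : ℕ) (S : Type*) [TopologicalSpace S]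
    [ChartedSpace (EuclideanSpace ℝ (Fin n)) S] [IsManifold (𝓡 n) ∞ S]
    [T2Space S] [SigmaCompactSpace S] : SmoothPartitionOfUnity S (𝓡 n) S Set.univ :=
  Classical.choose (SmoothPartitionOfUnity.exists_isSubordinate_chartAt_source (𝓡 n) S)

theorem chartPartition_isSubordinate (n : ℕ) (S : Type*) [TopologicalSpace S]
    [ChartedSpace (EuclideanSpace ℝ (Fin n)) S] [IsManifold (𝓡 n) ∞ S]
    [T2Space S] [SigmaCompactSpace S] :
    (chartPartition n S).IsSubordinate
      (fun c => (chartAt (EuclideanSpace ℝ (Fin n)) c).source) :=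
  Classical.choose_spec (SmoothPartitionOfUnity.exists_isSubordinate_chartAt_source (𝓡 n) S)

/-- The integral `∫_S f dvol_g` of a function against the Riemannian volume element
`√(det g_{ij}) dy¹ … dyⁿ`, by a partition of unity subordinate to the charts. -/
noncomputable def integral [T2Space S] [SigmaCompactSpace S] (g : Metric n S) (f : S → ℂ) : ℂ :=
  ∑ᶠ c : S, ∫ y in (extChartAt (𝓡 n) c).target,
    ((chartPartition n S c ((extChartAt (𝓡 n) c).symm y) * density g c y : ℝ) : ℂ) *
      f ((extChartAt (𝓡 n) c).symm y)

end Riemannian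

/-- For a finite-dimensional space `W` with a real inner product `B`, the induced Hermitian inner
product `B^{ab} αₐ conj β_b` of complex-valued covectors `α`, `β`, where `(B^{ab})` is the inverse
of the Gram matrix of a basis of `W`. It does not depend on the basis. -/
noncomputable def covectorInner {W : Type*} [AddCommGroup W] [Module ℝ W]
    [FiniteDimensional ℝ W]
    (B : W → W → ℝ) (α β : W → ℂ) : ℂ :=
  let b := Module.finBasis ℝ W
  ∑ i, ∑ j, (((Matrix.of fun k l => B (b k) (b l))⁻¹ i j : ℝ) : ℂ) *
    α (b i) * (starRingEnd ℂ) (β (b j))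

/-! ## The Kähler cone of a Sasakian manifold -/

section Cone

/-- The open half-line `ℝ_{>0}`. -/
def posReals : TopologicalSpace.Opens ℝ := ⟨Set.Ioi 0, isOpen_Ioi⟩

/-- The cone `C(S) = S × ℝ_{>0}`. -/
abbrev Cone (S : Type*) := S × posReals

/-- The model with corners (without boundary) of the cone. Its tangent space at `(p, r)` is
`T_p S × ℝ`, the second component being `dr`. -/
noncomputable abbrev coneModel (n : ℕ) := (𝓡 n).prod 𝓘(ℝ, ℝ)

variable {n : ℕ} {S : Type*} [TopologicalSpace S] [ChartedSpace (EuclideanSpace ℝ (Fin n)) S]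

/-- The component in `T_p S` of a tangent vector of the cone at `(p, r)`. -/
noncomputable def baseComp {x : Cone S} (v : TangentSpace (coneModel n) x) : TangentSpace (𝓡 n) x.1 :=
  Prod.fst (show EuclideanSpace ℝ (Fin n) × ℝ from v)

/-- The component `dr(v)` of a tangent vector of the cone. -/
noncomputable def radComp {x : Cone S} (v : TangentSpace (coneModel n) x) : ℝ :=
  Prod.snd (show EuclideanSpace ℝ (Fin n) × ℝ from v)

/-- The tangent vector of the cone at `x = (p, r)` with components `v ∈ T_p S` and `a ∂/∂r`. -/
noncomputable def coneVec (x : Cone S) (v : TangentSpace (𝓡 n) x.1) (a : ℝ) : TangentSpace (coneModel n) x :=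
  (show EuclideanSpace ℝ (Fin n) × ℝ from (v, a))

/-- The Euler vector field `r ∂/∂r` on the cone. -/
noncomputable def euler (n : ℕ) {S : Type*} [TopologicalSpace S]
    [ChartedSpace (EuclideanSpace ℝ (Fin n)) S] (x : Cone S) : TangentSpace (coneModel n) x :=
  coneVec x 0 (x.2 : ℝ)

/-- The point `(p, 1)` of the cone. -/
def atOne (p : S) : Cone S := (p, ⟨1, Set.mem_Ioi.mpr one_pos⟩)

variable [IsManifold (𝓡 n) ∞ S]

/-- The cone metric `dr² + r² g`. -/
noncomputable def coneMetric (g : Metric n S) (x : Cone S)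
    (v w : TangentSpace (coneModel n) x) : ℝ :=
  radComp v * radComp w + (x.2 : ℝ) ^ 2 * g.inner x.1 (baseComp v) (baseComp w)

/-- The vector field `X` on the cone is smooth at `x`. -/
def SmoothFieldAt (X : ∀ x : Cone S, TangentSpace (coneModel n) x) (x : Cone S) : Prop :=
  ContMDiffAt (coneModel n) (coneModel n).tangent ∞
    (fun y => (⟨y, X y⟩ : TangentBundle (coneModel n) (Cone S))) x

/-- The directional derivative at `x` of the real function `f` on the cone along the vector `v`. -/
noncomputable def dirDeriv (f : Cone S → ℝ) (x : Cone S) (v : TangentSpace (coneModel n) x) : ℝ :=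
  mfderiv (coneModel n) 𝓘(ℝ, ℝ) f x v

end Cone

/-- A Sasakian structure on a manifold `S` of dimension `2m+1`: a Riemannian metric `g` and a
complex structure `J` on the cone `C(S)` which makes `(C(S), dr² + r² g)` a Kähler manifold and
satisfies `L_{r∂/∂r} J = 0`. -/
structure SasakianStructure (m : ℕ) (S : Type*) [TopologicalSpace S]
    [ChartedSpace (EuclideanSpace ℝ (Fin (2 * m + 1))) S] [IsManifold (𝓡 (2 * m + 1)) ∞ S] where
  /-- the Sasaki metric -/
  g : Metric (2 * m + 1) S
  /-- the complex structure of the cone -/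
  J : ∀ x : Cone S, TangentSpace (coneModel (2 * m + 1)) x →L[ℝ]
    TangentSpace (coneModel (2 * m + 1)) x
  /-- `J` is a smooth tensor field -/
  smooth_J : ContMDiff (coneModel (2 * m + 1))
    ((coneModel (2 * m + 1)).prod 𝓘(ℝ, (EuclideanSpace ℝ (Fin (2 * m + 1)) × ℝ) →L[ℝ]
      (EuclideanSpace ℝ (Fin (2 * m + 1)) × ℝ))) ∞
    (fun x : Cone S => Bundle.TotalSpace.mk'
      ((EuclideanSpace ℝ (Fin (2 * m + 1)) × ℝ) →L[ℝ] (EuclideanSpace ℝ (Fin (2 * m + 1)) × ℝ))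
      (E := fun x : Cone S => TangentSpace (coneModel (2 * m + 1)) x →L[ℝ]
        TangentSpace (coneModel (2 * m + 1)) x) x (J x))
  /-- `J² = -1` -/
  J_sq : ∀ (x : Cone S) (v : TangentSpace (coneModel (2 * m + 1)) x), J x (J x v) = -v
  /-- `J` is integrable: its Nijenhuis tensor vanishes -/
  integrable : ∀ (x : Cone S) (X Y : ∀ x : Cone S, TangentSpace (coneModel (2 * m + 1)) x),
    SmoothFieldAt X x → SmoothFieldAt Y x →
    VectorField.mlieBracket (coneModel (2 * m + 1)) (fun y => J y (X y)) (fun y => J y (Y y)) x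
      - J x (VectorField.mlieBracket (coneModel (2 * m + 1)) (fun y => J y (X y)) Y x)
      - J x (VectorField.mlieBracket (coneModel (2 * m + 1)) X (fun y => J y (Y y)) x)
      - VectorField.mlieBracket (coneModel (2 * m + 1)) X Y x = 0
  /-- the cone metric is Hermitian -/
  hermitian : ∀ (x : Cone S) (v w : TangentSpace (coneModel (2 * m + 1)) x),
    coneMetric g x (J x v) (J x w) = coneMetric g x v w
  /-- the fundamental form `ω(X, Y) = ḡ(J X, Y)` is closed -/
  closed : ∀ (x : Cone S) (X Y Z : ∀ x : Cone S, TangentSpace (coneModel (2 * m + 1)) x),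
    SmoothFieldAt X x → SmoothFieldAt Y x → SmoothFieldAt Z x →
    dirDeriv (fun y => coneMetric g y (J y (Y y)) (Z y)) x (X x)
      + dirDeriv (fun y => coneMetric g y (J y (Z y)) (X y)) x (Y x)
      + dirDeriv (fun y => coneMetric g y (J y (X y)) (Y y)) x (Z x)
      - coneMetric g x (J x (VectorField.mlieBracket (coneModel (2 * m + 1)) X Y x)) (Z x)
      - coneMetric g x (J x (VectorField.mlieBracket (coneModel (2 * m + 1)) Y Z x)) (X x)
      - coneMetric g x (J x (VectorField.mlieBracket (coneModel (2 * m + 1)) Z X x)) (Y x) = 0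
  /-- `(L_{r∂/∂r} J) X = [r∂/∂r, J X] - J [r∂/∂r, X] = 0` -/
  lie_euler_J : ∀ (x : Cone S) (X : ∀ x : Cone S, TangentSpace (coneModel (2 * m + 1)) x),
    SmoothFieldAt X x →
    VectorField.mlieBracket (coneModel (2 * m + 1)) (euler (2 * m + 1)) (fun y => J y (X y)) x
      = J x (VectorField.mlieBracket (coneModel (2 * m + 1)) (euler (2 * m + 1)) X x)

namespace SasakianStructure

/-! ## Basic functions and the basic Laplacians -/

variable {m : ℕ} {S : Type*} [TopologicalSpace S]
    [ChartedSpace (EuclideanSpace ℝ (Fin (2 * m + 1))) S] [IsManifold (𝓡 (2 * m + 1)) ∞ S]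
    (𝓢 : SasakianStructure m S)

/-- The Reeb field `ξ = J(r∂/∂r)` on `S = {r = 1}`. -/
noncomputable def reeb (p : S) : TangentSpace (𝓡 (2 * m + 1)) p :=
  baseComp (𝓢.J (atOne p) (euler (2 * m + 1) (atOne p)))

/-- The contact form `η = g(ξ, ·)`. -/
noncomputable def eta (p : S) : TangentSpace (𝓡 (2 * m + 1)) p →L[ℝ] ℝ :=
  𝓢.g.inner p (𝓢.reeb p)

/-- The contact bundle `D = ker η`. -/
noncomputable def contact (p : S) : Submodule ℝ (TangentSpace (𝓡 (2 * m + 1)) p) :=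
  LinearMap.ker (𝓢.eta p : TangentSpace (𝓡 (2 * m + 1)) p →ₗ[ℝ] ℝ)

/-- The transverse metric `g^T`: the restriction of `g` to `D`. -/
noncomputable def transverseMetric (p : S) (v w : 𝓢.contact p) : ℝ :=
  𝓢.g.inner p (v : TangentSpace (𝓡 (2 * m + 1)) p) (w : TangentSpace (𝓡 (2 * m + 1)) p)

/-- The transverse complex structure, extended by zero along `ξ`: the `TS`-component of `J` on
`TS ⊂ TC(S)|_{r = 1}`. It agrees with `J` on `D` and maps `ξ` to `0`. -/
noncomputable def transverseJ (p : S) (v : TangentSpace (𝓡 (2 * m + 1)) p) :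
    TangentSpace (𝓡 (2 * m + 1)) p :=
  baseComp (𝓢.J (atOne p) (coneVec (atOne p) v 0))

/-- Basic functions: smooth functions `u` with `ξ u = 0`. -/
def IsBasic (u : S → ℂ) : Prop :=
  ContMDiff (𝓡 (2 * m + 1)) 𝓘(ℝ, ℂ) ∞ u ∧ ∀ p : S, d u p (𝓢.reeb p) = 0

/-- The operator `∂̄_B` on functions, `∂̄_B u = (du + √-1 du ∘ J) / 2`: the `(0,1)`-part of `du`
with respect to the transverse complex structure. Its values are recorded as functions on the
tangent spaces. -/
noncomputable def dbar (u : S → ℂ) (p : S) (v : TangentSpace (𝓡 (2 * m + 1)) p) : ℂ :=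
  (d u p v + Complex.I * d u p (𝓢.transverseJ p v)) / 2

/-- The operator `d_B`: the exterior derivative on basic functions. -/
noncomputable def dB (_𝓢 : SasakianStructure m S) (u : S → ℂ) (p : S)
    (v : TangentSpace (𝓡 (2 * m + 1)) p) : ℂ :=
  d u p v

section Integral

variable [T2Space S] [SigmaCompactSpace S]

/-- The `L²` inner product `∫_S u conj(v) dvol_g` of functions. -/
noncomputable def functionInner (u v : S → ℂ) : ℂ :=
  integral 𝓢.g (fun p => u p * (starRingEnd ℂ) (v p))

/-- The `L²` inner product `∫_S g^T(α, conj β) dvol_g` of basic `1`-forms, defined by the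
transverse metric. -/
noncomputable def formInner (α β : ∀ p : S, TangentSpace (𝓡 (2 * m + 1)) p → ℂ) : ℂ :=
  integral 𝓢.g (fun p => covectorInner (𝓢.transverseMetric p)
    (fun v : 𝓢.contact p => α p v) (fun v : 𝓢.contact p => β p v))

/-- `f` is a value at the basic `1`-form `α` of the adjoint of the operator `T` from basic functions
to basic `1`-forms: `f` is basic and `⟨T v, α⟩ = ⟨v, f⟩` for all basic functions `v`. -/
def IsAdjointValue (T : (S → ℂ) → ∀ p : S, TangentSpace (𝓡 (2 * m + 1)) p → ℂ)
    (α : ∀ p : S, TangentSpace (𝓡 (2 * m + 1)) p → ℂ) (f : S → ℂ) : Prop :=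
  𝓢.IsBasic f ∧ ∀ v : S → ℂ, 𝓢.IsBasic v → 𝓢.formInner (T v) α = 𝓢.functionInner v f

/-- The adjoint operator `T^*` of `T` on basic `1`-forms (arbitrary where there is no value). -/
noncomputable def adjoint (T : (S → ℂ) → ∀ p : S, TangentSpace (𝓡 (2 * m + 1)) p → ℂ)
    (α : ∀ p : S, TangentSpace (𝓡 (2 * m + 1)) p → ℂ) : S → ℂ :=
  Classical.epsilon (𝓢.IsAdjointValue T α)

/-- The basic Laplacian `Δ^B = d_B^* d_B + d_B d_B^*` on functions, where `d_B^* = 0`. -/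
noncomputable def basicLaplacian (u : S → ℂ) : S → ℂ := 𝓢.adjoint 𝓢.dB (𝓢.dB u)

/-- The basic Dolbeault Laplacian `□^B = ∂̄_B^* ∂̄_B + ∂̄_B ∂̄_B^*` on functions, where
`∂̄_B^* = 0`. -/
noncomputable def basicDolbeaultLaplacian (u : S → ℂ) : S → ℂ := 𝓢.adjoint 𝓢.dbar (𝓢.dbar u)

end Integral

end SasakianStructure

end Sasaki

open scoped Matrix


/-! Write Φ for the transverse complex structure extended by zero along ξ. If u is basic, the
gradients of Re u and Im u lie in D, so pairing covectors by g^T or by g is the same: the integrand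
of ⟨d_B v, d_B u⟩ is dv(grad Re u) - √-1 dv(grad Im u). The divergence theorem (`integral_d_field`)
turns its integral into ⟨v, Δ_g u⟩. Hence Δ_g u is a value of the adjoint as soon as it is basic.
Values are unique because the difference of two of them is basic, so it can be tested against
itself, and the L² norm is definite.

Δ_g u is basic because ξ is a Killing field (`IsLocalSasaki.killing`). Then ξ commutes with grad u,
commuting fields satisfy X(div Y) = Y(div X), and div ξ = 0, so ξ(div grad u) = 0.

For ∂̄_B, the identities Φ² = -1 on D and g(Φv, w) = -g(v, Φw) give half of the same integrand, plus
terms dv(Φ grad Re u) and dv(Φ grad Im u). These integrate to zero because Φ grad f is divergence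
free for real basic f (`IsLocalSasaki.divergence_Φ_gradient`). That is Liouville's theorem for the
transverse symplectic form β = g(Φ·,·) = dη/2: Φ grad f is the Hamiltonian field of f. It is proved
without differential forms of top degree. If a nondegenerate bilinear form B satisfies (det B)² =
ρ⁴, then div X = tr(B⁻¹ L_X B)/2 for the density ρ (`divergence_eq_trace_lieForm`). With B = g this
formula gives div ξ = 0 and the independence of the divergence from the chart; with B = β + η ⊗ η it
gives Liouville's theorem.

The identities of Sasakian geometry used here (`IsLocalSasaki`) are read off the cone at r = 1. The
algebraic ones come from J² = -1 and the Hermitian condition, dη = 2β from dω(r∂/∂r, ·, ·) = 0, and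
L_ξ Φ = 0 from the Nijenhuis tensor with r∂/∂r in one slot. -/

namespace Sasaki

/-! ### Derivatives of determinants and densities -/

section Calculus

variable {F : Type*} [NormedAddCommGroup F] [NormedSpace ℝ F] {n : ℕ}

/-- Jacobi's formula for the derivative of a determinant. -/
theorem fderiv_det_apply {A : F → Matrix (Fin n) (Fin n) ℝ} {y : F}
    (hA : ∀ i j, DifferentiableAt ℝ (fun x => A x i j) y) (v : F) :
    fderiv ℝ (fun x => (A x).det) y v =
      ((A y).adjugate * Matrix.of fun i j => fderiv ℝ (fun x => A x i j) y v).trace := by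
  have h1 : HasFDerivAt (fun x => (A x).det)
      (∑ σ : Equiv.Perm (Fin n), ((Equiv.Perm.sign σ : ℤ) : ℝ) •
        ∑ i, (∏ j ∈ Finset.univ.erase i, A y (σ j) j) •
          fderiv ℝ (fun x => A x (σ i) i) y) y := by
    simp only [Matrix.det_apply']
    refine HasFDerivAt.fun_sum fun σ _ => ?_
    refine HasFDerivAt.const_mul ?_ _
    exact HasFDerivAt.finsetProd fun i _ => (hA (σ i) i).hasFDerivAt
  rw [h1.fderiv]
  -- By Cramer's rule a diagonal entry of adj(A) ∂A is the determinant with one column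
  -- differentiated, which is one term of the product rule.
  have h2 : ∀ i, ((A y).adjugate * Matrix.of fun i j => fderiv ℝ (fun x => A x i j) y v) i i
      = ((A y).updateCol i (fun k => fderiv ℝ (fun x => A x k i) y v)).det := by
    intro i
    rw [← Matrix.cramer_apply, Matrix.cramer_eq_adjugate_mulVec]
    simp [Matrix.mul_apply, Matrix.mulVec, dotProduct]
  rw [Matrix.trace]
  simp only [Matrix.diag_apply, h2, Matrix.det_apply']
  rw [Finset.sum_comm]
  simp only [sum_apply, smul_apply, smul_eq_mul,
    Finset.mul_sum]
  refine Finset.sum_congr rfl fun σ _ => Finset.sum_congr rfl fun i _ => ?_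
  congr 1
  rw [← Finset.mul_prod_erase _ _ (Finset.mem_univ i), mul_comm]
  congr 1
  · simp
  · refine Finset.prod_congr rfl fun j hj => ?_
    simp [Matrix.updateCol_ne (Finset.ne_of_mem_erase hj)]

theorem contDiffOn_det {A : F → Matrix (Fin n) (Fin n) ℝ} {s : Set F} {k : WithTop ℕ∞}
    (hA : ∀ i j, ContDiffOn ℝ k (fun x => A x i j) s) :
    ContDiffOn ℝ k (fun x => (A x).det) s := by
  simp only [Matrix.det_apply']
  refine ContDiffOn.sum fun σ _ => contDiffOn_const.mul ?_
  exact contDiffOn_prod fun i _ => hA _ _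

theorem contDiffOn_matrix_inv {A : F → Matrix (Fin n) (Fin n) ℝ} {s : Set F} {k : WithTop ℕ∞}
    (hA : ∀ i j, ContDiffOn ℝ k (fun x => A x i j) s) (h0 : ∀ x ∈ s, (A x).det ≠ 0) (i j : Fin n) :
    ContDiffOn ℝ k (fun x => (A x)⁻¹ i j) s := by
  have : (fun x => (A x)⁻¹ i j) = fun x => (A x).det⁻¹ * (A x).adjugate i j := by
    ext x
    simp [Matrix.inv_def]
  rw [this]
  refine ((contDiffOn_det hA).inv h0).mul ?_
  simp only [Matrix.adjugate_apply]
  refine contDiffOn_det fun a b => ?_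
  by_cases h : a = j
  · subst h
    simpa using contDiffOn_const
  · simpa [Matrix.updateRow_ne h] using hA a b

/-- If `(det B)² = ρ⁴` then `∂ᵥ ρ = ρ tr(B⁻¹ ∂ᵥ B) / 2`. -/
theorem fderiv_density_apply {B : F → Matrix (Fin n) (Fin n) ℝ} {ρ : F → ℝ} {y : F}
    (hB : ∀ i j, DifferentiableAt ℝ (fun x => B x i j) y) (hρ : DifferentiableAt ℝ ρ y)
    (h0 : 0 < ρ y) (h : ∀ᶠ x in nhds y, (B x).det ^ 2 = ρ x ^ 4) (v : F) :
    fderiv ℝ ρ y v =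
      ρ y / 2 * ((B y)⁻¹ * Matrix.of fun i j => fderiv ℝ (fun x => B x i j) y v).trace := by
  have hd : DifferentiableAt ℝ (fun x => (B x).det) y := by
    simp only [Matrix.det_apply']
    refine DifferentiableAt.fun_sum fun σ _ => DifferentiableAt.const_mul ?_ _
    exact (HasFDerivAt.finsetProd fun i _ => (hB (σ i) i).hasFDerivAt).differentiableAt
  -- Comparing squares avoids the sign of det B, which is not tracked for the non-symmetric form to
  -- which this is applied. The result is 2 det B ∂(det B) = 4 ρ³ ∂ρ.
  have h1 : fderiv ℝ (fun x => (B x).det ^ 2) y v = fderiv ℝ (fun x => ρ x ^ 4) y v := by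
    rw [Filter.EventuallyEq.fderiv_eq h]
  rw [fderiv_fun_pow _ hd, fderiv_fun_pow _ hρ] at h1
  simp only [smul_apply, smul_eq_mul, fderiv_det_apply hB] at h1
  have hy : (B y).det ^ 2 = ρ y ^ 4 := h.self_of_nhds
  have hne : (B y).det ≠ 0 := fun h' => by
    rw [h'] at hy
    have := pow_pos h0 4
    simp at hy
    linarith
  rw [Matrix.inv_def, Ring.inverse_eq_inv', Matrix.smul_mul, Matrix.trace_smul, smul_eq_mul]
  generalize ((B y).adjugate * Matrix.of fun i j => fderiv ℝ (fun x => B x i j) y v).trace = t at *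
  norm_num at h1
  have h3 : ρ y ^ 3 * fderiv ℝ ρ y v = ρ y ^ 3 * (ρ y / 2 * ((B y).det⁻¹ * t)) := by
    have e1 : ρ y ^ 3 * (ρ y / 2 * ((B y).det⁻¹ * t)) = ρ y ^ 4 / 2 * ((B y).det⁻¹ * t) := by ring
    rw [e1, ← hy]
    field_simp
    linarith
  exact mul_left_cancel₀ (pow_pos h0 3).ne' h3

end Calculus

/-! ### Divergence and Lie derivatives of bilinear forms in coordinates -/

section Divergence

variable {n : ℕ}

local notation "𝔼" => EuclideanSpace ℝ (Fin n)

/-- The standard basis vectors of `ℝⁿ`. -/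
noncomputable def stdVec (i : Fin n) : EuclideanSpace ℝ (Fin n) := EuclideanSpace.single i (1 : ℝ)

theorem sum_coord_smul_stdVec (v : 𝔼) : ∑ i, v i • stdVec i = v := by
  ext j
  simp [stdVec, Pi.single_apply]

/-- The Lie derivative of a bilinear form along a vector field. -/
noncomputable def lieForm (X : 𝔼 → 𝔼) (B : 𝔼 → 𝔼 →L[ℝ] 𝔼 →L[ℝ] ℝ) (y : 𝔼) :
    𝔼 →L[ℝ] 𝔼 →L[ℝ] ℝ :=
  fderiv ℝ B y (X y) + (B y).comp (fderiv ℝ X y) + ((B y).flip.comp (fderiv ℝ X y)).flip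

theorem lieForm_apply (X : 𝔼 → 𝔼) (B : 𝔼 → 𝔼 →L[ℝ] 𝔼 →L[ℝ] ℝ) (y v w : 𝔼) :
    lieForm X B y v w =
      fderiv ℝ B y (X y) v w + B y (fderiv ℝ X y v) w + B y v (fderiv ℝ X y w) := rfl

/-- The matrix of a bilinear form in the standard basis. -/
noncomputable def formMatrix (b : 𝔼 →L[ℝ] 𝔼 →L[ℝ] ℝ) : Matrix (Fin n) (Fin n) ℝ :=
  Matrix.of fun i j => b (stdVec i) (stdVec j)

/-- The divergence of a vector field with respect to the density `ρ`. -/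
noncomputable def divergence (ρ : 𝔼 → ℝ) (X : 𝔼 → 𝔼) (y : 𝔼) : ℝ :=
  (ρ y)⁻¹ * ∑ i, fderiv ℝ (fun x => ρ x * X x i) y (stdVec i)

theorem fderiv_coord {X : 𝔼 → 𝔼} {y : 𝔼} (hX : DifferentiableAt ℝ X y) (i : Fin n) (v : 𝔼) :
    fderiv ℝ (fun x => X x i) y v = fderiv ℝ X y v i := by
  have := (EuclideanSpace.proj i : 𝔼 →L[ℝ] ℝ).hasFDerivAt.comp y hX.hasFDerivAt
  exact congrArg (· v) this.fderiv

theorem differentiableAt_coord {X : 𝔼 → 𝔼} {y : 𝔼} (hX : DifferentiableAt ℝ X y) (i : Fin n) :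
    DifferentiableAt ℝ (fun x => X x i) y :=
  (EuclideanSpace.proj i : 𝔼 →L[ℝ] ℝ).differentiableAt.comp y hX

/-- The product rule splits the divergence into X(log ρ) and the trace of the Jacobian; later
arguments treat the two parts separately. -/
theorem divergence_eq_trace_add {ρ : 𝔼 → ℝ} {X : 𝔼 → 𝔼} {y : 𝔼} (hρ : DifferentiableAt ℝ ρ y)
    (h0 : ρ y ≠ 0) (hX : DifferentiableAt ℝ X y) :
    divergence ρ X y = (ρ y)⁻¹ * fderiv ℝ ρ y (X y) + ∑ i, fderiv ℝ X y (stdVec i) i := by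
  have h1 : ∀ i, fderiv ℝ (fun x => ρ x * X x i) y (stdVec i)
      = ρ y * fderiv ℝ X y (stdVec i) i + X y i * fderiv ℝ ρ y (stdVec i) := by
    intro i
    rw [fderiv_fun_mul hρ (differentiableAt_coord hX i)]
    simp [fderiv_coord hX]
  rw [divergence, Finset.sum_congr rfl fun i _ => h1 i, Finset.sum_add_distrib, ← Finset.mul_sum]
  have h2 : ∑ i, X y i * fderiv ℝ ρ y (stdVec i) = fderiv ℝ ρ y (X y) := by
    conv_rhs => rw [← sum_coord_smul_stdVec (X y)]
    simp
  rw [h2, mul_add, inv_mul_cancel_left₀ h0, add_comm]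

theorem differentiableAt_form_apply {B : 𝔼 → 𝔼 →L[ℝ] 𝔼 →L[ℝ] ℝ} {y : 𝔼}
    (hB : DifferentiableAt ℝ B y) (v w : 𝔼) : DifferentiableAt ℝ (fun x => B x v w) y :=
  (hB.clm_apply (differentiableAt_const v)).clm_apply (differentiableAt_const w)

theorem fderiv_form_apply {B : 𝔼 → 𝔼 →L[ℝ] 𝔼 →L[ℝ] ℝ} {y : 𝔼}
    (hB : DifferentiableAt ℝ B y) (v w z : 𝔼) :
    fderiv ℝ (fun x => B x v w) y z = fderiv ℝ B y z v w := by
  rw [fderiv_clm_apply (hB.clm_apply (differentiableAt_const v)) (differentiableAt_const w),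
    fderiv_clm_apply hB (differentiableAt_const v)]
  simp

theorem form_apply_right (b : 𝔼 →L[ℝ] ℝ) (w : 𝔼) : b w = ∑ k, w k * b (stdVec k) := by
  conv_lhs => rw [← sum_coord_smul_stdVec w]
  simp

theorem form_apply_left (b : 𝔼 →L[ℝ] 𝔼 →L[ℝ] ℝ) (v w : 𝔼) :
    b v w = ∑ k, v k * b (stdVec k) w := by
  conv_lhs => rw [← sum_coord_smul_stdVec v]
  simp

/-- The divergence of `X` with respect to the density of a nondegenerate bilinear form `B` is
half the `B`-trace of the Lie derivative of `B` along `X`. -/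
theorem divergence_eq_trace_lieForm {B : 𝔼 → 𝔼 →L[ℝ] 𝔼 →L[ℝ] ℝ} {ρ : 𝔼 → ℝ} {X : 𝔼 → 𝔼} {y : 𝔼}
    (hB : DifferentiableAt ℝ B y) (hρ : DifferentiableAt ℝ ρ y) (h0 : 0 < ρ y)
    (h : ∀ᶠ x in nhds y, (formMatrix (B x)).det ^ 2 = ρ x ^ 4)
    (hX : DifferentiableAt ℝ X y) :
    divergence ρ X y =
      ((formMatrix (B y))⁻¹ * formMatrix (lieForm X B y)).trace / 2 := by
  rw [divergence_eq_trace_add hρ h0.ne' hX]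
  have hd := fderiv_density_apply (B := fun x => formMatrix (B x))
    (fun i j => differentiableAt_form_apply hB (stdVec i) (stdVec j)) hρ h0 h (X y)
  rw [hd]
  set M := formMatrix (B y) with hM
  have hu : IsUnit M.det := by
    have := h.self_of_nhds
    refine isUnit_iff_ne_zero.2 fun h' => ?_
    rw [← hM, h'] at this
    have h4 := pow_pos h0 4
    simp at this
    linarith
  set D : Matrix (Fin n) (Fin n) ℝ := Matrix.of fun k j => fderiv ℝ X y (stdVec j) k with hD
  generalize hN : (Matrix.of fun i j =>
    fderiv ℝ (fun x => (formMatrix (B x)) i j) y (X y)) = N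
  -- After multiplication by M⁻¹ each Jacobian term contributes tr D, and the derivative term N
  -- contributes 2 X(log ρ) by `hd`. Symmetry of M plays no role.
  have hL : formMatrix (lieForm X B y) = N
        + Dᵀ * M + M * D := by
    subst hN
    ext i j
    simp only [formMatrix, lieForm_apply, Matrix.of_apply, Matrix.add_apply, Matrix.mul_apply,
      Matrix.transpose_apply, hD, hM]
    rw [fderiv_form_apply hB]
    congr 1
    · congr 1
      rw [form_apply_left]
    · rw [form_apply_right]
      exact Finset.sum_congr rfl fun k _ => mul_comm _ _
  have h1 : (M⁻¹ * (M * D)).trace = D.trace := by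
    rw [← mul_assoc, Matrix.nonsing_inv_mul _ hu, one_mul]
  have h2 : (M⁻¹ * (Dᵀ * M)).trace = D.trace := by
    rw [Matrix.trace_mul_comm, mul_assoc, Matrix.mul_nonsing_inv _ hu, mul_one,
      Matrix.trace_transpose]
  rw [hL, mul_add, mul_add, Matrix.trace_add, Matrix.trace_add, h1, h2]
  have hT : D.trace = ∑ i, fderiv ℝ X y (stdVec i) i := by simp [Matrix.trace, hD]
  rw [hT]
  field_simp
  ring

/-- The matrix of an endomorphism in the standard basis. -/
noncomputable def endMatrix (A : 𝔼 →L[ℝ] 𝔼) : Matrix (Fin n) (Fin n) ℝ :=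
  Matrix.of fun k j => A (stdVec j) k

theorem endMatrix_comp (A C : 𝔼 →L[ℝ] 𝔼) : endMatrix (A.comp C) = endMatrix A * endMatrix C := by
  ext i j
  simp only [endMatrix, Matrix.of_apply, Matrix.mul_apply, ContinuousLinearMap.comp_apply]
  conv_lhs => rw [← sum_coord_smul_stdVec (C (stdVec j))]
  simp [mul_comm]

theorem endMatrix_id : endMatrix (ContinuousLinearMap.id ℝ 𝔼) = 1 := by
  ext i j
  simp [endMatrix, stdVec, Matrix.one_apply]

theorem formMatrix_bilinearComp (b : 𝔼 →L[ℝ] 𝔼 →L[ℝ] ℝ) (A C : 𝔼 →L[ℝ] 𝔼) :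
    formMatrix (b.bilinearComp A C) = (endMatrix A)ᵀ * formMatrix b * endMatrix C := by
  ext i j
  simp only [formMatrix, endMatrix, Matrix.of_apply, Matrix.mul_apply, Matrix.transpose_apply,
    ContinuousLinearMap.bilinearComp_apply]
  rw [form_apply_right]
  refine Finset.sum_congr rfl fun k _ => ?_
  rw [form_apply_left, mul_comm]

/-- A change of coordinates acts on a form and on its Lie derivative by the same congruence, so M⁻¹L
is merely conjugated by P. -/
theorem trace_inv_mul_congruence {M L P : Matrix (Fin n) (Fin n) ℝ} (hP : IsUnit P.det) :
    ((Pᵀ * M * P)⁻¹ * (Pᵀ * L * P)).trace = (M⁻¹ * L).trace := by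
  have hPt : IsUnit Pᵀ.det := by rwa [Matrix.det_transpose]
  have h : (Pᵀ * M * P)⁻¹ * (Pᵀ * L * P) = P⁻¹ * (M⁻¹ * L * P) := by
    rw [Matrix.mul_inv_rev, Matrix.mul_inv_rev]
    simp only [mul_assoc]
    rw [← mul_assoc (Pᵀ)⁻¹ Pᵀ, Matrix.nonsing_inv_mul _ hPt, one_mul]
  rw [h, Matrix.trace_mul_comm, mul_assoc, Matrix.mul_nonsing_inv _ hP, mul_one]

end Divergence

end Sasaki


namespace Sasaki

/-! ### Naturality of the divergence, and commuting vector fields -/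

section Invariance

variable {n : ℕ}

local notation "𝔼" => EuclideanSpace ℝ (Fin n)

theorem fderiv_form_apply_fields {B : 𝔼 → 𝔼 →L[ℝ] 𝔼 →L[ℝ] ℝ} {V W : 𝔼 → 𝔼} {y : 𝔼}
    (hB : DifferentiableAt ℝ B y) (hV : DifferentiableAt ℝ V y) (hW : DifferentiableAt ℝ W y)
    (z : 𝔼) :
    fderiv ℝ (fun x => B x (V x) (W x)) y z =
      fderiv ℝ B y z (V y) (W y) + B y (fderiv ℝ V y z) (W y) + B y (V y) (fderiv ℝ W y z) := by
  rw [fderiv_clm_apply (hB.clm_apply hV) hW, fderiv_clm_apply hB hV]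
  simp
  ring

theorem fderiv_field_apply {G : Type*} [NormedAddCommGroup G] [NormedSpace ℝ G]
    {A : 𝔼 → 𝔼 →L[ℝ] G} {V : 𝔼 → 𝔼} {y : 𝔼}
    (hA : DifferentiableAt ℝ A y) (hV : DifferentiableAt ℝ V y) (z : 𝔼) :
    fderiv ℝ (fun x => A x (V x)) y z = fderiv ℝ A y z (V y) + A y (fderiv ℝ V y z) := by
  rw [fderiv_clm_apply hA hV]
  simp [add_comm]

/-- The Lie derivative of a bilinear form is natural under diffeomorphisms. -/
theorem lieForm_pullback {τ : 𝔼 → 𝔼} {B₁ B₂ : 𝔼 → 𝔼 →L[ℝ] 𝔼 →L[ℝ] ℝ} {X Y : 𝔼 → 𝔼} {y : 𝔼}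
    (hτ : ContDiffAt ℝ 2 τ y) (hB₁ : DifferentiableAt ℝ B₁ y) (hB₂ : DifferentiableAt ℝ B₂ (τ y))
    (hX : DifferentiableAt ℝ X y) (hY : DifferentiableAt ℝ Y (τ y))
    (hB : ∀ᶠ x in nhds y, B₁ x = (B₂ (τ x)).bilinearComp (fderiv ℝ τ x) (fderiv ℝ τ x))
    (hXY : ∀ᶠ x in nhds y, Y (τ x) = fderiv ℝ τ x (X x)) :
    lieForm X B₁ y = (lieForm Y B₂ (τ y)).bilinearComp (fderiv ℝ τ y) (fderiv ℝ τ y) := by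
  have hτ1 : DifferentiableAt ℝ τ y := hτ.differentiableAt (by norm_num)
  have hτ2 : DifferentiableAt ℝ (fderiv ℝ τ) y :=
    (hτ.fderiv_right (m := 1) (by norm_num)).differentiableAt (by norm_num)
  have hsymm : IsSymmSndFDerivAt ℝ τ y := hτ.isSymmSndFDerivAt (by simp)
  -- Derivative of the relation Y ∘ τ = Dτ · X; it produces a second derivative of τ.
  have hDY : ∀ v, fderiv ℝ Y (τ y) (fderiv ℝ τ y v) =
      fderiv ℝ (fderiv ℝ τ) y v (X y) + fderiv ℝ τ y (fderiv ℝ X y v) := by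
    intro v
    have := (Filter.EventuallyEq.fderiv_eq (𝕜 := ℝ) hXY)
    have h2 : fderiv ℝ (fun x => Y (τ x)) y = (fderiv ℝ Y (τ y)).comp (fderiv ℝ τ y) :=
      fderiv_comp y hY hτ1
    rw [← fderiv_field_apply hτ2 hX, ← this, h2]
    rfl
  ext v w
  have h1 : fderiv ℝ B₁ y (X y) v w = fderiv ℝ (fun x => B₂ (τ x) (fderiv ℝ τ x v) (fderiv ℝ τ x w))
      y (X y) := by
    rw [← fderiv_form_apply hB₁]
    refine congrArg (fun L : 𝔼 →L[ℝ] ℝ => L (X y)) (Filter.EventuallyEq.fderiv_eq ?_)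
    filter_upwards [hB] with x hx
    rw [hx]
    rfl
  have hv : ∀ v : 𝔼, DifferentiableAt ℝ (fun x => fderiv ℝ τ x v) y := fun v =>
    hτ2.clm_apply (differentiableAt_const v)
  have hD : ∀ v z : 𝔼, fderiv ℝ (fun x => fderiv ℝ τ x v) y z = fderiv ℝ (fderiv ℝ τ) y z v := by
    intro v z
    rw [fderiv_field_apply hτ2 (differentiableAt_const v)]
    simp
  have hB₂τ : DifferentiableAt ℝ (fun x => B₂ (τ x)) y :=
    DifferentiableAt.comp (g := B₂) y hB₂ hτ1
  have hB₂D : fderiv ℝ (fun x => B₂ (τ x)) y = (fderiv ℝ B₂ (τ y)).comp (fderiv ℝ τ y) :=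
    fderiv_comp (g := B₂) y hB₂ hτ1
  rw [fderiv_form_apply_fields hB₂τ (hv v) (hv w), hD, hD, hB₂D] at h1
  rw [lieForm_apply, h1, hB.self_of_nhds]
  simp only [ContinuousLinearMap.bilinearComp_apply, lieForm_apply, hDY, hXY.self_of_nhds,
    ContinuousLinearMap.comp_apply, map_add, add_apply]
  -- By symmetry of D²τ, the second derivatives coming from the pulled-back form match those coming
  -- from Y.
  rw [hsymm (X y) v, hsymm (X y) w]
  ring

/-- The divergence with respect to the density of a bilinear form is natural. -/
theorem divergence_pullback {τ : 𝔼 → 𝔼} {B₁ B₂ : 𝔼 → 𝔼 →L[ℝ] 𝔼 →L[ℝ] ℝ} {ρ₁ ρ₂ : 𝔼 → ℝ}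
    {X Y : 𝔼 → 𝔼} {y : 𝔼}
    (hτ : ContDiffAt ℝ 2 τ y) (hdet : IsUnit (endMatrix (fderiv ℝ τ y)).det)
    (hB₁ : DifferentiableAt ℝ B₁ y) (hB₂ : DifferentiableAt ℝ B₂ (τ y))
    (hX : DifferentiableAt ℝ X y) (hY : DifferentiableAt ℝ Y (τ y))
    (hB : ∀ᶠ x in nhds y, B₁ x = (B₂ (τ x)).bilinearComp (fderiv ℝ τ x) (fderiv ℝ τ x))
    (hXY : ∀ᶠ x in nhds y, Y (τ x) = fderiv ℝ τ x (X x))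
    (hρ₁ : DifferentiableAt ℝ ρ₁ y) (h₁ : 0 < ρ₁ y)
    (hd₁ : ∀ᶠ x in nhds y, (formMatrix (B₁ x)).det ^ 2 = ρ₁ x ^ 4)
    (hρ₂ : DifferentiableAt ℝ ρ₂ (τ y)) (h₂ : 0 < ρ₂ (τ y))
    (hd₂ : ∀ᶠ x in nhds (τ y), (formMatrix (B₂ x)).det ^ 2 = ρ₂ x ^ 4) :
    divergence ρ₁ X y = divergence ρ₂ Y (τ y) := by
  rw [divergence_eq_trace_lieForm hB₁ hρ₁ h₁ hd₁ hX, divergence_eq_trace_lieForm hB₂ hρ₂ h₂ hd₂ hY,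
    lieForm_pullback hτ hB₁ hB₂ hX hY hB hXY, hB.self_of_nhds, formMatrix_bilinearComp,
    formMatrix_bilinearComp, trace_inv_mul_congruence hdet]

/-- If two vector fields commute, then each derives the divergence of the other in the same way. -/
theorem fderiv_divergence_of_commute {T : Set 𝔼} (hT : IsOpen T) {ρ : 𝔼 → ℝ} {X Y : 𝔼 → 𝔼}
    (hρ : ContDiffOn ℝ ∞ ρ T) (h0 : ∀ y ∈ T, 0 < ρ y)
    (hX : ContDiffOn ℝ ∞ X T) (hY : ContDiffOn ℝ ∞ Y T)
    (hXY : ∀ y ∈ T, fderiv ℝ Y y (X y) = fderiv ℝ X y (Y y)) {y : 𝔼} (hy : y ∈ T) :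
    fderiv ℝ (divergence ρ Y) y (X y) = fderiv ℝ (divergence ρ X) y (Y y) := by
  have hTy : ∀ {y}, y ∈ T → T ∈ nhds y := fun h => hT.mem_nhds h
  -- With ℓ = log ρ, div Y = Dℓ(Y) + tr DY. Hence X(div Y) = D²ℓ(X, Y) + Dℓ(DY·X) + tr D²Y(X, ·),
  -- and each of the three terms turns out to be symmetric in X and Y.
  set ℓ : 𝔼 → ℝ := fun x => Real.log (ρ x) with hℓ
  have hℓs : ContDiffOn ℝ ∞ ℓ T := hρ.log fun x hx => (h0 x hx).ne'
  have hℓd : ∀ x ∈ T, ∀ v, fderiv ℝ ℓ x v = (ρ x)⁻¹ * fderiv ℝ ρ x v := by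
    intro x hx v
    have := ((hρ.differentiableOn (by simp)).differentiableAt (hTy hx)).hasFDerivAt.log
      (h0 x hx).ne'
    rw [this.fderiv]
    simp
  have key : ∀ {X Y : 𝔼 → 𝔼}, ContDiffOn ℝ ∞ X T → ContDiffOn ℝ ∞ Y T →
      fderiv ℝ (divergence ρ Y) y (X y) = fderiv ℝ (fderiv ℝ ℓ) y (X y) (Y y)
        + fderiv ℝ ℓ y (fderiv ℝ Y y (X y))
        + ∑ i, fderiv ℝ (fderiv ℝ Y) y (X y) (stdVec i) i := by
    intro X Y hX hY
    have hDY : DifferentiableAt ℝ (fderiv ℝ Y) y :=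
      ((hY.contDiffAt (hTy hy)).fderiv_right (m := 1) (by norm_cast)).differentiableAt (by simp)
    have hDℓ : DifferentiableAt ℝ (fderiv ℝ ℓ) y :=
      ((hℓs.contDiffAt (hTy hy)).fderiv_right (m := 1) (by norm_cast)).differentiableAt (by simp)
    have hYd : DifferentiableAt ℝ Y y := (hY.differentiableOn (by simp)).differentiableAt (hTy hy)
    have h1 : divergence ρ Y =ᶠ[nhds y]
        fun x => fderiv ℝ ℓ x (Y x) + ∑ i, fderiv ℝ Y x (stdVec i) i := by
      filter_upwards [hTy hy] with x hx
      rw [hℓd x hx, divergence_eq_trace_add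
        ((hρ.differentiableOn (by simp)).differentiableAt (hTy hx)) (h0 x hx).ne'
        ((hY.differentiableOn (by simp)).differentiableAt (hTy hx))]
    have hs : ∀ i, DifferentiableAt ℝ (fun x => fderiv ℝ Y x (stdVec i)) y := fun i =>
      hDY.clm_apply (differentiableAt_const _)
    rw [h1.fderiv_eq, fderiv_fun_add (hDℓ.clm_apply hYd)
      (DifferentiableAt.fun_sum fun i _ => differentiableAt_coord (hs i) i),
      fderiv_fun_sum fun i _ => differentiableAt_coord (hs i) i]
    simp only [add_apply, sum_apply]
    rw [fderiv_field_apply hDℓ hYd]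
    congr 1
    refine Finset.sum_congr rfl fun i _ => ?_
    rw [fderiv_coord (hs i), fderiv_field_apply hDY (differentiableAt_const _)]
    simp
  rw [key hX hY, key hY hX, hXY y hy]
  have hsℓ : IsSymmSndFDerivAt ℝ ℓ y :=
    (hℓs.contDiffAt (hTy hy)).isSymmSndFDerivAt (by simp; norm_cast)
  have hsX : IsSymmSndFDerivAt ℝ X y :=
    (hX.contDiffAt (hTy hy)).isSymmSndFDerivAt (by simp; norm_cast)
  have hsY : IsSymmSndFDerivAt ℝ Y y :=
    (hY.contDiffAt (hTy hy)).isSymmSndFDerivAt (by simp; norm_cast)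
  rw [hsℓ (X y) (Y y)]
  congr 1
  have hd : ∀ {X : 𝔼 → 𝔼}, ContDiffOn ℝ ∞ X T → DifferentiableAt ℝ (fderiv ℝ X) y := fun hX =>
    ((hX.contDiffAt (hTy hy)).fderiv_right (m := 1) (by norm_cast)).differentiableAt (by simp)
  have hd0 : ∀ {X : 𝔼 → 𝔼}, ContDiffOn ℝ ∞ X T → DifferentiableAt ℝ X y := fun hX =>
    (hX.differentiableOn (by simp)).differentiableAt (hTy hy)
  -- Derivative of DY·X = DX·Y along v. After taking traces the products DY∘DX and DX∘DY cancel,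
  -- which leaves the symmetry of the third term.
  have h3 : ∀ v, fderiv ℝ (fderiv ℝ Y) y (X y) v + fderiv ℝ Y y (fderiv ℝ X y v) =
      fderiv ℝ (fderiv ℝ X) y (Y y) v + fderiv ℝ X y (fderiv ℝ Y y v) := by
    intro v
    rw [hsY (X y) v, hsX (Y y) v, ← fderiv_field_apply (hd hY) (hd0 hX),
      ← fderiv_field_apply (hd hX) (hd0 hY)]
    refine congrArg (fun L : 𝔼 →L[ℝ] 𝔼 => L v) (Filter.EventuallyEq.fderiv_eq ?_)
    filter_upwards [hTy hy] with x hx using hXY x hx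
  have h4 : ∑ i, fderiv ℝ Y y (fderiv ℝ X y (stdVec i)) i
      = ∑ i, fderiv ℝ X y (fderiv ℝ Y y (stdVec i)) i := by
    have := Matrix.trace_mul_comm (endMatrix (fderiv ℝ Y y)) (endMatrix (fderiv ℝ X y))
    rw [← endMatrix_comp, ← endMatrix_comp] at this
    exact this
  have h5 : ∑ i, (fderiv ℝ (fderiv ℝ Y) y (X y) (stdVec i)
        + fderiv ℝ Y y (fderiv ℝ X y (stdVec i))) i =
      ∑ i, (fderiv ℝ (fderiv ℝ X) y (Y y) (stdVec i)
        + fderiv ℝ X y (fderiv ℝ Y y (stdVec i))) i :=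
    Finset.sum_congr rfl fun i _ => by rw [h3]
  simp only [PiLp.add_apply, Finset.sum_add_distrib] at h5
  linarith

end Invariance

end Sasaki


namespace Sasaki

/-! ### Sasakian geometry in a coordinate domain -/

section LocalSasaki

variable {n : ℕ}

local notation "𝔼" => EuclideanSpace ℝ (Fin n)

/-- The identities satisfied by the metric `G`, the Reeb field `ξ` and the transverse complex
structure `Φ` of a Sasakian manifold in a coordinate domain `T`. -/
structure IsLocalSasaki (T : Set (EuclideanSpace ℝ (Fin n)))
    (G : EuclideanSpace ℝ (Fin n) →
      EuclideanSpace ℝ (Fin n) →L[ℝ] EuclideanSpace ℝ (Fin n) →L[ℝ] ℝ)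
    (ξ : EuclideanSpace ℝ (Fin n) → EuclideanSpace ℝ (Fin n))
    (Φ : EuclideanSpace ℝ (Fin n) → EuclideanSpace ℝ (Fin n) →L[ℝ] EuclideanSpace ℝ (Fin n)) :
    Prop where
  isOpen : IsOpen T
  smooth_G : ContDiffOn ℝ ∞ G T
  smooth_ξ : ContDiffOn ℝ ∞ ξ T
  smooth_Φ : ContDiffOn ℝ ∞ Φ T
  symm : ∀ y ∈ T, ∀ v w, G y v w = G y w v
  pos : ∀ y ∈ T, ∀ v, v ≠ 0 → 0 < G y v v
  skew : ∀ y ∈ T, ∀ v w, G y (Φ y v) w = -G y v (Φ y w)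
  unit : ∀ y ∈ T, G y (ξ y) (ξ y) = 1
  Φ_ξ : ∀ y ∈ T, Φ y (ξ y) = 0
  Φ_sq : ∀ y ∈ T, ∀ v, Φ y (Φ y v) = -v + G y (ξ y) v • ξ y
  contact : ∀ y ∈ T, ∀ v w, 2 * G y (Φ y v) w =
    fderiv ℝ (fun x => G x (ξ x)) y v w - fderiv ℝ (fun x => G x (ξ x)) y w v
  lie_Φ : ∀ y ∈ T, ∀ v, fderiv ℝ Φ y (ξ y) v - fderiv ℝ ξ y (Φ y v) + Φ y (fderiv ℝ ξ y v) = 0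

namespace IsLocalSasaki

variable {T : Set (EuclideanSpace ℝ (Fin n))}
  {G : EuclideanSpace ℝ (Fin n) → EuclideanSpace ℝ (Fin n) →L[ℝ] EuclideanSpace ℝ (Fin n) →L[ℝ] ℝ}
  {ξ : EuclideanSpace ℝ (Fin n) → EuclideanSpace ℝ (Fin n)}
  {Φ : EuclideanSpace ℝ (Fin n) → EuclideanSpace ℝ (Fin n) →L[ℝ] EuclideanSpace ℝ (Fin n)}
  (h : IsLocalSasaki T G ξ Φ)
include h

theorem mem_nhds {y : 𝔼} (hy : y ∈ T) : T ∈ nhds y := h.isOpen.mem_nhds hy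

theorem differentiableAt {H : Type*} [NormedAddCommGroup H] [NormedSpace ℝ H] {f : 𝔼 → H}
    (hf : ContDiffOn ℝ ∞ f T) {y : 𝔼} (hy : y ∈ T) : DifferentiableAt ℝ f y :=
  (hf.differentiableOn (by simp)).differentiableAt (h.mem_nhds hy)

theorem differentiableAt_fderiv {H : Type*} [NormedAddCommGroup H] [NormedSpace ℝ H] {f : 𝔼 → H}
    (hf : ContDiffOn ℝ ∞ f T) {y : 𝔼} (hy : y ∈ T) : DifferentiableAt ℝ (fderiv ℝ f) y :=
  ((hf.contDiffAt (h.mem_nhds hy)).fderiv_right (m := 1) (by norm_cast)).differentiableAt (by simp)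

theorem isSymmSndFDerivAt {H : Type*} [NormedAddCommGroup H] [NormedSpace ℝ H] {f : 𝔼 → H}
    (hf : ContDiffOn ℝ ∞ f T) {y : 𝔼} (hy : y ∈ T) : IsSymmSndFDerivAt ℝ f y :=
  (hf.contDiffAt (h.mem_nhds hy)).isSymmSndFDerivAt (by simp; norm_cast)

theorem fderiv_congr {H : Type*} [NormedAddCommGroup H] [NormedSpace ℝ H] {f f' : 𝔼 → H}
    (hf : ∀ x ∈ T, f x = f' x) {y : 𝔼} (hy : y ∈ T) (v : 𝔼) : fderiv ℝ f y v = fderiv ℝ f' y v := by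
  refine congrArg (fun L : 𝔼 →L[ℝ] H => L v) (Filter.EventuallyEq.fderiv_eq ?_)
  filter_upwards [h.mem_nhds hy] with x hx using hf x hx

/-- The contact form is smooth. -/
theorem smooth_η : ContDiffOn ℝ ∞ (fun x => G x (ξ x)) T := h.smooth_G.clm_apply h.smooth_ξ

theorem smooth_β : ContDiffOn ℝ ∞ (fun x => (G x).comp (Φ x)) T := h.smooth_G.clm_comp h.smooth_Φ

/-- This is L_ξ η = 0 in coordinates: dη(ξ, ·) = 0 because Φξ = 0, and η(ξ) is constant. -/
theorem fderiv_eta_reeb {y : 𝔼} (hy : y ∈ T) (w : 𝔼) :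
    fderiv ℝ (fun x => G x (ξ x)) y (ξ y) w = -G y (ξ y) (fderiv ℝ ξ y w) := by
  have h1 := h.contact y hy (ξ y) w
  rw [h.Φ_ξ y hy] at h1
  have h2 : fderiv ℝ (fun x => G x (ξ x) (ξ x)) y w = fderiv ℝ (fun _ => (1 : ℝ)) y w :=
    h.fderiv_congr h.unit hy w
  rw [fderiv_field_apply (A := fun x => G x (ξ x)) (h.differentiableAt h.smooth_η hy)
    (h.differentiableAt h.smooth_ξ hy)] at h2
  simp at h1 h2
  linarith

/-- Since β = dη/2, derivatives of β are second derivatives of η, so that closedness of β becomes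
the symmetry of D²η. -/
theorem fderiv_β {y : 𝔼} (hy : y ∈ T) (z v w : 𝔼) :
    2 * fderiv ℝ (fun x => (G x).comp (Φ x)) y z v w =
      fderiv ℝ (fderiv ℝ (fun x => G x (ξ x))) y z v w
        - fderiv ℝ (fderiv ℝ (fun x => G x (ξ x))) y z w v := by
  have hη := h.differentiableAt_fderiv h.smooth_η hy
  have hv : ∀ v w : 𝔼, fderiv ℝ (fun x => fderiv ℝ (fun x => G x (ξ x)) x v w) y z =
      fderiv ℝ (fderiv ℝ (fun x => G x (ξ x))) y z v w := by
    intro v w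
    rw [fderiv_form_apply_fields hη (differentiableAt_const v) (differentiableAt_const w)]
    simp
  rw [← fderiv_form_apply (h.differentiableAt h.smooth_β hy), ← hv, ← hv,
    ← sub_apply, ← fderiv_fun_sub (differentiableAt_form_apply hη v w)
      (differentiableAt_form_apply hη w v)]
  have := h.fderiv_congr (h.contact · · v w) hy z
  rw [← this]
  exact (congrArg (fun L : 𝔼 →L[ℝ] ℝ => L z) (fderiv_const_mul
    (differentiableAt_form_apply (h.differentiableAt h.smooth_β hy) v w) (2 : ℝ))).symm

/-- The form `G(Φ ·, ·)` is closed. -/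
theorem β_closed {y : 𝔼} (hy : y ∈ T) (x v w : 𝔼) :
    fderiv ℝ (fun x => (G x).comp (Φ x)) y x v w =
      fderiv ℝ (fun x => (G x).comp (Φ x)) y v x w
        - fderiv ℝ (fun x => (G x).comp (Φ x)) y w x v := by
  have h1 := h.fderiv_β hy x v w
  have h2 := h.fderiv_β hy v x w
  have h3 := h.fderiv_β hy w x v
  have hs := h.isSymmSndFDerivAt h.smooth_η hy
  rw [hs x v, hs x w] at h1
  rw [hs v w] at h2
  linarith

theorem β_antisymm {y : 𝔼} (hy : y ∈ T) (v w : 𝔼) : G y (Φ y v) w = -G y (Φ y w) v := by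
  rw [h.skew y hy, h.symm y hy]

/-- Cartan's formula for the closed form `β = G(Φ ·, ·)`. -/
theorem lieForm_β {X : 𝔼 → 𝔼} {y : 𝔼} (hy : y ∈ T) (hX : DifferentiableAt ℝ X y) (v w : 𝔼) :
    lieForm X (fun x => (G x).comp (Φ x)) y v w =
      fderiv ℝ (fun x => G x (Φ x (X x)) w) y v - fderiv ℝ (fun x => G x (Φ x (X x)) v) y w := by
  have hβ := h.differentiableAt h.smooth_β hy
  have e : ∀ v w, fderiv ℝ (fun x => G x (Φ x (X x)) w) y v =
      fderiv ℝ (fun x => (G x).comp (Φ x)) y v (X y) w + G y (Φ y (fderiv ℝ X y v)) w := by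
    intro v w
    have := fderiv_form_apply_fields hβ hX (differentiableAt_const w) v
    simpa using this
  rw [lieForm_apply, e, e, h.β_closed hy]
  simp only [ContinuousLinearMap.comp_apply]
  rw [h.β_antisymm hy v]
  ring

/-- The contraction of the closed form β with ξ is zero because Φξ = 0, so Cartan's formula leaves
nothing. -/
theorem lieForm_β_reeb {y : 𝔼} (hy : y ∈ T) (v w : 𝔼) :
    lieForm ξ (fun x => (G x).comp (Φ x)) y v w = 0 := by
  rw [h.lieForm_β hy (h.differentiableAt h.smooth_ξ hy)]
  have : ∀ v w, fderiv ℝ (fun x => G x (Φ x (ξ x)) w) y v = 0 := by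
    intro v w
    rw [h.fderiv_congr (f' := fun _ => 0) (fun x hx => by simp [h.Φ_ξ x hx]) hy]
    simp
  rw [this, this, sub_zero]

/-- The Reeb field is a Killing field. -/
theorem killing {y : 𝔼} (hy : y ∈ T) : lieForm ξ G y = 0 := by
  ext v w
  have hG := h.differentiableAt h.smooth_G hy
  have hη := h.differentiableAt h.smooth_η hy
  have hβ := h.differentiableAt h.smooth_β hy
  have hΦ := h.differentiableAt h.smooth_Φ hy
  have hΦv : DifferentiableAt ℝ (fun x => Φ x v) y := hΦ.clm_apply (differentiableAt_const v)
  have hηv : ∀ v, DifferentiableAt ℝ (fun x => G x (ξ x) v) y := fun v =>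
    hη.clm_apply (differentiableAt_const v)
  -- The identity for Φ² rebuilds G as η ⊗ η - β(Φ·, ·), and ξ preserves η, β and Φ.
  have hGe : ∀ x ∈ T, ∀ v w, G x v w = G x (ξ x) v * G x (ξ x) w - G x (Φ x (Φ x v)) w := by
    intro x hx v w
    rw [h.Φ_sq x hx]
    simp
  have h1 := h.fderiv_congr (fun x hx => hGe x hx v w) hy (ξ y)
  have hβΦ : DifferentiableAt ℝ (fun x => G x (Φ x (Φ x v)) w) y :=
    (hβ.clm_apply hΦv).clm_apply (differentiableAt_const w)
  have hηe : ∀ v, fderiv ℝ (fun x => G x (ξ x) v) y (ξ y) = -G y (ξ y) (fderiv ℝ ξ y v) := by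
    intro v
    rw [fderiv_field_apply hη (differentiableAt_const v), h.fderiv_eta_reeb hy]
    simp
  have hβe : fderiv ℝ (fun x => G x (Φ x (Φ x v)) w) y (ξ y) =
      fderiv ℝ (fun x => (G x).comp (Φ x)) y (ξ y) (Φ y v) w
        + G y (Φ y (fderiv ℝ Φ y (ξ y) v)) w := by
    have := fderiv_form_apply_fields hβ hΦv (differentiableAt_const w) (ξ y)
    rw [fderiv_field_apply hΦ (differentiableAt_const v)] at this
    simpa using this
  rw [fderiv_fun_sub ((hηv v).fun_mul (hηv w)) hβΦ, fderiv_fun_mul (hηv v) (hηv w),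
    fderiv_form_apply hG] at h1
  simp only [sub_apply, add_apply, smul_apply, smul_eq_mul, hηe, hβe] at h1
  have h2 := h.lieForm_β_reeb hy (Φ y v) w
  have h3 := congrArg (fun z => G y (Φ y z) w) (h.lie_Φ y hy v)
  rw [lieForm_apply] at h2
  simp only [ContinuousLinearMap.comp_apply, map_add, map_sub, add_apply, sub_apply, map_zero,
    zero_apply] at h2 h3
  rw [lieForm_apply, h1, hGe y hy (fderiv ℝ ξ y v) w, hGe y hy v (fderiv ℝ ξ y w)]
  simp only [zero_apply]
  linarith

/-- The gradient of an invariant function commutes with the Reeb field. -/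
theorem reeb_commutes_gradient {u : 𝔼 → ℝ} {Z : 𝔼 → 𝔼} (hu : ContDiffOn ℝ ∞ u T)
    (hZ : ContDiffOn ℝ ∞ Z T) (hZu : ∀ y ∈ T, ∀ w, G y (Z y) w = fderiv ℝ u y w)
    (huξ : ∀ y ∈ T, fderiv ℝ u y (ξ y) = 0) {y : 𝔼} (hy : y ∈ T) :
    fderiv ℝ Z y (ξ y) = fderiv ℝ ξ y (Z y) := by
  have hG := h.differentiableAt h.smooth_G hy
  have hZd := h.differentiableAt hZ hy
  have hξd := h.differentiableAt h.smooth_ξ hy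
  have hu2 := h.differentiableAt_fderiv hu hy
  by_contra hne
  have hpos := h.pos y hy _ (sub_ne_zero.2 hne)
  -- The bracket of ξ and Z pairs to zero with every w. `h1` differentiates G(Z, w) = du(w) along ξ,
  -- `h2` differentiates du(ξ) = 0 along w, and `h3` is the Killing equation; the second derivatives
  -- of u cancel.
  have hw : ∀ w, G y (fderiv ℝ Z y (ξ y) - fderiv ℝ ξ y (Z y)) w = 0 := by
    intro w
    have h1 := h.fderiv_congr (fun x hx => hZu x hx w) hy (ξ y)
    rw [fderiv_form_apply_fields hG hZd (differentiableAt_const w),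
      fderiv_field_apply hu2 (differentiableAt_const w)] at h1
    have h2 := h.fderiv_congr huξ hy w
    rw [fderiv_field_apply hu2 hξd, h.isSymmSndFDerivAt hu hy w (ξ y), ← hZu y hy] at h2
    have h3 := congrArg (fun b => b (Z y) w) (h.killing hy)
    simp only [lieForm_apply] at h3
    simp at h1 h2 h3
    simp
    linarith
  rw [hw] at hpos
  exact lt_irrefl _ hpos

/-- A Killing field preserves the metric, hence its density: the trace formula is applied to L_ξ G =
0. -/
theorem divergence_reeb {ρ : 𝔼 → ℝ} (hρ : ContDiffOn ℝ ∞ ρ T) (h0 : ∀ y ∈ T, 0 < ρ y)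
    (hd : ∀ y ∈ T, (formMatrix (G y)).det = ρ y ^ 2) {y : 𝔼} (hy : y ∈ T) :
    divergence ρ ξ y = 0 := by
  rw [divergence_eq_trace_lieForm (h.differentiableAt h.smooth_G hy) (h.differentiableAt hρ hy)
    (h0 y hy) _ (h.differentiableAt h.smooth_ξ hy), h.killing hy]
  · have : formMatrix (0 : 𝔼 →L[ℝ] 𝔼 →L[ℝ] ℝ) = 0 := by
      ext i j
      simp [formMatrix]
    simp [this]
  · filter_upwards [h.mem_nhds hy] with x hx
    rw [hd x hx]
    ring

/-- The divergence of the gradient of an invariant function is invariant. -/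
theorem fderiv_divergence_gradient_reeb {ρ : 𝔼 → ℝ} (hρ : ContDiffOn ℝ ∞ ρ T)
    (h0 : ∀ y ∈ T, 0 < ρ y) (hd : ∀ y ∈ T, (formMatrix (G y)).det = ρ y ^ 2)
    {u : 𝔼 → ℝ} {Z : 𝔼 → 𝔼} (hu : ContDiffOn ℝ ∞ u T)
    (hZ : ContDiffOn ℝ ∞ Z T) (hZu : ∀ y ∈ T, ∀ w, G y (Z y) w = fderiv ℝ u y w)
    (huξ : ∀ y ∈ T, fderiv ℝ u y (ξ y) = 0) {y : 𝔼} (hy : y ∈ T) :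
    fderiv ℝ (divergence ρ Z) y (ξ y) = 0 := by
  -- ξ(div Z) = Z(div ξ), and div ξ vanishes on all of T.
  rw [fderiv_divergence_of_commute h.isOpen hρ h0 h.smooth_ξ hZ
    (fun y hy => h.reeb_commutes_gradient hu hZ hZu huξ hy) hy,
    h.fderiv_congr (f' := fun _ => 0) (fun x hx => h.divergence_reeb hρ h0 hd hx) hy]
  simp

/-- The nondegenerate form `G(Φ ·, ·) + η ⊗ η` has the same density as the metric. -/
theorem det_contactForm_sq {y : 𝔼} (hy : y ∈ T) :
    (formMatrix ((G y).comp (Φ y) + (G y (ξ y)).smulRight (G y (ξ y)))).det ^ 2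
      = (formMatrix (G y)).det ^ 2 := by
  -- The form is G(Ψ·, ·), where Ψ equals Φ on D and fixes ξ. Then Ψ⁴ = 1, which forces (det Ψ)² =
  -- 1.
  set Ψ : 𝔼 →L[ℝ] 𝔼 := Φ y + (G y (ξ y)).smulRight (ξ y) with hΨ
  have e : (G y).comp (Φ y) + (G y (ξ y)).smulRight (G y (ξ y)) =
      (G y).bilinearComp Ψ (ContinuousLinearMap.id ℝ 𝔼) := by
    ext v w
    simp [hΨ]
  have hηΦ : ∀ v, G y (ξ y) (Φ y v) = 0 := by
    intro v
    have := h.skew y hy (ξ y) v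
    rw [h.Φ_ξ y hy] at this
    simp at this
    linarith
  have hΨ2 : ∀ v, Ψ (Ψ v) = -v + (2 * G y (ξ y) v) • ξ y := by
    intro v
    simp only [hΨ, add_apply, ContinuousLinearMap.smulRight_apply, map_add, map_smul, hηΦ,
      h.Φ_ξ y hy, h.Φ_sq y hy, h.unit y hy]
    module
  have hΨ4 : (Ψ.comp Ψ).comp (Ψ.comp Ψ) = ContinuousLinearMap.id ℝ 𝔼 := by
    ext1 v
    simp only [ContinuousLinearMap.comp_apply, hΨ2, map_add, map_neg, map_smul, h.unit y hy,
      ContinuousLinearMap.id_apply]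
    module
  have hdet : (endMatrix Ψ).det ^ 4 = 1 := by
    have := congrArg (fun A => (endMatrix A).det) hΨ4
    simp only [endMatrix_comp, endMatrix_id, Matrix.det_mul, Matrix.det_one] at this
    rw [← this]
    ring
  have hdet2 : (endMatrix Ψ).det ^ 2 = 1 := by
    have h1 : ((endMatrix Ψ).det ^ 2) ^ 2 = 1 := by rw [← hdet]; ring
    exact (pow_eq_one_iff_of_nonneg (sq_nonneg _) two_ne_zero).1 h1
  rw [e, formMatrix_bilinearComp, endMatrix_id, mul_one, Matrix.det_mul, Matrix.det_transpose,
    mul_pow, hdet2, one_mul]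

/-- For an invariant function `u`, the field `Φ (grad u)` is divergence free. -/
theorem divergence_Φ_gradient {ρ : 𝔼 → ℝ} (hρ : ContDiffOn ℝ ∞ ρ T)
    (h0 : ∀ y ∈ T, 0 < ρ y) (hd : ∀ y ∈ T, (formMatrix (G y)).det = ρ y ^ 2)
    {u : 𝔼 → ℝ} {Z : 𝔼 → 𝔼} (hu : ContDiffOn ℝ ∞ u T)
    (hZ : ContDiffOn ℝ ∞ Z T) (hZu : ∀ y ∈ T, ∀ w, G y (Z y) w = fderiv ℝ u y w)
    (huξ : ∀ y ∈ T, fderiv ℝ u y (ξ y) = 0) {y : 𝔼} (hy : y ∈ T) :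
    divergence ρ (fun x => Φ x (Z x)) y = 0 := by
  -- B has the density of G up to sign, but unlike L_X G, its Lie derivative along X = Φ Z can be
  -- computed: contraction of β with X is -du, so L_X β = -d(du) = 0, and only η changes.
  set B : 𝔼 → 𝔼 →L[ℝ] 𝔼 →L[ℝ] ℝ :=
    fun x => (G x).comp (Φ x) + (G x (ξ x)).smulRight (G x (ξ x)) with hB
  have hη := h.differentiableAt h.smooth_η hy
  have hβ := h.differentiableAt h.smooth_β hy
  have hηη : DifferentiableAt ℝ (fun x => (G x (ξ x)).smulRight (G x (ξ x))) y := by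
    have hs : ∀ v, ContDiffOn ℝ ∞ (fun x => G x (ξ x) v) T := fun v =>
      h.smooth_η.clm_apply contDiffOn_const
    exact h.differentiableAt (contDiffOn_clm_apply.2 fun v => contDiffOn_clm_apply.2 fun w =>
      (hs v).mul (hs w)) hy
  have hX : DifferentiableAt ℝ (fun x => Φ x (Z x)) y :=
    (h.differentiableAt h.smooth_Φ hy).clm_apply (h.differentiableAt hZ hy)
  have hBd : DifferentiableAt ℝ B y := hβ.add hηη
  have hηZ : ∀ x ∈ T, G x (ξ x) (Z x) = 0 := fun x hx => by
    rw [h.symm x hx, hZu x hx, huξ x hx]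
  have hηX : ∀ x ∈ T, G x (ξ x) (Φ x (Z x)) = 0 := fun x hx => by
    rw [← neg_eq_zero, ← h.skew x hx, h.Φ_ξ x hx]
    simp
  have hβX : ∀ x ∈ T, ∀ w, G x (Φ x (Φ x (Z x))) w = -fderiv ℝ u x w := fun x hx w => by
    rw [h.Φ_sq x hx, hηZ x hx, ← hZu x hx]
    simp
  have hLβ : ∀ v w, lieForm (fun x => Φ x (Z x)) (fun x => (G x).comp (Φ x)) y v w = 0 := by
    intro v w
    have hu2 := h.differentiableAt_fderiv hu hy
    have e : ∀ v w, fderiv ℝ (fun x => G x (Φ x (Φ x (Z x))) w) y v =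
        -fderiv ℝ (fderiv ℝ u) y v w := by
      intro v w
      rw [h.fderiv_congr (fun x hx => hβX x hx w) hy, fderiv_fun_neg, neg_apply,
        fderiv_field_apply hu2 (differentiableAt_const w)]
      simp
    rw [h.lieForm_β hy hX, e, e, h.isSymmSndFDerivAt hu hy v w, sub_self]
  -- This is L_X η = -2 du, from η(X) = 0 and dη = 2β.
  have hLη : ∀ w, fderiv ℝ (fun x => G x (ξ x)) y (Φ y (Z y)) w
      + G y (ξ y) (fderiv ℝ (fun x => Φ x (Z x)) y w) = -2 * fderiv ℝ u y w := by
    intro w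
    have h1 := h.fderiv_congr hηX hy w
    rw [fderiv_field_apply (A := fun x => G x (ξ x)) hη hX] at h1
    have h2 := h.contact y hy (Φ y (Z y)) w
    rw [hβX y hy] at h2
    simp at h1
    linarith
  have hL : ∀ v w, lieForm (fun x => Φ x (Z x)) B y v w =
      -2 * (fderiv ℝ u y v * G y (ξ y) w + G y (ξ y) v * fderiv ℝ u y w) := by
    intro v w
    have e1 : fderiv ℝ B y = fderiv ℝ (fun x => (G x).comp (Φ x)) y
        + fderiv ℝ (fun x => (G x (ξ x)).smulRight (G x (ξ x))) y := fderiv_add hβ hηη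
    have hηv : ∀ v, DifferentiableAt ℝ (fun x => G x (ξ x) v) y := fun v =>
      hη.clm_apply (differentiableAt_const v)
    have e2 : ∀ z, fderiv ℝ (fun x => (G x (ξ x)).smulRight (G x (ξ x))) y z v w =
        fderiv ℝ (fun x => G x (ξ x)) y z v * G y (ξ y) w
          + G y (ξ y) v * fderiv ℝ (fun x => G x (ξ x)) y z w := by
      intro z
      rw [← fderiv_form_apply hηη]
      have : (fun x => (G x (ξ x)).smulRight (G x (ξ x)) v w) =
          fun x => G x (ξ x) v * G x (ξ x) w := by ext x; simp
      rw [this, fderiv_fun_mul (hηv v) (hηv w), add_apply, smul_apply, smul_apply,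
        fderiv_field_apply hη (differentiableAt_const v),
        fderiv_field_apply hη (differentiableAt_const w)]
      simp
      ring
    have h1 := hLβ v w
    rw [lieForm_apply] at h1 ⊢
    rw [e1, add_apply, add_apply, add_apply, e2]
    have h2 := hLη v
    have h3 := hLη w
    simp only [hB, add_apply, ContinuousLinearMap.smulRight_apply, smul_apply, smul_eq_mul] at h1 ⊢
    linear_combination h1 + G y (ξ y) w * h2 + G y (ξ y) v * h3
  rw [divergence_eq_trace_lieForm hBd (h.differentiableAt hρ hy) (h0 y hy) _ hX]
  swap
  · filter_upwards [h.mem_nhds hy] with x hx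
    rw [hB, h.det_contactForm_sq hx, hd x hx]
    ring
  have hu : IsUnit (formMatrix (B y)).det := by
    refine isUnit_iff_ne_zero.2 fun h' => ?_
    have h1 := h.det_contactForm_sq hy
    rw [hd y hy] at h1
    have h2 := h0 y hy
    change (formMatrix (B y)).det ^ 2 = _ at h1
    rw [h'] at h1
    simp at h1
    exact (pow_pos (pow_pos h2 2) 2).ne h1
  set M := formMatrix (B y) with hM
  set a : Fin n → ℝ := fun i => fderiv ℝ u y (stdVec i) with ha
  set b : Fin n → ℝ := fun i => G y (ξ y) (stdVec i) with hb
  -- B(·, ξ) = η = B(ξ, ·), so B⁻¹ sends η to ξ on either side. Both rank-one terms of L_X B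
  -- therefore have B-trace a multiple of du(ξ) = 0.
  have hMξ : M *ᵥ (ξ y) = b := by
    ext i
    have : B y (stdVec i) (ξ y) = G y (ξ y) (stdVec i) := by
      simp only [hB, add_apply, ContinuousLinearMap.comp_apply,
        ContinuousLinearMap.smulRight_apply, smul_apply, h.unit y hy, h.skew y hy, h.Φ_ξ y hy]
      simp
    change _ = G y (ξ y) (stdVec i)
    rw [← this, form_apply_right]
    simp [Matrix.mulVec, dotProduct, hM, formMatrix, mul_comm]
  have hξM : (ξ y) ᵥ* M = b := by
    ext i
    have : B y (ξ y) (stdVec i) = G y (ξ y) (stdVec i) := by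
      simp only [hB, add_apply, ContinuousLinearMap.comp_apply,
        ContinuousLinearMap.smulRight_apply, smul_apply, h.unit y hy, h.Φ_ξ y hy]
      simp
    change _ = G y (ξ y) (stdVec i)
    rw [← this, form_apply_left]
    simp [Matrix.vecMul, dotProduct, hM, formMatrix]
  have hN : formMatrix (lieForm (fun x => Φ x (Z x)) B y) =
      (-2 : ℝ) • (Matrix.vecMulVec a b + Matrix.vecMulVec b a) := by
    ext i j
    simp only [formMatrix, Matrix.of_apply, hL, Matrix.smul_apply, Matrix.add_apply,
      Matrix.vecMulVec_apply, smul_eq_mul, ha, hb]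
  have haξ : a ⬝ᵥ (ξ y) = 0 := by
    rw [← huξ y hy, form_apply_right (fderiv ℝ u y)]
    simp [dotProduct, ha, mul_comm]
  have h1 : (M⁻¹ * Matrix.vecMulVec b a).trace = 0 := by
    rw [Matrix.mul_vecMulVec, Matrix.trace_vecMulVec, ← hMξ, Matrix.mulVec_mulVec,
      Matrix.nonsing_inv_mul _ hu, Matrix.one_mulVec, dotProduct_comm]
    exact haξ
  have h2 : (M⁻¹ * Matrix.vecMulVec a b).trace = 0 := by
    rw [Matrix.trace_mul_comm, Matrix.vecMulVec_mul, Matrix.trace_vecMulVec, ← hξM,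
      Matrix.vecMul_vecMul, Matrix.mul_nonsing_inv _ hu, Matrix.vecMul_one]
    exact haξ
  rw [hN, Matrix.mul_smul, mul_add, Matrix.trace_smul, Matrix.trace_add, h1, h2]
  simp

end IsLocalSasaki

end LocalSasaki

end Sasaki


namespace Sasaki

/-! ### Vector fields and Lie brackets in a chart -/

section Chart

open VectorField

variable {E : Type*} [NormedAddCommGroup E] [NormedSpace ℝ E]
  {H : Type*} [TopologicalSpace H] {I : ModelWithCorners ℝ E H}
  {M : Type*} [TopologicalSpace M] [ChartedSpace H M] [IsManifold I ∞ M]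

theorem isManifold_one : IsManifold I 1 M := IsManifold.of_le (n := ∞) (by norm_cast)

/-- The differential of the inverse of the chart at `c`, at the point with coordinates `y`. -/
noncomputable def chartDeriv (I : ModelWithCorners ℝ E H) (c : M) (y : E) :
    E →L[ℝ] TangentSpace I ((extChartAt I c).symm y) :=
  mfderiv 𝓘(ℝ, E) I (extChartAt I c).symm y

/-- The differential of the chart at `c`, at the point with coordinates `y`. -/
noncomputable def chartDerivInv (I : ModelWithCorners ℝ E H) (c : M) (y : E) :
    TangentSpace I ((extChartAt I c).symm y) →L[ℝ] E :=
  mfderiv I 𝓘(ℝ, E) (extChartAt I c) ((extChartAt I c).symm y)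

/-- The components in the chart at `c` of a vector field on a manifold. -/
noncomputable def fieldInChart (I : ModelWithCorners ℝ E H) (c : M) (V : ∀ x : M, TangentSpace I x)
    (y : E) : E :=
  chartDerivInv I c y (V ((extChartAt I c).symm y))

/-- The vector field on a manifold given in the chart at `c` by `X`. -/
noncomputable def chartField (I : ModelWithCorners ℝ E H) (c : M) (X : E → E) (x : M) :
    TangentSpace I x :=
  mpullback I 𝓘(ℝ, E) (extChartAt I c) (fun y => (X y : TangentSpace 𝓘(ℝ, E) y)) x

variable [I.Boundaryless] {c : M} {y : E}

theorem contMDiffAt_chart_symm (hy : y ∈ (extChartAt I c).target) :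
    ContMDiffAt 𝓘(ℝ, E) I ∞ (extChartAt I c).symm y :=
  (contMDiffOn_extChartAt_symm c).contMDiffAt ((isOpen_extChartAt_target c).mem_nhds hy)

theorem chartDeriv_chartDerivInv (hy : y ∈ (extChartAt I c).target)
    (v : TangentSpace I ((extChartAt I c).symm y)) : chartDeriv I c y (chartDerivInv I c y v) = v := by
  have : IsManifold I 1 M := isManifold_one (I := I)
  have h1 := mfderivWithin_extChartAt_symm_comp_mfderiv_extChartAt (I := I) hy
  rw [I.range_eq_univ, mfderivWithin_univ] at h1
  exact congrArg (fun L => L v) h1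

theorem chartDerivInv_chartDeriv (hy : y ∈ (extChartAt I c).target) (v : E) :
    chartDerivInv I c y (chartDeriv I c y v) = v := by
  have : IsManifold I 1 M := isManifold_one (I := I)
  have h1 := mfderiv_extChartAt_comp_mfderivWithin_extChartAt_symm (I := I) hy
  rw [I.range_eq_univ, mfderivWithin_univ] at h1
  exact congrArg (fun L => L v) h1

theorem chartDeriv_injective (hy : y ∈ (extChartAt I c).target) :
    Function.Injective (chartDeriv I c y) :=
  Function.LeftInverse.injective (chartDerivInv_chartDeriv hy)

theorem chartDeriv_fieldInChart (hy : y ∈ (extChartAt I c).target)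
    (V : ∀ x : M, TangentSpace I x) :
    chartDeriv I c y (fieldInChart I c V y) = V ((extChartAt I c).symm y) :=
  chartDeriv_chartDerivInv hy _

/-- `mpullback` uses the formal inverse of a differential. Identifying that inverse with the
differential of the chart makes the general results on smoothness and brackets of pullbacks
available for components. -/
theorem mpullback_chart_symm (hy : y ∈ (extChartAt I c).target)
    (V : ∀ x : M, TangentSpace I x) :
    mpullback 𝓘(ℝ, E) I (extChartAt I c).symm V y = fieldInChart I c V y := by
  have h : (mfderiv 𝓘(ℝ, E) I (extChartAt I c).symm y).inverse = chartDerivInv I c y :=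
    ContinuousLinearMap.inverse_eq
      (ContinuousLinearMap.ext fun v => chartDeriv_chartDerivInv (I := I) hy v)
      (ContinuousLinearMap.ext fun v => chartDerivInv_chartDeriv (I := I) hy v)
  exact congrArg (fun L : TangentSpace I ((extChartAt I c).symm y) →L[ℝ] E => L (V _)) h

theorem chartField_apply (hy : y ∈ (extChartAt I c).target) (X : E → E) :
    chartField I c X ((extChartAt I c).symm y) = chartDeriv I c y (X y) := by
  have h : (mfderiv I 𝓘(ℝ, E) (extChartAt I c) ((extChartAt I c).symm y)).inverse =
      chartDeriv I c y :=
    ContinuousLinearMap.inverse_eq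
      (ContinuousLinearMap.ext fun v => chartDerivInv_chartDeriv (I := I) hy v)
      (ContinuousLinearMap.ext fun v => chartDeriv_chartDerivInv (I := I) hy v)
  have h2 := congrArg (fun L : E →L[ℝ] TangentSpace I ((extChartAt I c).symm y) =>
    L (X (extChartAt I c ((extChartAt I c).symm y)))) h
  refine h2.trans ?_
  rw [(extChartAt I c).right_inv hy]

theorem fieldInChart_chartField (hy : y ∈ (extChartAt I c).target) (X : E → E) :
    fieldInChart I c (chartField I c X) y = X y := by
  apply chartDeriv_injective (I := I) hy
  rw [chartDeriv_fieldInChart hy, chartField_apply hy]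

-- Coordinate expressions thus provide smooth test fields, to be inserted in the conditions that
-- define a Sasakian structure.
omit [I.Boundaryless] in
theorem contMDiffAt_chartField [CompleteSpace E] (hy : y ∈ (extChartAt I c).target) {X : E → E}
    (hX : ContDiffAt ℝ ∞ X y) :
    ContMDiffAt I I.tangent ∞ (fun x => (⟨x, chartField I c X x⟩ : TangentBundle I M))
      ((extChartAt I c).symm y) := by
  have : IsManifold I 1 M := isManifold_one (I := I)
  have hs : (extChartAt I c).symm y ∈ (extChartAt I c).source := (extChartAt I c).map_target hy
  refine ContMDiffAt.mpullback_vectorField_preimage (n := ∞) ?_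
    (contMDiffAt_extChartAt' (by rwa [← extChartAt_source I])) (isInvertible_mfderiv_extChartAt hs)
    (by simp)
  rw [(extChartAt I c).right_inv hy]
  exact contMDiffAt_vectorSpace_iff_contDiffAt.2 hX

theorem contDiffAt_fieldInChart [CompleteSpace E] (hy : y ∈ (extChartAt I c).target)
    {V : ∀ x : M, TangentSpace I x}
    (hV : ContMDiffAt I I.tangent ∞ (fun x => (⟨x, V x⟩ : TangentBundle I M))
      ((extChartAt I c).symm y)) :
    ContDiffAt ℝ ∞ (fieldInChart I c V) y := by
  have : IsManifold I 1 M := isManifold_one (I := I)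
  have hi : (mfderiv 𝓘(ℝ, E) I (extChartAt I c).symm y).IsInvertible := by
    have := isInvertible_mfderivWithin_extChartAt_symm (I := I) hy
    rwa [I.range_eq_univ, mfderivWithin_univ] at this
  have h := contMDiffAt_vectorSpace_iff_contDiffAt.1
    (ContMDiffAt.mpullback_vectorField_preimage (n := ∞) hV (contMDiffAt_chart_symm hy) hi (by simp))
  refine h.congr_of_eventuallyEq ?_
  filter_upwards [(isOpen_extChartAt_target c).mem_nhds hy] with z hz
  exact (mpullback_chart_symm hz V).symm

theorem mlieBracket_vectorSpace (X Y : ∀ y : E, TangentSpace 𝓘(ℝ, E) y) (y : E) :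
    mlieBracket 𝓘(ℝ, E) X Y y = lieBracket ℝ X Y y := by
  rw [← mlieBracketWithin_univ, mlieBracketWithin_eq_lieBracketWithin]
  exact congrFun lieBracketWithin_univ y

/-- The Lie bracket of vector fields in a chart. -/
theorem mlieBracket_chart [CompleteSpace E] (hy : y ∈ (extChartAt I c).target)
    {V W : ∀ x : M, TangentSpace I x}
    (hV : ContMDiffAt I I.tangent ∞ (fun x => (⟨x, V x⟩ : TangentBundle I M))
      ((extChartAt I c).symm y))
    (hW : ContMDiffAt I I.tangent ∞ (fun x => (⟨x, W x⟩ : TangentBundle I M))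
      ((extChartAt I c).symm y)) {X Y : E → E}
    (hX : ∀ z ∈ (extChartAt I c).target, fieldInChart I c V z = X z)
    (hY : ∀ z ∈ (extChartAt I c).target, fieldInChart I c W z = Y z) :
    mlieBracket I V W ((extChartAt I c).symm y) =
      chartDeriv I c y (fderiv ℝ Y y (X y) - fderiv ℝ X y (Y y)) := by
  have : IsManifold I (minSmoothness ℝ 2) M :=
    IsManifold.of_le (n := ∞) (by simp; norm_cast)
  have h := mpullback_mlieBracket (I := 𝓘(ℝ, E)) (I' := I) (n := ∞)
    (hV.mdifferentiableAt (by simp)) (hW.mdifferentiableAt (by simp))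
    (contMDiffAt_chart_symm hy) (by simp; norm_cast)
  rw [← chartDeriv_fieldInChart (I := I) hy (mlieBracket I V W), ← mpullback_chart_symm hy, h]
  congr 1
  have hT := (isOpen_extChartAt_target (I := I) c).mem_nhds hy
  have hX' : mpullback 𝓘(ℝ, E) I (extChartAt I c).symm V =ᶠ[nhds y] X := by
    filter_upwards [hT] with z hz
    exact (mpullback_chart_symm hz V).trans (hX z hz)
  have hY' : mpullback 𝓘(ℝ, E) I (extChartAt I c).symm W =ᶠ[nhds y] Y := by
    filter_upwards [hT] with z hz
    exact (mpullback_chart_symm hz W).trans (hY z hz)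
  exact (hX'.mlieBracket_vectorField_eq hY').trans (mlieBracket_vectorSpace X Y y)

/-- The derivative of a function along a tangent vector, computed in a chart. -/
theorem fderiv_comp_chart_symm {F : Type*} [NormedAddCommGroup F] [NormedSpace ℝ F]
    (hy : y ∈ (extChartAt I c).target) {f : M → F}
    (hf : MDifferentiableAt I 𝓘(ℝ, F) f ((extChartAt I c).symm y)) (v : E) :
    fderiv ℝ (fun z => f ((extChartAt I c).symm z)) y v =
      mfderiv I 𝓘(ℝ, F) f ((extChartAt I c).symm y) (chartDeriv I c y v) := by
  have h := mfderiv_comp (I := 𝓘(ℝ, E)) (I' := I) (I'' := 𝓘(ℝ, F)) y hf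
    ((contMDiffAt_chart_symm (I := I) hy).mdifferentiableAt (by simp))
  rw [mfderiv_eq_fderiv] at h
  exact congrArg (fun L : E →L[ℝ] F => L v) h

end Chart

end Sasaki


namespace Sasaki

/-! ### Product charts of the cone -/

section ConeChart

/-- The half-line is an open subset of ℝ, and its chart at any point is the whole inclusion; the
radial coordinate is r itself. -/
theorem posReals_extChartAt_source (r : posReals) : (extChartAt 𝓘(ℝ, ℝ) r).source = Set.univ := by
  rw [extChartAt_source]
  change ((chartAt ℝ (r : ℝ)).subtypeRestr ⟨r⟩).source = _
  rw [OpenPartialHomeomorph.subtypeRestr_source, chartAt_self_eq]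
  rfl

theorem mem_posReals_extChartAt_target (r : posReals) {t : ℝ} (ht : 0 < t) :
    t ∈ (extChartAt 𝓘(ℝ, ℝ) r).target :=
  (extChartAt 𝓘(ℝ, ℝ) r).map_source (x := ⟨t, ht⟩) (by rw [posReals_extChartAt_source]; trivial)

theorem posReals_extChartAt_symm (r : posReals) {t : ℝ} (ht : 0 < t) :
    (extChartAt 𝓘(ℝ, ℝ) r).symm t = ⟨t, ht⟩ :=
  (extChartAt 𝓘(ℝ, ℝ) r).left_inv (x := ⟨t, ht⟩) (by rw [posReals_extChartAt_source]; trivial)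

theorem posReals_chartDeriv (r : posReals) {t : ℝ} (ht : 0 < t) (a : ℝ) :
    mfderiv 𝓘(ℝ, ℝ) 𝓘(ℝ, ℝ) (extChartAt 𝓘(ℝ, ℝ) r).symm t a = a := by
  have hd : MDifferentiableAt 𝓘(ℝ, ℝ) 𝓘(ℝ, ℝ) (extChartAt 𝓘(ℝ, ℝ) r).symm t :=
    (contMDiffAt_chart_symm (mem_posReals_extChartAt_target r ht)).mdifferentiableAt (by simp)
  rw [hd.mfderiv, ModelWithCorners.range_eq_univ, fderivWithin_univ]
  have h : writtenInExtChartAt 𝓘(ℝ, ℝ) 𝓘(ℝ, ℝ) t (extChartAt 𝓘(ℝ, ℝ) r).symm =ᶠ[nhds t] id := by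
    filter_upwards [Ioi_mem_nhds ht] with s hs
    simp only [writtenInExtChartAt, extChartAt_model_space_eq_id, PartialEquiv.refl_symm,
      PartialEquiv.refl_coe, Function.comp_id, Function.comp_apply, id]
    change (((extChartAt 𝓘(ℝ, ℝ) r).symm s : posReals) : ℝ) = s
    rw [posReals_extChartAt_symm r hs]
  have h2 := h.fderiv_eq (𝕜 := ℝ)
  rw [fderiv_id] at h2
  exact congrArg (fun L : ℝ →L[ℝ] ℝ => L a) h2

variable {n : ℕ} {S : Type*} [TopologicalSpace S] [ChartedSpace (EuclideanSpace ℝ (Fin n)) S]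

local notation "𝔼" => EuclideanSpace ℝ (Fin n)

theorem mem_cone_target {c : S} {y : 𝔼} (hy : y ∈ (extChartAt (𝓡 n) c).target) {t : ℝ}
    (ht : 0 < t) : (y, t) ∈ (extChartAt (coneModel n) (atOne c)).target := by
  rw [extChartAt_prod]
  exact ⟨hy, mem_posReals_extChartAt_target _ ht⟩

theorem mem_target_of_mem_cone_target {c : S} {z : 𝔼 × ℝ}
    (hz : z ∈ (extChartAt (coneModel n) (atOne c)).target) :
    z.1 ∈ (extChartAt (𝓡 n) c).target := by
  rw [extChartAt_prod] at hz
  exact hz.1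

theorem pos_of_mem_cone_target {c : S} {z : 𝔼 × ℝ}
    (hz : z ∈ (extChartAt (coneModel n) (atOne c)).target) : 0 < z.2 := by
  rw [extChartAt_prod] at hz
  have h := (extChartAt 𝓘(ℝ, ℝ) (atOne c).2).right_inv hz.2
  have h2 : (((extChartAt 𝓘(ℝ, ℝ) (atOne c).2).symm z.2 : posReals) : ℝ) = z.2 := h
  rw [← h2]
  exact ((extChartAt 𝓘(ℝ, ℝ) (atOne c).2).symm z.2).2

theorem cone_chart_symm {c : S} {z : 𝔼 × ℝ} (hz : 0 < z.2) :
    (extChartAt (coneModel n) (atOne c)).symm z = ((extChartAt (𝓡 n) c).symm z.1, ⟨z.2, hz⟩) := by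
  rw [← posReals_extChartAt_symm (atOne c).2 hz]
  rfl

theorem cone_chart_symm_snd {c : S} {z : 𝔼 × ℝ} (hz : 0 < z.2) :
    (((extChartAt (coneModel n) (atOne c)).symm z).2 : ℝ) = z.2 := by
  rw [cone_chart_symm hz]

variable [IsManifold (𝓡 n) ∞ S]

/-- The chart at (c, 1) is the product of the chart at c with the inclusion of the half-line, whose
differential is the identity. -/
theorem cone_chartDeriv {c : S} {z : 𝔼 × ℝ} (hy : z.1 ∈ (extChartAt (𝓡 n) c).target)
    (ht : 0 < z.2) (v : 𝔼 × ℝ) :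
    chartDeriv (coneModel n) (atOne c) z v =
      coneVec ((extChartAt (coneModel n) (atOne c)).symm z) (chartDeriv (𝓡 n) c z.1 v.1) v.2 := by
  have h1 : MDifferentiableAt 𝓘(ℝ, 𝔼) (𝓡 n) (extChartAt (𝓡 n) c).symm z.1 :=
    (contMDiffAt_chart_symm hy).mdifferentiableAt (by simp)
  have h2 : MDifferentiableAt 𝓘(ℝ, ℝ) 𝓘(ℝ, ℝ) (extChartAt 𝓘(ℝ, ℝ) (atOne c).2).symm z.2 :=
    (contMDiffAt_chart_symm (mem_posReals_extChartAt_target _ ht)).mdifferentiableAt (by simp)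
  have h := mfderiv_prodMap (p := z) h1 h2
  have h3 := congrArg (fun L => L v) h
  have h4 : chartDeriv (coneModel n) (atOne c) z v = mfderiv (𝓘(ℝ, 𝔼).prod 𝓘(ℝ, ℝ)) (coneModel n)
      (Prod.map (extChartAt (𝓡 n) c).symm (extChartAt 𝓘(ℝ, ℝ) (atOne c).2).symm) z v := by
    rw [chartDeriv, modelWithCornersSelf_prod, ← chartedSpaceSelf_prod]
    rfl
  refine h4.trans (h3.trans ?_)
  refine Prod.ext rfl ?_
  exact posReals_chartDeriv _ ht v.2

end ConeChart

end Sasaki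


namespace Sasaki

/-! ### The metric in a chart -/

section MetricChart

variable {n : ℕ} {S : Type*} [TopologicalSpace S] [ChartedSpace (EuclideanSpace ℝ (Fin n)) S]
  [IsManifold (𝓡 n) ∞ S]

local notation "𝔼" => EuclideanSpace ℝ (Fin n)

/-- The metric in the chart at `c`. -/
noncomputable def metricInChart (g : Metric n S) (c : S) (y : EuclideanSpace ℝ (Fin n)) :
    EuclideanSpace ℝ (Fin n) →L[ℝ] EuclideanSpace ℝ (Fin n) →L[ℝ] ℝ :=
  ContinuousLinearMap.bilinearComp
    -- The identity maps only retype the tangent spaces, which unfold to the model space, so that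
    -- the result is a function into one fixed space.
    (@id (𝔼 →L[ℝ] 𝔼 →L[ℝ] ℝ) (g.inner ((extChartAt (𝓡 n) c).symm y)))
    (@id (𝔼 →L[ℝ] 𝔼) (chartDeriv (𝓡 n) c y)) (@id (𝔼 →L[ℝ] 𝔼) (chartDeriv (𝓡 n) c y))

theorem metricInChart_apply (g : Metric n S) (c : S) (y v w : 𝔼) :
    metricInChart g c y v w = g.inner ((extChartAt (𝓡 n) c).symm y)
      (chartDeriv (𝓡 n) c y v) (chartDeriv (𝓡 n) c y w) := rfl

theorem gram_eq_formMatrix (g : Metric n S) (c : S) (y : 𝔼) :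
    gram g c y = formMatrix (metricInChart g c y) := rfl

/-- Smoothness of the metric as a section is tested on the fields with constant components. -/
theorem contDiffOn_metricInChart (g : Metric n S) (c : S) :
    ContDiffOn ℝ ∞ (metricInChart g c) (extChartAt (𝓡 n) c).target := by
  refine contDiffOn_clm_apply.2 fun v => contDiffOn_clm_apply.2 fun w y hy => ?_
  have hφ : ContMDiffAt 𝓘(ℝ, 𝔼) (𝓡 n) ∞ (extChartAt (𝓡 n) c).symm y := contMDiffAt_chart_symm hy
  have hs : ∀ v : 𝔼, ContMDiffAt 𝓘(ℝ, 𝔼) (𝓡 n).tangent ∞ (fun z =>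
      (⟨(extChartAt (𝓡 n) c).symm z, chartField (𝓡 n) c (fun _ => v)
        ((extChartAt (𝓡 n) c).symm z)⟩ : TangentBundle (𝓡 n) S)) y := fun v =>
    ContMDiffAt.comp y (contMDiffAt_chartField hy contDiffAt_const) hφ
  have hg : ContMDiffAt 𝓘(ℝ, 𝔼) ((𝓡 n).prod 𝓘(ℝ, 𝔼 →L[ℝ] 𝔼 →L[ℝ] ℝ)) ∞ (fun z =>
      Bundle.TotalSpace.mk' (𝔼 →L[ℝ] 𝔼 →L[ℝ] ℝ)
        (E := fun p : S => TangentSpace (𝓡 n) p →L[ℝ] TangentSpace (𝓡 n) p →L[ℝ] ℝ)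
        ((extChartAt (𝓡 n) c).symm z) (g.inner ((extChartAt (𝓡 n) c).symm z))) y :=
    ContMDiffAt.comp y (g.contMDiff _) hφ
  have h := ContMDiffAt.clm_bundle_apply₂ (F₁ := 𝔼) (F₂ := 𝔼) (E₃ := Bundle.Trivial S ℝ) hg
    (hs v) (hs w)
  rw [Bundle.contMDiffAt_totalSpace] at h
  have h2 : ContDiffAt ℝ ∞ (fun z => g.inner ((extChartAt (𝓡 n) c).symm z)
      (chartField (𝓡 n) c (fun _ => v) ((extChartAt (𝓡 n) c).symm z))
      (chartField (𝓡 n) c (fun _ => w) ((extChartAt (𝓡 n) c).symm z))) y :=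
    contMDiffAt_iff_contDiffAt.1 h.2
  refine (h2.congr_of_eventuallyEq ?_).contDiffWithinAt
  filter_upwards [(isOpen_extChartAt_target c).mem_nhds hy] with z hz
  rw [chartField_apply hz, chartField_apply hz, metricInChart_apply]

theorem metricInChart_symm (g : Metric n S) (c : S) (y v w : 𝔼) :
    metricInChart g c y v w = metricInChart g c y w v := g.symm _ _ _

theorem metricInChart_pos (g : Metric n S) {c : S} {y : 𝔼} (hy : y ∈ (extChartAt (𝓡 n) c).target)
    (v : 𝔼) (hv : v ≠ 0) : 0 < metricInChart g c y v v := by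
  refine g.pos _ _ fun h => hv (chartDeriv_injective (I := 𝓡 n) hy ?_)
  exact h.trans (map_zero _).symm

end MetricChart

/-! ### The complex structure of the cone in a product chart -/

namespace SasakianStructure

variable {m : ℕ} {S : Type*} [TopologicalSpace S]
    [ChartedSpace (EuclideanSpace ℝ (Fin (2 * m + 1))) S] [IsManifold (𝓡 (2 * m + 1)) ∞ S]
    (𝓢 : SasakianStructure m S)

local notation "𝔼" => EuclideanSpace ℝ (Fin (2 * m + 1))
local notation "𝕀" => coneModel (2 * m + 1)

/-- The complex structure of the cone in the product chart at `(c, 1)`. -/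
noncomputable def JInChart (c : S) (z : EuclideanSpace ℝ (Fin (2 * m + 1)) × ℝ) :
    EuclideanSpace ℝ (Fin (2 * m + 1)) × ℝ →L[ℝ] EuclideanSpace ℝ (Fin (2 * m + 1)) × ℝ :=
  (chartDerivInv 𝕀 (atOne c) z : 𝔼 × ℝ →L[ℝ] 𝔼 × ℝ).comp
    ((𝓢.J ((extChartAt 𝕀 (atOne c)).symm z) : 𝔼 × ℝ →L[ℝ] 𝔼 × ℝ).comp
      (chartDeriv 𝕀 (atOne c) z : 𝔼 × ℝ →L[ℝ] 𝔼 × ℝ))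

variable {c : S} {z : EuclideanSpace ℝ (Fin (2 * m + 1)) × ℝ}
  (hz : z ∈ (extChartAt (coneModel (2 * m + 1)) (atOne c)).target)
include hz

theorem chartDeriv_JInChart (v : 𝔼 × ℝ) :
    chartDeriv 𝕀 (atOne c) z (𝓢.JInChart c z v) = 𝓢.J _ (chartDeriv 𝕀 (atOne c) z v) :=
  chartDeriv_chartDerivInv hz _

theorem fieldInChart_J (V : ∀ x : Cone S, TangentSpace 𝕀 x) :
    fieldInChart 𝕀 (atOne c) (fun x => 𝓢.J x (V x)) z =
      𝓢.JInChart c z (fieldInChart 𝕀 (atOne c) V z) := by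
  apply chartDeriv_injective (I := 𝕀) hz
  rw [chartDeriv_JInChart 𝓢 hz, chartDeriv_fieldInChart hz, chartDeriv_fieldInChart hz]

omit hz in
theorem smoothFieldAt_J {V : ∀ x : Cone S, TangentSpace 𝕀 x} {x : Cone S}
    (hV : SmoothFieldAt V x) : SmoothFieldAt (fun x => 𝓢.J x (V x)) x :=
  ContMDiffAt.clm_bundle_apply (F₁ := 𝔼 × ℝ) (F₂ := 𝔼 × ℝ) (b := fun x => x) (𝓢.smooth_J x) hV

-- J carries the fields with constant components to smooth fields, whose components are the columns
-- of the matrix of J.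
omit hz in
theorem contDiffOn_JInChart (c : S) :
    ContDiffOn ℝ ∞ (𝓢.JInChart c) (extChartAt 𝕀 (atOne c)).target := by
  refine contDiffOn_clm_apply.2 fun v z hz => ?_
  have h := contDiffAt_fieldInChart (I := 𝕀) hz
    (𝓢.smoothFieldAt_J (contMDiffAt_chartField (I := 𝕀) hz (contDiffAt_const (c := v))))
  refine (h.congr_of_eventuallyEq ?_).contDiffWithinAt
  filter_upwards [(isOpen_extChartAt_target (I := 𝕀) (atOne c)).mem_nhds hz] with x hx
  rw [fieldInChart_J 𝓢 hx, fieldInChart_chartField hx]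

theorem differentiableAt_JInChart : DifferentiableAt ℝ (𝓢.JInChart c) z :=
  ((𝓢.contDiffOn_JInChart c).differentiableOn (by simp)).differentiableAt
    ((isOpen_extChartAt_target (I := 𝕀) (atOne c)).mem_nhds hz)

theorem JInChart_sq (v : 𝔼 × ℝ) : 𝓢.JInChart c z (𝓢.JInChart c z v) = -v := by
  apply chartDeriv_injective (I := 𝕀) hz
  rw [chartDeriv_JInChart 𝓢 hz, chartDeriv_JInChart 𝓢 hz, 𝓢.J_sq, map_neg]

/-- The cone metric in the product chart. -/
theorem coneMetric_chartDeriv (v w : 𝔼 × ℝ) :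
    coneMetric 𝓢.g ((extChartAt 𝕀 (atOne c)).symm z) (chartDeriv 𝕀 (atOne c) z v)
      (chartDeriv 𝕀 (atOne c) z w) =
      v.2 * w.2 + z.2 ^ 2 * metricInChart 𝓢.g c z.1 v.1 w.1 := by
  have h1 := mem_target_of_mem_cone_target hz
  have h2 := pos_of_mem_cone_target hz
  rw [cone_chartDeriv h1 h2, cone_chartDeriv h1 h2, coneMetric, cone_chart_symm_snd h2]
  rfl

theorem JInChart_hermitian (v w : 𝔼 × ℝ) :
    (𝓢.JInChart c z v).2 * (𝓢.JInChart c z w).2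
      + z.2 ^ 2 * metricInChart 𝓢.g c z.1 (𝓢.JInChart c z v).1 (𝓢.JInChart c z w).1 =
      v.2 * w.2 + z.2 ^ 2 * metricInChart 𝓢.g c z.1 v.1 w.1 := by
  rw [← coneMetric_chartDeriv 𝓢 hz, ← coneMetric_chartDeriv 𝓢 hz, chartDeriv_JInChart 𝓢 hz,
    chartDeriv_JInChart 𝓢 hz, 𝓢.hermitian]

/-- The Hermitian identity for Jv and w, combined with J² = -1. -/
theorem JInChart_skew (v w : 𝔼 × ℝ) :
    (𝓢.JInChart c z v).2 * w.2 + z.2 ^ 2 * metricInChart 𝓢.g c z.1 (𝓢.JInChart c z v).1 w.1 =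
      -(v.2 * (𝓢.JInChart c z w).2
        + z.2 ^ 2 * metricInChart 𝓢.g c z.1 v.1 (𝓢.JInChart c z w).1) := by
  have h := JInChart_hermitian 𝓢 hz (𝓢.JInChart c z v) w
  rw [JInChart_sq 𝓢 hz] at h
  rw [← h]
  simp
  ring

theorem chartDeriv_euler :
    chartDeriv 𝕀 (atOne c) z (0, z.2) = euler (2 * m + 1) ((extChartAt 𝕀 (atOne c)).symm z) := by
  have h1 := mem_target_of_mem_cone_target hz
  have h2 := pos_of_mem_cone_target hz
  rw [cone_chartDeriv h1 h2, euler, cone_chart_symm_snd h2, map_zero]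
  rfl

theorem fieldInChart_euler : fieldInChart 𝕀 (atOne c) (euler (2 * m + 1)) z = (0, z.2) := by
  apply chartDeriv_injective (I := 𝕀) hz
  rw [chartDeriv_fieldInChart hz, chartDeriv_euler hz]

theorem smoothFieldAt_euler :
    SmoothFieldAt (euler (2 * m + 1)) ((extChartAt 𝕀 (atOne c)).symm z) := by
  have h := contMDiffAt_chartField (I := 𝕀) hz (X := fun z : 𝔼 × ℝ => ((0 : 𝔼), z.2))
    (contDiffAt_const.prodMk contDiffAt_snd)
  refine h.congr_of_eventuallyEq ?_
  have hs := (extChartAt 𝕀 (atOne c)).map_target hz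
  filter_upwards [(isOpen_extChartAt_source (I := 𝕀) (atOne c)).mem_nhds hs] with x hx
  have hx' := (extChartAt 𝕀 (atOne c)).map_source hx
  have e := (extChartAt 𝕀 (atOne c)).left_inv hx
  rw [← e, chartField_apply hx', chartDeriv_euler hx']

end SasakianStructure

end Sasaki


namespace Sasaki

/-- `dirDeriv` is an `mfderiv`, which is zero by default at points of non-differentiability. It can
be computed in coordinates only once differentiability on the manifold is known. -/
theorem mdifferentiableAt_of_comp_chart_symm {E : Type*} [NormedAddCommGroup E] [NormedSpace ℝ E]
    {H : Type*} [TopologicalSpace H] {I : ModelWithCorners ℝ E H} [I.Boundaryless]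
    {M : Type*} [TopologicalSpace M] [ChartedSpace H M] [IsManifold I ∞ M]
    {F : Type*} [NormedAddCommGroup F] [NormedSpace ℝ F] {c : M} {y : E}
    (hy : y ∈ (extChartAt I c).target) {f : M → F}
    (hf : DifferentiableAt ℝ (fun z => f ((extChartAt I c).symm z)) y) :
    MDifferentiableAt I 𝓘(ℝ, F) f ((extChartAt I c).symm y) := by
  have hs := (extChartAt I c).map_target hy
  have h1 : MDifferentiableAt I 𝓘(ℝ, E) (extChartAt I c) ((extChartAt I c).symm y) :=
    (contMDiffAt_extChartAt' (n := ∞) (by rwa [← extChartAt_source I])).mdifferentiableAt (by simp)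
  have h2 : MDifferentiableAt 𝓘(ℝ, E) 𝓘(ℝ, F) (fun z => f ((extChartAt I c).symm z))
      (extChartAt I c ((extChartAt I c).symm y)) := by
    rw [(extChartAt I c).right_inv hy]
    exact hf.mdifferentiableAt
  refine (h2.comp _ h1).congr_of_eventuallyEq ?_
  filter_upwards [(isOpen_extChartAt_source (I := I) c).mem_nhds hs] with x hx
  rw [Function.comp_apply, (extChartAt I c).left_inv hx]

/-! ### The differential conditions on J in a product chart -/

namespace SasakianStructure

variable {m : ℕ} {S : Type*} [TopologicalSpace S]
    [ChartedSpace (EuclideanSpace ℝ (Fin (2 * m + 1))) S] [IsManifold (𝓡 (2 * m + 1)) ∞ S]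
    (𝓢 : SasakianStructure m S)

local notation "𝔼" => EuclideanSpace ℝ (Fin (2 * m + 1))
local notation "𝕀" => coneModel (2 * m + 1)

section Cone

variable {c : S} {z : EuclideanSpace ℝ (Fin (2 * m + 1)) × ℝ}
  (hz : z ∈ (extChartAt (coneModel (2 * m + 1)) (atOne c)).target)
include hz

/-- The equation `L_{r∂/∂r} J = 0` in the product chart. -/
theorem lie_euler_JInChart {X : 𝔼 × ℝ → 𝔼 × ℝ} (hX : ContDiff ℝ ∞ X) :
    fderiv ℝ (fun z => 𝓢.JInChart c z (X z)) z (0, z.2) - (0, (𝓢.JInChart c z (X z)).2) =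
      𝓢.JInChart c z (fderiv ℝ X z (0, z.2) - (0, (X z).2)) := by
  have hXs := contMDiffAt_chartField (I := 𝕀) hz hX.contDiffAt
  have hE : ∀ v, fderiv ℝ (fun z : 𝔼 × ℝ => ((0 : 𝔼), z.2)) z v = (0, v.2) := by
    intro v
    have : HasFDerivAt (fun z : 𝔼 × ℝ => ((0 : 𝔼), z.2))
        ((0 : 𝔼 × ℝ →L[ℝ] 𝔼).prod (ContinuousLinearMap.snd ℝ 𝔼 ℝ)) z :=
      (hasFDerivAt_const (0 : 𝔼) z).prodMk hasFDerivAt_snd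
    rw [this.fderiv]
    rfl
  have h1 := mlieBracket_chart (I := 𝕀) hz (smoothFieldAt_euler hz) (𝓢.smoothFieldAt_J hXs)
    (X := fun z => (0, z.2)) (Y := fun z => 𝓢.JInChart c z (X z))
    (fun z hz => fieldInChart_euler hz)
    (fun z hz => by rw [fieldInChart_J 𝓢 hz, fieldInChart_chartField hz])
  have h2 := mlieBracket_chart (I := 𝕀) hz (smoothFieldAt_euler hz) hXs
    (X := fun z => (0, z.2)) (Y := X)
    (fun z hz => fieldInChart_euler hz) (fun z hz => fieldInChart_chartField hz X)
  have h3 := 𝓢.lie_euler_J _ _ hXs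
  rw [h1, h2, ← chartDeriv_JInChart 𝓢 hz, hE, hE] at h3
  exact chartDeriv_injective hz h3

/-- The vanishing of the Nijenhuis tensor in the product chart. -/
theorem nijenhuis_JInChart {X Y : 𝔼 × ℝ → 𝔼 × ℝ} (hX : ContDiff ℝ ∞ X) (hY : ContDiff ℝ ∞ Y) :
    (fderiv ℝ (fun z => 𝓢.JInChart c z (Y z)) z (𝓢.JInChart c z (X z))
        - fderiv ℝ (fun z => 𝓢.JInChart c z (X z)) z (𝓢.JInChart c z (Y z)))
      - 𝓢.JInChart c z (fderiv ℝ Y z (𝓢.JInChart c z (X z))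
        - fderiv ℝ (fun z => 𝓢.JInChart c z (X z)) z (Y z))
      - 𝓢.JInChart c z (fderiv ℝ (fun z => 𝓢.JInChart c z (Y z)) z (X z)
        - fderiv ℝ X z (𝓢.JInChart c z (Y z)))
      - (fderiv ℝ Y z (X z) - fderiv ℝ X z (Y z)) = 0 := by
  have hXs := contMDiffAt_chartField (I := 𝕀) hz hX.contDiffAt
  have hYs := contMDiffAt_chartField (I := 𝕀) hz hY.contDiffAt
  have hJ : ∀ X : 𝔼 × ℝ → 𝔼 × ℝ, ∀ z ∈ (extChartAt 𝕀 (atOne c)).target,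
      fieldInChart 𝕀 (atOne c) (fun x => 𝓢.J x (chartField 𝕀 (atOne c) X x)) z =
        𝓢.JInChart c z (X z) := fun X z hz => by
    rw [fieldInChart_J 𝓢 hz, fieldInChart_chartField hz]
  have hC : ∀ X : 𝔼 × ℝ → 𝔼 × ℝ, ∀ z ∈ (extChartAt 𝕀 (atOne c)).target,
      fieldInChart 𝕀 (atOne c) (chartField 𝕀 (atOne c) X) z = X z := fun X z hz =>
    fieldInChart_chartField hz X
  have h := 𝓢.integrable _ _ _ hXs hYs
  rw [mlieBracket_chart hz (𝓢.smoothFieldAt_J hXs) (𝓢.smoothFieldAt_J hYs) (hJ X) (hJ Y),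
    mlieBracket_chart hz (𝓢.smoothFieldAt_J hXs) hYs (hJ X) (hC Y),
    mlieBracket_chart hz hXs (𝓢.smoothFieldAt_J hYs) (hC X) (hJ Y),
    mlieBracket_chart hz hXs hYs (hC X) (hC Y),
    ← chartDeriv_JInChart 𝓢 hz, ← chartDeriv_JInChart 𝓢 hz, ← map_sub, ← map_sub, ← map_sub] at h
  refine chartDeriv_injective hz (h.trans (map_zero _).symm)

/-- The closedness of the fundamental form in the product chart, in terms of the components
`σ z v w` of the fundamental form. -/
theorem closed_JInChart {X Y Z : 𝔼 × ℝ → 𝔼 × ℝ} (hX : ContDiff ℝ ∞ X) (hY : ContDiff ℝ ∞ Y)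
    (hZ : ContDiff ℝ ∞ Z) {σ : 𝔼 × ℝ → 𝔼 × ℝ → 𝔼 × ℝ → ℝ}
    (hσ : σ = fun z v w => (𝓢.JInChart c z v).2 * w.2
      + z.2 ^ 2 * metricInChart 𝓢.g c z.1 (𝓢.JInChart c z v).1 w.1) :
    fderiv ℝ (fun z => σ z (Y z) (Z z)) z (X z) + fderiv ℝ (fun z => σ z (Z z) (X z)) z (Y z)
      + fderiv ℝ (fun z => σ z (X z) (Y z)) z (Z z)
      - σ z (fderiv ℝ Y z (X z) - fderiv ℝ X z (Y z)) (Z z)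
      - σ z (fderiv ℝ Z z (Y z) - fderiv ℝ Y z (Z z)) (X z)
      - σ z (fderiv ℝ X z (Z z) - fderiv ℝ Z z (X z)) (Y z) = 0 := by
  have hs : ∀ {X}, ContDiff ℝ ∞ X → _ := fun {X} hX =>
    contMDiffAt_chartField (I := 𝕀) (M := Cone S) (X := X) hz hX.contDiffAt
  have hC : ∀ X : 𝔼 × ℝ → 𝔼 × ℝ, ∀ z ∈ (extChartAt 𝕀 (atOne c)).target,
      fieldInChart 𝕀 (atOne c) (chartField 𝕀 (atOne c) X) z = X z := fun X z hz =>
    fieldInChart_chartField hz X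
  have hm : ∀ z ∈ (extChartAt 𝕀 (atOne c)).target, ∀ v w : 𝔼 × ℝ,
      coneMetric 𝓢.g ((extChartAt 𝕀 (atOne c)).symm z) (𝓢.J _ (chartDeriv 𝕀 (atOne c) z v))
        (chartDeriv 𝕀 (atOne c) z w) = σ z v w := by
    intro z hz v w
    rw [← chartDeriv_JInChart 𝓢 hz, coneMetric_chartDeriv 𝓢 hz, hσ]
  have hT := (isOpen_extChartAt_target (I := 𝕀) (atOne c)).mem_nhds hz
  have hd : ∀ {X Y Z : 𝔼 × ℝ → 𝔼 × ℝ}, ContDiff ℝ ∞ Y → ContDiff ℝ ∞ Z →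
      dirDeriv (fun x => coneMetric 𝓢.g x (𝓢.J x (chartField 𝕀 (atOne c) Y x))
        (chartField 𝕀 (atOne c) Z x)) ((extChartAt 𝕀 (atOne c)).symm z)
        (chartField 𝕀 (atOne c) X ((extChartAt 𝕀 (atOne c)).symm z)) =
        fderiv ℝ (fun z => σ z (Y z) (Z z)) z (X z) := by
    intro X Y Z hY hZ
    have he : (fun z => coneMetric 𝓢.g ((extChartAt 𝕀 (atOne c)).symm z)
        (𝓢.J _ (chartField 𝕀 (atOne c) Y ((extChartAt 𝕀 (atOne c)).symm z)))
        (chartField 𝕀 (atOne c) Z ((extChartAt 𝕀 (atOne c)).symm z))) =ᶠ[nhds z]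
        fun z => σ z (Y z) (Z z) := by
      filter_upwards [hT] with z hz
      rw [chartField_apply hz, chartField_apply hz, hm z hz]
    have hσd : DifferentiableAt ℝ (fun z => σ z (Y z) (Z z)) z := by
      have hYd : DifferentiableAt ℝ Y z := hY.differentiable (by simp) z
      have hZd : DifferentiableAt ℝ Z z := hZ.differentiable (by simp) z
      have hJY : DifferentiableAt ℝ (fun z => 𝓢.JInChart c z (Y z)) z :=
        (differentiableAt_JInChart 𝓢 hz).clm_apply hYd
      have hG : DifferentiableAt ℝ (fun z : 𝔼 × ℝ => metricInChart 𝓢.g c z.1) z := by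
        have h1 : DifferentiableAt ℝ (metricInChart 𝓢.g c) z.1 :=
          ((contDiffOn_metricInChart 𝓢.g c).differentiableOn (by simp)).differentiableAt
            ((isOpen_extChartAt_target c).mem_nhds (mem_target_of_mem_cone_target hz))
        have h0 : DifferentiableAt ℝ (fun z : 𝔼 × ℝ => z.1) z := by fun_prop
        exact DifferentiableAt.comp (g := metricInChart 𝓢.g c) z h1 h0
      rw [hσ]
      exact (hJY.snd.mul hZd.snd).add
        ((differentiableAt_snd.pow 2).mul ((hG.clm_apply hJY.fst).clm_apply hZd.fst))
    have hF := mdifferentiableAt_of_comp_chart_symm (I := 𝕀) hz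
      (f := fun x => coneMetric 𝓢.g x (𝓢.J x (chartField 𝕀 (atOne c) Y x))
        (chartField 𝕀 (atOne c) Z x)) (hσd.congr_of_eventuallyEq he)
    have e1 := congrArg (dirDeriv (fun x => coneMetric 𝓢.g x (𝓢.J x (chartField 𝕀 (atOne c) Y x))
        (chartField 𝕀 (atOne c) Z x)) ((extChartAt 𝕀 (atOne c)).symm z)) (chartField_apply hz X)
    exact e1.trans ((fderiv_comp_chart_symm hz hF (X z)).symm.trans
      (congrArg (fun L : 𝔼 × ℝ →L[ℝ] ℝ => L (X z)) he.fderiv_eq))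
  have h := 𝓢.closed _ _ _ _ (hs hX) (hs hY) (hs hZ)
  rw [hd hY hZ, hd hZ hX, hd hX hY,
    mlieBracket_chart hz (hs hX) (hs hY) (hC X) (hC Y),
    mlieBracket_chart hz (hs hY) (hs hZ) (hC Y) (hC Z),
    mlieBracket_chart hz (hs hZ) (hs hX) (hC Z) (hC X),
    chartField_apply hz, chartField_apply hz, chartField_apply hz, hm z hz, hm z hz, hm z hz] at h
  exact h

end Cone

end SasakianStructure

end Sasaki


namespace Sasaki

/-! ### Restriction to r = 1: the Sasakian identities -/

namespace SasakianStructure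

variable {m : ℕ} {S : Type*} [TopologicalSpace S]
    [ChartedSpace (EuclideanSpace ℝ (Fin (2 * m + 1))) S] [IsManifold (𝓡 (2 * m + 1)) ∞ S]
    (𝓢 : SasakianStructure m S)

local notation "𝔼" => EuclideanSpace ℝ (Fin (2 * m + 1))
local notation "𝕀" => coneModel (2 * m + 1)

/-- The Reeb field in the chart at `c`. -/
noncomputable def reebInChart (c : S) (y : EuclideanSpace ℝ (Fin (2 * m + 1))) :
    EuclideanSpace ℝ (Fin (2 * m + 1)) :=
  (𝓢.JInChart c (y, 1) (0, 1)).1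

/-- The transverse complex structure in the chart at `c`. -/
noncomputable def transverseJInChart (c : S) (y : EuclideanSpace ℝ (Fin (2 * m + 1))) :
    EuclideanSpace ℝ (Fin (2 * m + 1)) →L[ℝ] EuclideanSpace ℝ (Fin (2 * m + 1)) :=
  (ContinuousLinearMap.fst ℝ 𝔼 ℝ).comp
    ((𝓢.JInChart c (y, 1)).comp (ContinuousLinearMap.inl ℝ 𝔼 ℝ))

theorem transverseJInChart_apply (c : S) (y v : 𝔼) :
    𝓢.transverseJInChart c y v = (𝓢.JInChart c (y, 1) (v, 0)).1 := rfl

variable {c : S} {y : EuclideanSpace ℝ (Fin (2 * m + 1))}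
  (hy : y ∈ (extChartAt (𝓡 (2 * m + 1)) c).target)
include hy

omit [IsManifold (𝓡 (2 * m + 1)) ∞ S] in
theorem mem_slice : (y, (1 : ℝ)) ∈ (extChartAt 𝕀 (atOne c)).target := mem_cone_target hy one_pos

omit [IsManifold (𝓡 (2 * m + 1)) ∞ S] hy in
theorem cone_chart_symm_slice :
    (extChartAt 𝕀 (atOne c)).symm (y, 1) = atOne ((extChartAt (𝓡 (2 * m + 1)) c).symm y) :=
  cone_chart_symm (z := (y, 1)) one_pos

theorem chartDeriv_reebInChart :
    chartDeriv (𝓡 (2 * m + 1)) c y (𝓢.reebInChart c y) =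
      𝓢.reeb ((extChartAt (𝓡 (2 * m + 1)) c).symm y) := by
  have hz := mem_slice hy
  -- The points `symm (y, 1)` and `atOne (symm y)` agree, but not by definition, so their tangent
  -- spaces are different types. A function with values in the fixed model space can be transported
  -- along the equality.
  let F : Cone S → 𝔼 := fun x => baseComp (𝓢.J x (euler (2 * m + 1) x))
  have h1 : F ((extChartAt 𝕀 (atOne c)).symm (y, 1)) =
      F (atOne ((extChartAt (𝓡 (2 * m + 1)) c).symm y)) := congrArg F cone_chart_symm_slice
  refine Eq.trans ?_ h1
  have h2 := 𝓢.chartDeriv_JInChart hz (0, 1)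
  rw [chartDeriv_euler hz, cone_chartDeriv hy one_pos] at h2
  exact congrArg baseComp h2

theorem chartDeriv_transverseJInChart (v : 𝔼) :
    chartDeriv (𝓡 (2 * m + 1)) c y (𝓢.transverseJInChart c y v) =
      𝓢.transverseJ _ (chartDeriv (𝓡 (2 * m + 1)) c y v) := by
  have hz := mem_slice hy
  let F : Cone S → 𝔼 := fun x =>
    baseComp (𝓢.J x (coneVec x (chartDeriv (𝓡 (2 * m + 1)) c y v : 𝔼) 0))
  have h1 : F ((extChartAt 𝕀 (atOne c)).symm (y, 1)) =
      F (atOne ((extChartAt (𝓡 (2 * m + 1)) c).symm y)) := congrArg F cone_chart_symm_slice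
  refine Eq.trans ?_ h1
  have h2 := 𝓢.chartDeriv_JInChart hz (v, 0)
  rw [cone_chartDeriv hy one_pos, cone_chartDeriv hy one_pos] at h2
  exact congrArg baseComp h2

omit hy in
theorem contDiffOn_slice : ContDiffOn ℝ ∞ (fun y => 𝓢.JInChart c (y, 1))
    (extChartAt (𝓡 (2 * m + 1)) c).target :=
  (𝓢.contDiffOn_JInChart c).comp (contDiff_id.prodMk contDiff_const).contDiffOn
    fun _ hy => mem_slice hy

omit hy in
theorem contDiffOn_reebInChart : ContDiffOn ℝ ∞ (𝓢.reebInChart c)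
    (extChartAt (𝓡 (2 * m + 1)) c).target :=
  (𝓢.contDiffOn_slice.clm_apply contDiffOn_const).fst

omit hy in
theorem contDiffOn_transverseJInChart : ContDiffOn ℝ ∞ (𝓢.transverseJInChart c)
    (extChartAt (𝓡 (2 * m + 1)) c).target :=
  contDiffOn_const.clm_comp (𝓢.contDiffOn_slice.clm_comp contDiffOn_const)

omit hy [TopologicalSpace S] [ChartedSpace (EuclideanSpace ℝ (Fin (2 * m + 1))) S]
  [IsManifold (𝓡 (2 * m + 1)) ∞ S] in
/-- Derivatives along the slice `r = 1`. -/
theorem fderiv_slice {F : Type*} [NormedAddCommGroup F] [NormedSpace ℝ F] {f : 𝔼 × ℝ → F}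
    (hf : DifferentiableAt ℝ f (y, 1)) (v : 𝔼) :
    fderiv ℝ (fun y => f (y, 1)) y v = fderiv ℝ f (y, 1) (v, 0) := by
  have h1 : HasFDerivAt (fun y : 𝔼 => (y, (1 : ℝ))) (ContinuousLinearMap.inl ℝ 𝔼 ℝ) y :=
    hasFDerivAt_prodMk_left y 1
  have h2 := HasFDerivAt.comp (g := f) y hf.hasFDerivAt h1
  rw [show (fun y => f (y, 1)) = f ∘ fun y : 𝔼 => (y, (1 : ℝ)) from rfl, h2.fderiv]
  rfl

-- Skewness of J makes J(r∂/∂r) orthogonal to r∂/∂r, so it is tangent to the slices of constant r.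
omit hy in
theorem JInChart_euler_snd {z : 𝔼 × ℝ} (hz : z ∈ (extChartAt 𝕀 (atOne c)).target) :
    (𝓢.JInChart c z (0, z.2)).2 = 0 := by
  have h := 𝓢.JInChart_skew hz (0, z.2) (0, z.2)
  have hp := pos_of_mem_cone_target hz
  simp at h
  have : (𝓢.JInChart c z (0, z.2)).2 * z.2 = 0 := by linarith
  exact (mul_eq_zero.1 this).resolve_right hp.ne'

theorem JInChart_reeb : 𝓢.JInChart c (y, 1) (0, 1) = (𝓢.reebInChart c y, 0) :=
  Prod.ext rfl (𝓢.JInChart_euler_snd (mem_slice hy))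

/-- The radial part of Jv is ḡ(Jv, ∂/∂r) = -ḡ(v, J∂/∂r), which at r = 1 is -η(v). -/
theorem JInChart_horizontal (v : 𝔼) :
    𝓢.JInChart c (y, 1) (v, 0) = (𝓢.transverseJInChart c y v,
      -metricInChart 𝓢.g c y (𝓢.reebInChart c y) v) := by
  refine Prod.ext rfl ?_
  have h := 𝓢.JInChart_skew (mem_slice hy) (v, 0) (0, 1)
  rw [𝓢.JInChart_reeb hy] at h
  simp at h
  rw [h, metricInChart_symm]

theorem horizontal_eq (v : 𝔼) (a : ℝ) : 𝓢.JInChart c (y, 1) (v, a) =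
    (𝓢.transverseJInChart c y v + a • 𝓢.reebInChart c y,
      -metricInChart 𝓢.g c y (𝓢.reebInChart c y) v) := by
  have : ((v, a) : 𝔼 × ℝ) = (v, 0) + a • (0, 1) := by simp
  rw [this, map_add, map_smul, 𝓢.JInChart_reeb hy, 𝓢.JInChart_horizontal hy]
  simp

omit hy in
theorem differentiableAt_JInChart_const {z : 𝔼 × ℝ} (hz : z ∈ (extChartAt 𝕀 (atOne c)).target)
    (v : 𝔼 × ℝ) : DifferentiableAt ℝ (fun z => 𝓢.JInChart c z v) z :=
  (differentiableAt_JInChart 𝓢 hz).clm_apply (differentiableAt_const v)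

omit hy in
theorem differentiableAt_JInChart_euler {z : 𝔼 × ℝ} (hz : z ∈ (extChartAt 𝕀 (atOne c)).target) :
    DifferentiableAt ℝ (fun z => 𝓢.JInChart c z (0, z.2)) z :=
  (differentiableAt_JInChart 𝓢 hz).clm_apply ((differentiableAt_const _).prodMk differentiableAt_snd)

omit hy in
theorem fderiv_fst_apply {F : Type*} [NormedAddCommGroup F] [NormedSpace ℝ F]
    {f : F → 𝔼 × ℝ} {x : F} (hf : DifferentiableAt ℝ f x) (v : F) :
    fderiv ℝ (fun x => (f x).1) x v = (fderiv ℝ f x v).1 := by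
  rw [(hf.hasFDerivAt.fst).fderiv]
  rfl

omit hy in
theorem fderiv_snd_apply {F : Type*} [NormedAddCommGroup F] [NormedSpace ℝ F]
    {f : F → 𝔼 × ℝ} {x : F} (hf : DifferentiableAt ℝ f x) (v : F) :
    fderiv ℝ (fun x => (f x).2) x v = (fderiv ℝ f x v).2 := by
  rw [(hf.hasFDerivAt.snd).fderiv]
  rfl

omit hy [TopologicalSpace S] [ChartedSpace (EuclideanSpace ℝ (Fin (2 * m + 1))) S]
  [IsManifold (𝓡 (2 * m + 1)) ∞ S] in
theorem fderiv_euler (z v : 𝔼 × ℝ) :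
    fderiv ℝ (fun z : 𝔼 × ℝ => ((0 : 𝔼), z.2)) z v = (0, v.2) := by
  have : HasFDerivAt (fun z : 𝔼 × ℝ => ((0 : 𝔼), z.2))
      ((0 : 𝔼 × ℝ →L[ℝ] 𝔼).prod (ContinuousLinearMap.snd ℝ 𝔼 ℝ)) z :=
    (hasFDerivAt_const (0 : 𝔼) z).prodMk hasFDerivAt_snd
  rw [this.fderiv]
  rfl

omit hy [TopologicalSpace S] [ChartedSpace (EuclideanSpace ℝ (Fin (2 * m + 1))) S]
  [IsManifold (𝓡 (2 * m + 1)) ∞ S] in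
theorem contDiff_euler : ContDiff ℝ ∞ (fun z : 𝔼 × ℝ => ((0 : 𝔼), z.2)) :=
  contDiff_const.prodMk contDiff_snd

/-- L_{r∂/∂r} J = 0 is tested on the constant field (v, 0), which commutes with r∂/∂r. The part of
J(v, 0) tangent to S is therefore radially constant. -/
theorem radial_fderiv_J (v : 𝔼) :
    fderiv ℝ (fun z => 𝓢.JInChart c z (v, 0)) (y, 1) (0, 1) =
      (0, (𝓢.JInChart c (y, 1) (v, 0)).2) := by
  have h := 𝓢.lie_euler_JInChart (mem_slice hy) (X := fun _ => (v, 0)) contDiff_const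
  simp at h
  exact sub_eq_zero.1 (h.trans (map_zero _))

/-- The same equation tested on r∂/∂r itself, whose image under J has no radial part. -/
theorem radial_fderiv_J_euler :
    fderiv ℝ (fun z => 𝓢.JInChart c z (0, z.2)) (y, 1) (0, 1) = 0 := by
  have h := 𝓢.lie_euler_JInChart (mem_slice hy) (X := fun z => (0, z.2)) contDiff_euler
  rw [fderiv_euler, 𝓢.JInChart_euler_snd (mem_slice hy)] at h
  simpa [Prod.mk_zero_zero] using h

theorem fderiv_J_slice (v w : 𝔼) :
    (fderiv ℝ (fun z => 𝓢.JInChart c z (v, 0)) (y, 1) (w, 0)).1 =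
      fderiv ℝ (𝓢.transverseJInChart c) y w v := by
  have hd := (𝓢.contDiffOn_transverseJInChart.differentiableOn (by simp)).differentiableAt
    ((isOpen_extChartAt_target c).mem_nhds hy)
  have h1 : fderiv ℝ (fun y => 𝓢.transverseJInChart c y v) y w =
      fderiv ℝ (𝓢.transverseJInChart c) y w v := by
    rw [fderiv_field_apply hd (differentiableAt_const v)]
    simp
  have hJ := 𝓢.differentiableAt_JInChart_const (mem_slice hy) (v, 0)
  rw [← h1, ← fderiv_fst_apply hJ, ← fderiv_slice hJ.fst]
  rfl

theorem fderiv_J_euler_slice (w : 𝔼) :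
    fderiv ℝ (fun z => 𝓢.JInChart c z (0, z.2)) (y, 1) (w, 0) =
      (fderiv ℝ (𝓢.reebInChart c) y w, 0) := by
  have hJ := 𝓢.differentiableAt_JInChart_euler (mem_slice hy)
  refine Prod.ext ?_ ?_
  · rw [← fderiv_fst_apply hJ, ← fderiv_slice hJ.fst]
    rfl
  · rw [← fderiv_snd_apply hJ]
    have : (fun z => (𝓢.JInChart c z (0, z.2)).2) =ᶠ[nhds (y, (1 : ℝ))] fun _ => 0 := by
      filter_upwards [(isOpen_extChartAt_target (I := 𝕀) (atOne c)).mem_nhds (mem_slice hy)]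
        with z hz using 𝓢.JInChart_euler_snd hz
    rw [this.fderiv_eq]
    simp

/-- In N(r∂/∂r, Y) = 0 the terms -J[r∂/∂r, JY] and -[r∂/∂r, Y] cancel because L_{r∂/∂r} J = 0. What
remains is L_{J(r∂/∂r)} J = 0, and its component tangent to S at r = 1 is L_ξ Φ = 0. -/
theorem lie_transverseJInChart (v : 𝔼) :
    fderiv ℝ (𝓢.transverseJInChart c) y (𝓢.reebInChart c y) v
      - fderiv ℝ (𝓢.reebInChart c) y (𝓢.transverseJInChart c y v)
      + 𝓢.transverseJInChart c y (fderiv ℝ (𝓢.reebInChart c) y v) = 0 := by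
  have h := 𝓢.nijenhuis_JInChart (mem_slice hy) (X := fun z => (0, z.2)) (Y := fun _ => (v, 0))
    contDiff_euler contDiff_const
  have e : ∀ (w : 𝔼) (a : ℝ), ((w, a) : 𝔼 × ℝ) = (w, 0) + a • (0, 1) := by simp
  simp only [fderiv_euler, 𝓢.JInChart_reeb hy, 𝓢.JInChart_horizontal hy,
    𝓢.radial_fderiv_J hy, 𝓢.fderiv_J_euler_slice hy] at h
  -- The direction J(v, 0) leaves the slice by -η(v)∂/∂r; this part is split off, and the radial
  -- derivative of J(r∂/∂r) kills it.
  rw [e _ (-metricInChart 𝓢.g c y (𝓢.reebInChart c y) v), map_add, map_smul,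
    𝓢.radial_fderiv_J_euler hy, 𝓢.fderiv_J_euler_slice hy] at h
  have h1 := congrArg Prod.fst h
  simp [𝓢.JInChart_horizontal hy, 𝓢.fderiv_J_slice hy] at h1
  exact h1

/-- This is dω = 0 on r∂/∂r, (v, 0), (w, 0), three commuting fields. On vectors tangent to S the
form ω scales as r², which gives the factor 2 at r = 1; the other two terms are derivatives of η,
since ω(r∂/∂r, v) = η(v) there. -/
theorem contact_transverseJInChart (v w : 𝔼) :
    2 * metricInChart 𝓢.g c y (𝓢.transverseJInChart c y v) w =
      fderiv ℝ (fun x => metricInChart 𝓢.g c x (𝓢.reebInChart c x)) y v w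
        - fderiv ℝ (fun x => metricInChart 𝓢.g c x (𝓢.reebInChart c x)) y w v := by
  have hz := mem_slice hy
  set G : 𝔼 × ℝ → 𝔼 →L[ℝ] 𝔼 →L[ℝ] ℝ := fun z => metricInChart 𝓢.g c z.1 with hG
  have hGy : DifferentiableAt ℝ (metricInChart 𝓢.g c) y :=
    ((contDiffOn_metricInChart 𝓢.g c).differentiableOn (by simp)).differentiableAt
      ((isOpen_extChartAt_target c).mem_nhds hy)
  have hGd : DifferentiableAt ℝ G (y, 1) := by
    have h0 : DifferentiableAt ℝ (fun z : 𝔼 × ℝ => z.1) (y, 1) := by fun_prop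
    exact DifferentiableAt.comp (g := metricInChart 𝓢.g c) (y, (1 : ℝ)) hGy h0
  have hG1 : fderiv ℝ G (y, 1) (0, 1) = 0 := by
    have : HasFDerivAt G ((fderiv ℝ (metricInChart 𝓢.g c) y).comp (ContinuousLinearMap.fst ℝ 𝔼 ℝ))
        (y, 1) := by
      have h0 : HasFDerivAt (fun z : 𝔼 × ℝ => z.1) (ContinuousLinearMap.fst ℝ 𝔼 ℝ) (y, 1) :=
        hasFDerivAt_fst
      exact HasFDerivAt.comp (g := metricInChart 𝓢.g c) (y, (1 : ℝ)) hGy.hasFDerivAt h0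
    rw [this.fderiv]
    simp
  set σ : 𝔼 × ℝ → 𝔼 × ℝ → 𝔼 × ℝ → ℝ := fun z v w => (𝓢.JInChart c z v).2 * w.2
      + z.2 ^ 2 * metricInChart 𝓢.g c z.1 (𝓢.JInChart c z v).1 w.1 with hσ
  have hcl := 𝓢.closed_JInChart hz (X := fun z => (0, z.2)) (Y := fun _ => (v, 0))
    (Z := fun _ => (w, 0)) contDiff_euler contDiff_const contDiff_const hσ
  have hskew : ∀ z ∈ (extChartAt 𝕀 (atOne c)).target, ∀ v w, σ z v w = -σ z w v := by
    intro z hz v w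
    have := 𝓢.JInChart_skew hz v w
    simp only [hσ]
    rw [this, metricInChart_symm]
    ring
  have hT := (isOpen_extChartAt_target (I := 𝕀) (atOne c)).mem_nhds hz
  have hη := contDiffOn_metricInChart 𝓢.g c |>.clm_apply 𝓢.contDiffOn_reebInChart
  have hηd := (hη.differentiableOn (by simp)).differentiableAt
    ((isOpen_extChartAt_target c).mem_nhds hy)
  have t3 : ∀ v w : 𝔼, fderiv ℝ (fun z => σ z (0, z.2) (v, 0)) (y, 1) (w, 0) =
      fderiv ℝ (fun x => metricInChart 𝓢.g c x (𝓢.reebInChart c x)) y w v := by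
    intro v w
    have hd : DifferentiableAt ℝ (fun z => σ z (0, z.2) (v, 0)) (y, 1) :=
      ((𝓢.differentiableAt_JInChart_euler hz).snd.mul (differentiableAt_const _)).add
        ((differentiableAt_snd.pow 2).mul ((hGd.clm_apply
          (𝓢.differentiableAt_JInChart_euler hz).fst).clm_apply (differentiableAt_const _)))
    rw [← fderiv_slice hd]
    have e : (fun y => σ (y, 1) (0, 1) (v, 0)) =
        fun y => metricInChart 𝓢.g c y (𝓢.reebInChart c y) v := by
      ext y
      simp [hσ, reebInChart]
    have := fderiv_field_apply hηd (differentiableAt_const v) w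
    simp only [fderiv_fun_const, Pi.zero_apply, zero_apply, map_zero, add_zero] at this
    rw [← this]
    exact congrArg (fun f : 𝔼 → ℝ => fderiv ℝ f y w) e
  have t2 : ∀ v w : 𝔼, fderiv ℝ (fun z => σ z (v, 0) (0, z.2)) (y, 1) (w, 0) =
      -fderiv ℝ (fun x => metricInChart 𝓢.g c x (𝓢.reebInChart c x)) y w v := by
    intro v w
    have e : (fun z => σ z (v, 0) (0, z.2)) =ᶠ[nhds (y, (1 : ℝ))]
        fun z => -σ z (0, z.2) (v, 0) := by
      filter_upwards [hT] with z hz using hskew z hz _ _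
    rw [e.fderiv_eq, fderiv_fun_neg, neg_apply, t3]
  have t1 : fderiv ℝ (fun z => σ z (v, 0) (w, 0)) (y, 1) (0, 1) =
      2 * metricInChart 𝓢.g c y (𝓢.transverseJInChart c y v) w := by
    have hJ := 𝓢.differentiableAt_JInChart_const hz (v, 0)
    have hJ1 : DifferentiableAt ℝ (fun z => (𝓢.JInChart c z (v, 0)).1) (y, 1) := hJ.fst
    have hA : DifferentiableAt ℝ (fun z => G z (𝓢.JInChart c z (v, 0)).1) (y, 1) :=
      hGd.clm_apply hJ1
    have hB : DifferentiableAt ℝ (fun z => G z (𝓢.JInChart c z (v, 0)).1 w) (y, 1) :=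
      hA.clm_apply (differentiableAt_const w)
    -- Neither the metric of S nor the part of J(v, 0) tangent to S depends on r to first order, so
    -- only the factor r² is differentiated.
    have hB1 : fderiv ℝ (fun z => G z (𝓢.JInChart c z (v, 0)).1 w) (y, 1) (0, 1) = 0 := by
      rw [fderiv_clm_apply hA (differentiableAt_const w), fderiv_clm_apply hGd hJ1]
      simp [hG1, fderiv_fst_apply hJ, 𝓢.radial_fderiv_J hy]
    have e : (fun z => σ z (v, 0) (w, 0)) = fun z => z.2 ^ 2 * G z (𝓢.JInChart c z (v, 0)).1 w := by
      ext z
      simp [hσ, hG]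
    have hp : DifferentiableAt ℝ (fun z : 𝔼 × ℝ => z.2 ^ 2) (y, 1) := differentiableAt_snd.pow 2
    have hp1 : fderiv ℝ (fun z : 𝔼 × ℝ => z.2 ^ 2) (y, 1) (0, 1) = 2 := by
      rw [fderiv_fun_pow _ differentiableAt_snd]
      simp [fderiv_snd]
    rw [e, fderiv_fun_mul hp hB]
    simp only [add_apply, smul_apply, hp1, smul_eq_mul]
    rw [hB1, transverseJInChart_apply]
    simp only [hG]
    ring
  have hσ0 : ∀ u, σ (y, 1) 0 u = 0 := fun u => by simp [hσ]
  rw [t1, t2, t3] at hcl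
  simp only [fderiv_euler, fderiv_fun_const, Pi.zero_apply, zero_apply, sub_zero, Prod.mk_zero_zero,
    hσ0] at hcl
  linarith

omit hy in
/-- A Sasakian structure in a chart. -/
theorem isLocalSasaki (c : S) :
    IsLocalSasaki (extChartAt (𝓡 (2 * m + 1)) c).target (metricInChart 𝓢.g c) (𝓢.reebInChart c)
      (𝓢.transverseJInChart c) where
  isOpen := isOpen_extChartAt_target c
  smooth_G := contDiffOn_metricInChart 𝓢.g c
  smooth_ξ := 𝓢.contDiffOn_reebInChart
  smooth_Φ := 𝓢.contDiffOn_transverseJInChart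
  symm y _ := metricInChart_symm 𝓢.g c y
  pos y hy := metricInChart_pos 𝓢.g hy
  skew y hy v w := by
    have h := 𝓢.JInChart_skew (mem_slice hy) (v, 0) (w, 0)
    simpa [transverseJInChart_apply] using h
  unit y hy := by
    have h := 𝓢.JInChart_hermitian (mem_slice hy) (0, 1) (0, 1)
    rw [𝓢.JInChart_reeb hy] at h
    simpa using h
  Φ_ξ y hy := by
    have h := 𝓢.JInChart_sq (mem_slice hy) (0, 1)
    rw [𝓢.JInChart_reeb hy] at h
    exact (congrArg Prod.fst h).trans (by simp)
  Φ_sq y hy v := by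
    have h := 𝓢.JInChart_sq (mem_slice hy) (v, 0)
    rw [𝓢.JInChart_horizontal hy, 𝓢.horizontal_eq hy] at h
    have h1 := congrArg Prod.fst h
    simp only [Prod.fst_neg] at h1
    rw [← h1]
    module
  contact y hy := 𝓢.contact_transverseJInChart hy
  lie_Φ y hy := 𝓢.lie_transverseJInChart hy

end SasakianStructure

end Sasaki


namespace Sasaki

/-! ### Positivity and smoothness of the Riemannian density -/

section Density

variable {n : ℕ} {S : Type*} [TopologicalSpace S] [ChartedSpace (EuclideanSpace ℝ (Fin n)) S]
  [IsManifold (𝓡 n) ∞ S]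

local notation "𝔼" => EuclideanSpace ℝ (Fin n)

theorem formMatrix_det_pos {b : 𝔼 →L[ℝ] 𝔼 →L[ℝ] ℝ} (hs : ∀ v w, b v w = b w v)
    (hp : ∀ v, v ≠ 0 → 0 < b v v) : 0 < (formMatrix b).det := by
  refine Matrix.PosDef.det_pos (Matrix.PosDef.of_dotProduct_mulVec_pos ?_ fun x hx => ?_)
  · ext i j
    simp [formMatrix, hs (stdVec j)]
  · have h := hp (WithLp.toLp 2 x) (by simpa using hx)
    rw [form_apply_left] at h
    refine h.trans_eq ?_
    simp only [dotProduct, Matrix.mulVec, formMatrix, Matrix.of_apply]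
    refine Finset.sum_congr rfl fun i _ => ?_
    rw [form_apply_right]
    simp [mul_comm]

variable (g : Metric n S) {c c' : S} {y : EuclideanSpace ℝ (Fin n)}

theorem gram_det_pos (hy : y ∈ (extChartAt (𝓡 n) c).target) : 0 < (gram g c y).det := by
  rw [gram_eq_formMatrix]
  exact formMatrix_det_pos (metricInChart_symm g c y) (metricInChart_pos g hy)

theorem density_pos (hy : y ∈ (extChartAt (𝓡 n) c).target) : 0 < density g c y :=
  Real.sqrt_pos.2 (gram_det_pos g hy)

theorem det_metricInChart (hy : y ∈ (extChartAt (𝓡 n) c).target) :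
    (formMatrix (metricInChart g c y)).det = density g c y ^ 2 :=
  (Real.sq_sqrt (gram_det_pos g hy).le).symm

theorem contDiffOn_gram (c : S) (i j : Fin n) :
    ContDiffOn ℝ ∞ (fun y => gram g c y i j) (extChartAt (𝓡 n) c).target :=
  ((contDiffOn_metricInChart g c).clm_apply contDiffOn_const).clm_apply contDiffOn_const

theorem contDiffOn_density (c : S) :
    ContDiffOn ℝ ∞ (density g c) (extChartAt (𝓡 n) c).target :=
  (contDiffOn_det (contDiffOn_gram g c)).sqrt fun _ hy => (gram_det_pos g hy).ne'

end Density

/-! ### Change of chart -/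

section Transition

variable {n : ℕ} {S : Type*} [TopologicalSpace S] [ChartedSpace (EuclideanSpace ℝ (Fin n)) S]

local notation "𝔼" => EuclideanSpace ℝ (Fin n)

/-- The transition map from the chart at `c` to the chart at `c'`. -/
noncomputable def transition (c c' : S) (y : EuclideanSpace ℝ (Fin n)) :
    EuclideanSpace ℝ (Fin n) :=
  extChartAt (𝓡 n) c' ((extChartAt (𝓡 n) c).symm y)

/-- The domain of the transition map. -/
def overlap (n : ℕ) {S : Type*} [TopologicalSpace S] [ChartedSpace (EuclideanSpace ℝ (Fin n)) S]
    (c c' : S) : Set (EuclideanSpace ℝ (Fin n)) :=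
  (extChartAt (𝓡 n) c).target ∩ (extChartAt (𝓡 n) c).symm ⁻¹' (extChartAt (𝓡 n) c').source

variable {c c' : S} {y : EuclideanSpace ℝ (Fin n)}

theorem isOpen_overlap (c c' : S) : IsOpen (overlap n c c') :=
  (continuousOn_extChartAt_symm c).isOpen_inter_preimage (isOpen_extChartAt_target c)
    (isOpen_extChartAt_source c')

theorem transition_mem (hy : y ∈ overlap n c c') : transition c c' y ∈ overlap n c' c := by
  refine ⟨(extChartAt (𝓡 n) c').map_source hy.2, ?_⟩
  rw [Set.mem_preimage, transition, (extChartAt (𝓡 n) c').left_inv hy.2]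
  exact (extChartAt (𝓡 n) c).map_target hy.1

theorem chart_symm_transition (hy : y ∈ overlap n c c') :
    (extChartAt (𝓡 n) c').symm (transition c c' y) = (extChartAt (𝓡 n) c).symm y :=
  (extChartAt (𝓡 n) c').left_inv hy.2

theorem transition_transition (hy : y ∈ overlap n c c') :
    transition c' c (transition c c' y) = y := by
  rw [transition, chart_symm_transition hy, (extChartAt (𝓡 n) c).right_inv hy.1]

theorem injOn_transition (c c' : S) : Set.InjOn (transition c c') (overlap n c c') :=
  Set.LeftInvOn.injOn (f₁' := transition c' c) fun _ hy => transition_transition hy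

theorem image_transition (c c' : S) : transition c c' '' overlap n c c' = overlap n c' c :=
  Set.Subset.antisymm (Set.image_subset_iff.2 fun _ hy => transition_mem hy) fun y hy =>
    ⟨transition c' c y, transition_mem hy, transition_transition hy⟩

variable [IsManifold (𝓡 n) ∞ S]

theorem contDiffAt_transition (hy : y ∈ overlap n c c') : ContDiffAt ℝ ∞ (transition c c') y := by
  have h2 : ContMDiffAt (𝓡 n) 𝓘(ℝ, 𝔼) ∞ (extChartAt (𝓡 n) c') ((extChartAt (𝓡 n) c).symm y) :=
    contMDiffAt_extChartAt' (by rw [← extChartAt_source (𝓡 n)]; exact hy.2)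
  exact (ContMDiffAt.comp y h2 (contMDiffAt_chart_symm hy.1)).contDiffAt

theorem differentiableAt_transition (hy : y ∈ overlap n c c') :
    DifferentiableAt ℝ (transition c c') y :=
  (contDiffAt_transition hy).differentiableAt (by simp)

theorem chartDeriv_transition (hy : y ∈ overlap n c c') (v : 𝔼) :
    @id 𝔼 (chartDeriv (𝓡 n) c y v) =
      chartDeriv (𝓡 n) c' (transition c c' y) (fderiv ℝ (transition c c') y v) := by
  have h := mfderiv_comp (I := 𝓘(ℝ, 𝔼)) (I' := 𝓘(ℝ, 𝔼)) (I'' := 𝓡 n) y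
    (g := (extChartAt (𝓡 n) c').symm) (f := transition c c')
    ((contMDiffAt_chart_symm (I := 𝓡 n) (transition_mem hy).1).mdifferentiableAt (by simp))
    (differentiableAt_transition hy).mdifferentiableAt
  rw [mfderiv_eq_fderiv] at h
  have h2 : (extChartAt (𝓡 n) c).symm =ᶠ[nhds y]
      (extChartAt (𝓡 n) c').symm ∘ transition c c' := by
    filter_upwards [(isOpen_overlap c c').mem_nhds hy] with x hx
    exact (chart_symm_transition hx).symm
  exact congrArg (fun L : 𝔼 →L[ℝ] 𝔼 => L v) (h2.mfderiv_eq.trans h)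

theorem fderiv_transition_inverse (hy : y ∈ overlap n c c') :
    (fderiv ℝ (transition c' c) (transition c c' y)).comp (fderiv ℝ (transition c c') y) =
      ContinuousLinearMap.id ℝ 𝔼 := by
  rw [← fderiv_comp y (differentiableAt_transition (transition_mem hy))
    (differentiableAt_transition hy)]
  have : transition c' c ∘ transition c c' =ᶠ[nhds y] id := by
    filter_upwards [(isOpen_overlap c c').mem_nhds hy] with x hx using transition_transition hx
  rw [this.fderiv_eq, fderiv_id]

theorem isUnit_det_fderiv_transition (hy : y ∈ overlap n c c') :
    IsUnit (endMatrix (fderiv ℝ (transition c c') y)).det := by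
  have h := congrArg (fun A => (endMatrix A).det) (fderiv_transition_inverse hy)
  simp only [endMatrix_comp, endMatrix_id, Matrix.det_mul, Matrix.det_one] at h
  exact .of_mul_eq_one _ ((mul_comm _ _).trans h)

theorem metricInChart_transition (g : Metric n S) (hy : y ∈ overlap n c c') :
    metricInChart g c y = (metricInChart g c' (transition c c' y)).bilinearComp
      (fderiv ℝ (transition c c') y) (fderiv ℝ (transition c c') y) := by
  ext v w
  let G : S → 𝔼 →L[ℝ] 𝔼 →L[ℝ] ℝ := fun p => g.inner p
  have h1 : metricInChart g c y v w = G ((extChartAt (𝓡 n) c).symm y)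
      (@id 𝔼 (chartDeriv (𝓡 n) c y v)) (@id 𝔼 (chartDeriv (𝓡 n) c y w)) := rfl
  rw [h1, chartDeriv_transition hy, chartDeriv_transition hy, ← chart_symm_transition hy]
  rfl

theorem endMatrix_det (A : 𝔼 →L[ℝ] 𝔼) : (endMatrix A).det = A.det := by
  have : endMatrix A = LinearMap.toMatrix (EuclideanSpace.basisFun (Fin n) ℝ).toBasis
      (EuclideanSpace.basisFun (Fin n) ℝ).toBasis (A : 𝔼 →ₗ[ℝ] 𝔼) := by
    ext i j
    simp [endMatrix, LinearMap.toMatrix_apply, stdVec]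
  rw [this, LinearMap.det_toMatrix]

/-- The Gram matrix changes by congruence with the Jacobian, whose absolute determinant is exactly
the factor in the change of variables formula for integrals. -/
theorem density_transition (g : Metric n S) (hy : y ∈ overlap n c c') :
    density g c y = |(fderiv ℝ (transition c c') y).det| * density g c' (transition c c' y) := by
  rw [density, density, gram_eq_formMatrix, metricInChart_transition g hy, formMatrix_bilinearComp,
    Matrix.det_mul, Matrix.det_mul, Matrix.det_transpose, endMatrix_det, ← gram_eq_formMatrix,
    mul_right_comm, ← sq, Real.sqrt_mul (sq_nonneg _), Real.sqrt_sq_eq_abs]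

theorem fieldInChart_transition (hy : y ∈ overlap n c c') (X : ∀ p : S, TangentSpace (𝓡 n) p) :
    fieldInChart (𝓡 n) c' X (transition c c' y) =
      fderiv ℝ (transition c c') y (fieldInChart (𝓡 n) c X y) := by
  apply chartDeriv_injective (I := 𝓡 n) (transition_mem hy).1
  rw [chartDeriv_fieldInChart (transition_mem hy).1]
  let F : S → 𝔼 := X
  have h : F ((extChartAt (𝓡 n) c').symm (transition c c' y)) =
      F ((extChartAt (𝓡 n) c).symm y) := congrArg F (chart_symm_transition hy)
  refine Eq.trans h (Eq.trans ?_ (chartDeriv_transition hy _))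
  exact (chartDeriv_fieldInChart hy.1 X).symm

end Transition

/-! ### The divergence on the manifold -/

section Divergence

variable {n : ℕ} {S : Type*} [TopologicalSpace S] [ChartedSpace (EuclideanSpace ℝ (Fin n)) S]
  [IsManifold (𝓡 n) ∞ S]

local notation "𝔼" => EuclideanSpace ℝ (Fin n)

/-- Smooth vector fields, by their components in the charts. -/
def IsSmoothField (X : ∀ p : S, TangentSpace (𝓡 n) p) : Prop :=
  ∀ c : S, ContDiffOn ℝ ∞ (fieldInChart (𝓡 n) c X) (extChartAt (𝓡 n) c).target

/-- The divergence of a vector field on a Riemannian manifold. -/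
noncomputable def fieldDiv (g : Metric n S) (X : ∀ p : S, TangentSpace (𝓡 n) p) (p : S) : ℝ :=
  divergence (density g p) (fieldInChart (𝓡 n) p X) (extChartAt (𝓡 n) p p)

theorem contDiffOn_divergence {ρ : 𝔼 → ℝ} {X : 𝔼 → 𝔼} {T : Set (EuclideanSpace ℝ (Fin n))}
    (hT : IsOpen T) (hρ : ContDiffOn ℝ ∞ ρ T) (h0 : ∀ y ∈ T, 0 < ρ y) (hX : ContDiffOn ℝ ∞ X T) :
    ContDiffOn ℝ ∞ (divergence ρ X) T := by
  refine (hρ.inv fun y hy => (h0 y hy).ne').mul (ContDiffOn.sum fun i _ => ?_)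
  have hXi : ContDiffOn ℝ ∞ (fun x => X x i) T :=
    (EuclideanSpace.proj i : 𝔼 →L[ℝ] ℝ).contDiff.comp_contDiffOn hX
  exact ((hρ.mul hXi).fderiv_of_isOpen (m := ∞) hT (by simp)).clm_apply contDiffOn_const

/-- The divergence can be computed in any chart. -/
theorem fieldDiv_chart (g : Metric n S) {X : ∀ p : S, TangentSpace (𝓡 n) p} (hX : IsSmoothField X)
    {c : S} {y : 𝔼} (hy : y ∈ (extChartAt (𝓡 n) c).target) :
    fieldDiv g X ((extChartAt (𝓡 n) c).symm y) =
      divergence (density g c) (fieldInChart (𝓡 n) c X) y := by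
  -- `fieldDiv` at a point uses the chart at that very point, so the transition from c to this chart
  -- has to be compared.
  set c' := (extChartAt (𝓡 n) c).symm y with hc'
  have hy2 : y ∈ overlap n c c' := ⟨hy, mem_extChartAt_source c'⟩
  have ht := (transition_mem hy2).1
  have hN : ∀ {c : S} {y : 𝔼}, y ∈ (extChartAt (𝓡 n) c).target →
      (extChartAt (𝓡 n) c).target ∈ nhds y := fun h => (isOpen_extChartAt_target _).mem_nhds h
  have hO := (isOpen_overlap c c').mem_nhds hy2
  symm
  refine divergence_pullback (τ := transition c c') (B₁ := metricInChart g c)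
    (B₂ := metricInChart g c') ((contDiffAt_transition hy2).of_le (by norm_cast))
    (isUnit_det_fderiv_transition hy2)
    (((contDiffOn_metricInChart g c).contDiffAt (hN hy)).differentiableAt (by simp))
    (((contDiffOn_metricInChart g c').contDiffAt (hN ht)).differentiableAt (by simp))
    (((hX c).contDiffAt (hN hy)).differentiableAt (by simp))
    (((hX c').contDiffAt (hN ht)).differentiableAt (by simp)) ?_ ?_
    (((contDiffOn_density g c).contDiffAt (hN hy)).differentiableAt (by simp)) (density_pos g hy) ?_
    (((contDiffOn_density g c').contDiffAt (hN ht)).differentiableAt (by simp)) (density_pos g ht) ?_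
  · filter_upwards [hO] with x hx using metricInChart_transition g hx
  · filter_upwards [hO] with x hx using fieldInChart_transition hx X
  · filter_upwards [hN hy] with x hx
    rw [det_metricInChart g hx]
    ring
  · filter_upwards [hN ht] with x hx
    rw [det_metricInChart g hx]
    ring

end Divergence

end Sasaki


namespace Sasaki

/-! ### Integration by a partition of unity -/

section Integration

open MeasureTheory

variable {n : ℕ} {S : Type*} [TopologicalSpace S] [ChartedSpace (EuclideanSpace ℝ (Fin n)) S]
  [IsManifold (𝓡 n) ∞ S]

local notation "𝔼" => EuclideanSpace ℝ (Fin n)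

omit [IsManifold (𝓡 n) ∞ S] in
theorem contMDiff_of_charts {F : Type*} [NormedAddCommGroup F] [NormedSpace ℝ F] {f : S → F}
    (h : ∀ c : S, ContDiffOn ℝ ∞ (fun y => f ((extChartAt (𝓡 n) c).symm y))
      (extChartAt (𝓡 n) c).target) : ContMDiff (𝓡 n) 𝓘(ℝ, F) ∞ f := by
  intro p
  have h1 : ContMDiffAt (𝓡 n) 𝓘(ℝ, F) ∞
      ((fun y => f ((extChartAt (𝓡 n) p).symm y)) ∘ extChartAt (𝓡 n) p) p :=
    ContMDiffAt.comp p ((h p).contDiffAt (extChartAt_target_mem_nhds p)).contMDiffAt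
      contMDiffAt_extChartAt
  refine h1.congr_of_eventuallyEq ?_
  filter_upwards [extChartAt_source_mem_nhds (I := 𝓡 n) p] with q hq
  exact (congrArg f ((extChartAt (𝓡 n) p).left_inv hq)).symm

theorem contDiffOn_comp_chart_symm {F : Type*} [NormedAddCommGroup F] [NormedSpace ℝ F] {f : S → F}
    (hf : ContMDiff (𝓡 n) 𝓘(ℝ, F) ∞ f) (c : S) :
    ContDiffOn ℝ ∞ (fun y => f ((extChartAt (𝓡 n) c).symm y)) (extChartAt (𝓡 n) c).target :=
  (hf.comp_contMDiffOn (contMDiffOn_extChartAt_symm c)).contDiffOn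

omit [IsManifold (𝓡 n) ∞ S] in
theorem continuousOn_comp_chart_symm {F : Type*} [TopologicalSpace F] {f : S → F}
    (hf : Continuous f) (c : S) :
    ContinuousOn (fun y => f ((extChartAt (𝓡 n) c).symm y)) (extChartAt (𝓡 n) c).target :=
  hf.comp_continuousOn (continuousOn_extChartAt_symm c)

/-- The integral of a function over the domain of the chart at `c`. -/
noncomputable def chartIntegral (g : Metric n S) (c : S) (f : S → ℂ) : ℂ :=
  ∫ y in (extChartAt (𝓡 n) c).target, (density g c y : ℂ) * f ((extChartAt (𝓡 n) c).symm y)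

/-- The coordinates of the support of a function supported in a chart. -/
def chartSupport (n : ℕ) {S : Type*} [TopologicalSpace S]
    [ChartedSpace (EuclideanSpace ℝ (Fin n)) S] (c : S) (f : S → ℂ) :
    Set (EuclideanSpace ℝ (Fin n)) :=
  extChartAt (𝓡 n) c '' tsupport f

section Compact

variable [CompactSpace S] {c : S} {f : S → ℂ}
  (hs : tsupport f ⊆ (extChartAt (𝓡 n) c).source)
include hs

omit [IsManifold (𝓡 n) ∞ S] in
theorem isCompact_chartSupport : IsCompact (chartSupport n c f) :=
  (isClosed_tsupport f).isCompact.image_of_continuousOn ((continuousOn_extChartAt c).mono hs)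

omit [IsManifold (𝓡 n) ∞ S] [CompactSpace S] in
theorem chartSupport_subset : chartSupport n c f ⊆ (extChartAt (𝓡 n) c).target :=
  ((extChartAt (𝓡 n) c).mapsTo.mono_left hs).image_subset

omit [IsManifold (𝓡 n) ∞ S] [CompactSpace S] hs in
theorem notMem_tsupport_of_notMem_chartSupport {y : 𝔼} (hy : y ∈ (extChartAt (𝓡 n) c).target)
    (h : y ∉ chartSupport n c f) : (extChartAt (𝓡 n) c).symm y ∉ tsupport f := fun h1 =>
  h ⟨_, h1, (extChartAt (𝓡 n) c).right_inv hy⟩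

/-- The integrand is continuous and vanishes off the compact image of the support; over the whole
chart domain the density alone need not be integrable. -/
theorem integrableOn_chart (g : Metric n S) (hf : Continuous f) :
    IntegrableOn (fun y => (density g c y : ℂ) * f ((extChartAt (𝓡 n) c).symm y))
      (extChartAt (𝓡 n) c).target := by
  have hc : ContinuousOn (fun y => (density g c y : ℂ) * f ((extChartAt (𝓡 n) c).symm y))
      (extChartAt (𝓡 n) c).target :=
    (Complex.continuous_ofReal.comp_continuousOn (contDiffOn_density g c).continuousOn).mul
      (continuousOn_comp_chart_symm hf c)
  refine ((hc.mono (chartSupport_subset hs)).integrableOn_compact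
    (isCompact_chartSupport hs)).of_forall_sdiff_eq_zero
    (isOpen_extChartAt_target c).measurableSet fun y hy => ?_
  rw [image_eq_zero_of_notMem_tsupport (notMem_tsupport_of_notMem_chartSupport hy.1 hy.2), mul_zero]

end Compact

/-- The integral of a function supported in two charts does not depend on the chart. -/
theorem chartIntegral_eq (g : Metric n S) {c c' : S} {f : S → ℂ}
    (hs : Function.support f ⊆ (extChartAt (𝓡 n) c).source)
    (hs' : Function.support f ⊆ (extChartAt (𝓡 n) c').source) :
    chartIntegral g c f = chartIntegral g c' f := by
  have key : ∀ c c' : S, Function.support f ⊆ (extChartAt (𝓡 n) c').source →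
      chartIntegral g c f = ∫ y in overlap n c c',
        (density g c y : ℂ) * f ((extChartAt (𝓡 n) c).symm y) := fun c c' hs' => by
    refine setIntegral_eq_of_subset_of_forall_sdiff_eq_zero
      (isOpen_extChartAt_target c).measurableSet Set.inter_subset_left fun y hy => ?_
    have : f ((extChartAt (𝓡 n) c).symm y) = 0 := by
      by_contra h
      exact hy.2 ⟨hy.1, hs' h⟩
    rw [this, mul_zero]
  rw [key c c' hs', key c' c hs, ← image_transition c c',
    integral_image_eq_integral_abs_det_fderiv_smul volume (isOpen_overlap c c').measurableSet
      (fun y hy => (differentiableAt_transition hy).hasFDerivAt.hasFDerivWithinAt)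
      (injOn_transition c c')]
  refine setIntegral_congr_fun (isOpen_overlap c c').measurableSet fun y hy => ?_
  simp only [chart_symm_transition hy, density_transition g hy, Complex.real_smul]
  push_cast
  ring

variable [T2Space S] [CompactSpace S] (g : Metric n S)

/-- The finitely many indices of the partition of unity. -/
noncomputable def partitionIndices (n : ℕ) (S : Type*) [TopologicalSpace S]
    [ChartedSpace (EuclideanSpace ℝ (Fin n)) S] [IsManifold (𝓡 n) ∞ S]
    [T2Space S] [CompactSpace S] : Finset S :=
  ((chartPartition n S).locallyFinite.finite_nonempty_of_compact).toFinset

theorem mem_partitionIndices {c p : S} (h : chartPartition n S c p ≠ 0) :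
    c ∈ partitionIndices n S := by
  rw [partitionIndices, Set.Finite.mem_toFinset]
  exact ⟨p, h⟩

theorem sum_partition (p : S) : ∑ c ∈ partitionIndices n S, chartPartition n S c p = 1 := by
  rw [← (chartPartition n S).sum_eq_one (Set.mem_univ p)]
  refine (finsum_eq_sum_of_support_subset _ fun c hc => ?_).symm
  exact mem_partitionIndices hc

/-- The part of a function in the domain of the chart at `c`. -/
noncomputable def chartPart (n : ℕ) {S : Type*} [TopologicalSpace S]
    [ChartedSpace (EuclideanSpace ℝ (Fin n)) S] [IsManifold (𝓡 n) ∞ S]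
    [T2Space S] [CompactSpace S] (c : S) (f : S → ℂ) (p : S) : ℂ :=
  (chartPartition n S c p : ℂ) * f p

theorem sum_chartPart (f : S → ℂ) (p : S) : ∑ c ∈ partitionIndices n S, chartPart n c f p = f p := by
  simp only [chartPart, ← Finset.sum_mul, ← Complex.ofReal_sum, sum_partition]
  simp

theorem tsupport_chartPart (c : S) (f : S → ℂ) :
    tsupport (chartPart n c f) ⊆ (extChartAt (𝓡 n) c).source := by
  refine Set.Subset.trans (closure_mono fun p hp => ?_)
    ((chartPartition_isSubordinate n S c).trans_eq (extChartAt_source (𝓡 n) c).symm)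
  intro h
  exact hp (by simp [chartPart, h])

theorem tsupport_chartPart_subset (c : S) (f : S → ℂ) : tsupport (chartPart n c f) ⊆ tsupport f :=
  closure_mono fun p hp h => hp (by simp [chartPart, h])

theorem contMDiff_partition (c : S) :
    ContMDiff (𝓡 n) 𝓘(ℝ, ℂ) ∞ (fun p => (chartPartition n S c p : ℂ)) :=
  Complex.ofRealCLM.contMDiff.comp (chartPartition n S c).contMDiff

theorem contMDiff_chartPart (c : S) {f : S → ℂ} (hf : ContMDiff (𝓡 n) 𝓘(ℝ, ℂ) ∞ f) :
    ContMDiff (𝓡 n) 𝓘(ℝ, ℂ) ∞ (chartPart n c f) :=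
  ((chartPartition n S c).contMDiff.smul hf).congr fun _ => Complex.real_smul.symm

theorem continuous_chartPart (c : S) {f : S → ℂ} (hf : Continuous f) :
    Continuous (chartPart n c f) :=
  (contMDiff_partition c).continuous.mul hf

/-- By compactness only finitely many members of the locally finite partition are nonzero. The
`finsum` is therefore an honest finite sum and can be manipulated linearly. -/
theorem integral_eq_sum (f : S → ℂ) :
    integral g f = ∑ c ∈ partitionIndices n S, chartIntegral g c (chartPart n c f) := by
  have h1 : integral g f = ∑ᶠ c : S, chartIntegral g c (chartPart n c f) := by
    refine finsum_congr fun c => ?_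
    refine congrArg _ (funext fun y => ?_)
    simp only [chartPart]
    push_cast
    ring
  rw [h1]
  refine finsum_eq_sum_of_support_subset _ fun c hc => ?_
  by_contra h
  refine hc ?_
  have : chartPart n c f = fun _ => 0 := by
    funext p
    have : chartPartition n S c p = 0 := by
      by_contra h2
      exact h (mem_partitionIndices h2)
    simp [chartPart, this]
  simp [chartIntegral, this]

omit [T2Space S] in
theorem chartIntegral_sum {ι : Type*} (s : Finset ι) {f : ι → S → ℂ} {c : S}
    (hs : ∀ i ∈ s, tsupport (f i) ⊆ (extChartAt (𝓡 n) c).source)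
    (hf : ∀ i ∈ s, Continuous (f i)) :
    chartIntegral g c (fun p => ∑ i ∈ s, f i p) = ∑ i ∈ s, chartIntegral g c (f i) := by
  simp only [chartIntegral]
  rw [← integral_finsetSum s fun i hi => integrableOn_chart (hs i hi) g (hf i hi)]
  simp only [Finset.mul_sum]

theorem integral_sum {ι : Type*} (s : Finset ι) {f : ι → S → ℂ} (hf : ∀ i ∈ s, Continuous (f i)) :
    integral g (fun p => ∑ i ∈ s, f i p) = ∑ i ∈ s, integral g (f i) := by
  simp only [integral_eq_sum]
  rw [Finset.sum_comm]
  refine Finset.sum_congr rfl fun c _ => ?_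
  rw [← chartIntegral_sum g s (fun i _ => tsupport_chartPart c (f i))
    fun i hi => continuous_chartPart c (hf i hi)]
  refine congrArg _ (funext fun p => ?_)
  simp [chartPart, Finset.mul_sum]

theorem integral_add {f₁ f₂ : S → ℂ} (h₁ : Continuous f₁) (h₂ : Continuous f₂) :
    integral g (fun p => f₁ p + f₂ p) = integral g f₁ + integral g f₂ := by
  have h := integral_sum g Finset.univ (f := fun b : Bool => if b then f₁ else f₂)
    (by intro b _; cases b <;> simpa)
  simpa using h

theorem integral_const_mul (a : ℂ) (f : S → ℂ) :
    integral g (fun p => a * f p) = a * integral g f := by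
  simp only [integral_eq_sum, Finset.mul_sum, chartIntegral]
  refine Finset.sum_congr rfl fun c _ => ?_
  rw [← MeasureTheory.integral_const_mul]
  refine congrArg _ (funext fun y => ?_)
  simp only [chartPart]
  ring

/-- The integral of a function supported in a chart is computed in this chart. -/
theorem integral_eq_chartIntegral {c : S} {f : S → ℂ}
    (hs : tsupport f ⊆ (extChartAt (𝓡 n) c).source) (hf : Continuous f) :
    integral g f = chartIntegral g c f := by
  rw [integral_eq_sum]
  have h : chartIntegral g c f =
      chartIntegral g c (fun p => ∑ c' ∈ partitionIndices n S, chartPart n c' f p) :=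
    congrArg _ (funext fun p => (sum_chartPart f p).symm)
  rw [h, chartIntegral_sum g _ (fun c' _ => (tsupport_chartPart_subset c' f).trans hs)
    fun c' _ => continuous_chartPart c' hf]
  exact Finset.sum_congr rfl fun c' _ => chartIntegral_eq g
    ((subset_tsupport _).trans (tsupport_chartPart c' f))
    ((subset_tsupport _).trans ((tsupport_chartPart_subset c' f).trans hs))

/-- The `L²` norm is definite on continuous functions. -/
theorem eq_zero_of_integral_mul_conj_eq_zero {f : S → ℂ} (hf : Continuous f)
    (h : integral g (fun p => f p * (starRingEnd ℂ) (f p)) = 0) : f = 0 := by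
  set F : S → ℝ := fun p => Complex.normSq (f p) with hF
  have hFc : Continuous F := Complex.continuous_normSq.comp hf
  set k : S → 𝔼 → ℝ := fun c y => density g c y *
    (chartPartition n S c ((extChartAt (𝓡 n) c).symm y) * F ((extChartAt (𝓡 n) c).symm y)) with hk
  have hk0 : ∀ c, ∀ y ∈ (extChartAt (𝓡 n) c).target, 0 ≤ k c y := fun c y hy =>
    mul_nonneg (density_pos g hy).le (mul_nonneg ((chartPartition n S).nonneg c _)
      (Complex.normSq_nonneg _))
  have e : ∀ c, chartIntegral g c (chartPart n c fun p => f p * (starRingEnd ℂ) (f p)) =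
      ((∫ y in (extChartAt (𝓡 n) c).target, k c y : ℝ) : ℂ) := by
    intro c
    refine Eq.trans ?_ integral_complex_ofReal
    rw [chartIntegral]
    refine congrArg _ (funext fun y => ?_)
    simp [chartPart, Complex.mul_conj, hk, hF]
  have hint : ∀ c, IntegrableOn (k c) (extChartAt (𝓡 n) c).target := by
    intro c
    have h1 := integrableOn_chart (tsupport_chartPart c fun p => (F p : ℂ)) g
      (continuous_chartPart c (Complex.continuous_ofReal.comp hFc))
    have h2 := h1.re
    refine h2.congr (Filter.Eventually.of_forall fun y => ?_)
    simp [chartPart, hk, ← Complex.ofReal_mul]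
  rw [integral_eq_sum, Finset.sum_congr rfl fun c _ => e c, ← Complex.ofReal_sum,
    Complex.ofReal_eq_zero, Finset.sum_eq_zero_iff_of_nonneg fun c _ =>
      setIntegral_nonneg (isOpen_extChartAt_target c).measurableSet (hk0 c)] at h
  -- A sum of nonnegative integrals is zero, so each continuous integrand vanishes almost
  -- everywhere, hence everywhere on the open chart domain.
  have hz : ∀ c ∈ partitionIndices n S, ∀ y ∈ (extChartAt (𝓡 n) c).target, k c y = 0 := by
    intro c hc
    have h1 := (setIntegral_eq_zero_iff_of_nonneg_ae
      ((ae_restrict_iff' (isOpen_extChartAt_target c).measurableSet).2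
        (Filter.Eventually.of_forall (hk0 c))) (hint c)).1 (h c hc)
    refine Measure.eqOn_open_of_ae_eq h1 (isOpen_extChartAt_target c) ?_ continuousOn_const
    exact (contDiffOn_density g c).continuousOn.mul ((continuousOn_comp_chart_symm
      (chartPartition n S c).contMDiff.continuous c).mul (continuousOn_comp_chart_symm hFc c))
  funext p
  by_contra hp
  have hp1 : F p ≠ 0 := fun h0 => hp (Complex.normSq_eq_zero.1 h0)
  -- At a point where f is nonzero every member of the partition would vanish, although they add up
  -- to 1.
  have h1 : ∀ c ∈ partitionIndices n S, chartPartition n S c p = 0 := by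
    intro c hc
    by_contra hne
    have hs : p ∈ (extChartAt (𝓡 n) c).source := by
      rw [extChartAt_source]
      exact chartPartition_isSubordinate n S c (subset_tsupport _ hne)
    have h2 := hz c hc _ ((extChartAt (𝓡 n) c).map_source hs)
    simp only [hk, (extChartAt (𝓡 n) c).left_inv hs] at h2
    exact mul_ne_zero (density_pos g ((extChartAt (𝓡 n) c).map_source hs)).ne'
      (mul_ne_zero hne hp1) h2
  have h2 := sum_partition (n := n) p
  rw [Finset.sum_eq_zero h1] at h2
  exact zero_ne_one h2

end Integration

end Sasaki


namespace Sasaki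

/-! ### The divergence theorem -/

section DivergenceTheorem

open MeasureTheory

variable {n : ℕ} {S : Type*} [TopologicalSpace S] [ChartedSpace (EuclideanSpace ℝ (Fin n)) S]
  [IsManifold (𝓡 n) ∞ S]

local notation "𝔼" => EuclideanSpace ℝ (Fin n)

/-- The integral of a derivative of a compactly supported function on an open set vanishes. -/
theorem setIntegral_fderiv_eq_zero {T K : Set (EuclideanSpace ℝ (Fin n))} (hT : IsOpen T)
    (hK : IsCompact K) (hKT : K ⊆ T) {f : 𝔼 → ℂ} (hf : ContDiffOn ℝ ∞ f T)
    (h0 : ∀ y ∈ T, y ∉ K → f y = 0) (v : 𝔼) : ∫ y in T, fderiv ℝ f y v = 0 := by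
  set F : 𝔼 → ℂ := T.indicator f with hF
  have hF0 : ∀ y, y ∉ K → F y = 0 := by
    intro y hy
    by_cases hyT : y ∈ T
    · rw [hF, Set.indicator_of_mem hyT, h0 y hyT hy]
    · exact Set.indicator_of_notMem hyT f
  have hFT : ∀ y ∈ T, F =ᶠ[nhds y] f := fun y hy => by
    filter_upwards [hT.mem_nhds hy] with x hx using Set.indicator_of_mem hx f
  have hFK : ∀ y, y ∉ K → F =ᶠ[nhds y] fun _ => 0 := fun y hy => by
    filter_upwards [hK.isClosed.isOpen_compl.mem_nhds hy] with x hx using hF0 x hx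
  have hFd : ContDiff ℝ ∞ F := by
    refine contDiff_iff_contDiffAt.2 fun y => ?_
    by_cases hy : y ∈ K
    · exact (hf.contDiffAt (hT.mem_nhds (hKT hy))).congr_of_eventuallyEq (hFT y (hKT hy))
    · exact contDiffAt_const.congr_of_eventuallyEq (hFK y hy)
  have hFc : HasCompactSupport F := HasCompactSupport.intro hK fun y hy => hF0 y hy
  have hF' : HasCompactSupport fun y => fderiv ℝ F y v := hFc.fderiv_apply ℝ v
  have hF'c : Continuous fun y => fderiv ℝ F y v :=
    (hFd.continuous_fderiv (by simp)).clm_apply continuous_const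
  have h1 : ∫ y in T, fderiv ℝ f y v = ∫ y, fderiv ℝ F y v := by
    rw [← setIntegral_eq_integral_of_forall_compl_eq_zero (s := T)
      (f := fun y => fderiv ℝ F y v)]
    · refine setIntegral_congr_fun hT.measurableSet fun y hy => ?_
      exact congrArg (fun L : 𝔼 →L[ℝ] ℂ => L v) (hFT y hy).fderiv_eq.symm
    · intro y hy
      rw [(hFK y fun h => hy (hKT h)).fderiv_eq]
      simp
  rw [h1]
  -- Integration by parts against the constant 1, for the extension of f by zero, which is smooth on
  -- the whole space with compact support.
  have h2 := integral_mul_fderiv_eq_neg_fderiv_mul_of_integrable (μ := (volume : Measure 𝔼))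
    (f := fun _ => (1 : ℂ)) (g := F) (v := v) (by simp)
    (by simpa using hF'c.integrable_of_hasCompactSupport hF')
    (by simpa using hFd.continuous.integrable_of_hasCompactSupport hFc)
    (fun x _ => differentiableAt_const _) (fun x _ => hFd.differentiable (by simp) x)
  simpa using h2

variable (g : Metric n S) {X : ∀ p : S, TangentSpace (𝓡 n) p}

/-- The derivative of a function along a vector field, in a chart. -/
theorem d_apply_field_chart {v : S → ℂ} (hv : ContMDiff (𝓡 n) 𝓘(ℝ, ℂ) ∞ v) {c : S} {y : 𝔼}
    (hy : y ∈ (extChartAt (𝓡 n) c).target) :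
    d v ((extChartAt (𝓡 n) c).symm y) (X ((extChartAt (𝓡 n) c).symm y)) =
      fderiv ℝ (fun z => v ((extChartAt (𝓡 n) c).symm z)) y (fieldInChart (𝓡 n) c X y) := by
  rw [fderiv_comp_chart_symm hy (hv.mdifferentiable (by simp) _), chartDeriv_fieldInChart hy]
  rfl

theorem d_apply_field_sum {ι : Type*} (s : Finset ι) {f : ι → S → ℂ}
    (hf : ∀ i ∈ s, ContMDiff (𝓡 n) 𝓘(ℝ, ℂ) ∞ (f i)) (p : S) :
    d (fun q => ∑ i ∈ s, f i q) p (X p) = ∑ i ∈ s, d (f i) p (X p) := by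
  have key : ∀ y ∈ (extChartAt (𝓡 n) p).target,
      d (fun q => ∑ i ∈ s, f i q) ((extChartAt (𝓡 n) p).symm y) (X ((extChartAt (𝓡 n) p).symm y)) =
        ∑ i ∈ s, d (f i) ((extChartAt (𝓡 n) p).symm y) (X ((extChartAt (𝓡 n) p).symm y)) := by
    intro y hy
    rw [d_apply_field_chart (contMDiff_finsetSum hf) hy,
      Finset.sum_congr rfl fun i hi => d_apply_field_chart (hf i hi) hy,
      fderiv_fun_sum fun i hi => ((contDiffOn_comp_chart_symm (hf i hi) p).contDiffAt
        ((isOpen_extChartAt_target p).mem_nhds hy)).differentiableAt (by simp), sum_apply]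
  have h := key _ (mem_extChartAt_target p)
  rwa [extChartAt_to_inv p] at h

theorem contMDiff_d_apply_field (hX : IsSmoothField X) {v : S → ℂ}
    (hv : ContMDiff (𝓡 n) 𝓘(ℝ, ℂ) ∞ v) :
    ContMDiff (𝓡 n) 𝓘(ℝ, ℂ) ∞ (fun p => d v p (X p)) := by
  refine contMDiff_of_charts fun c => ?_
  refine ContDiffOn.congr (((contDiffOn_comp_chart_symm hv c).fderiv_of_isOpen (m := ∞)
    (isOpen_extChartAt_target c) (by simp)).clm_apply (hX c)) fun y hy => ?_
  exact d_apply_field_chart hv hy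

theorem contMDiff_fieldDiv (hX : IsSmoothField X) :
    ContMDiff (𝓡 n) 𝓘(ℝ, ℝ) ∞ (fieldDiv g X) := by
  refine contMDiff_of_charts fun c => ?_
  refine ContDiffOn.congr (contDiffOn_divergence (isOpen_extChartAt_target c)
    (contDiffOn_density g c) (fun y hy => density_pos g hy) (hX c)) fun y hy => ?_
  exact fieldDiv_chart g hX hy

variable [T2Space S] [CompactSpace S]

/-- Integration by parts for functions supported in a chart. -/
theorem integral_d_field_of_tsupport (hX : IsSmoothField X) {v : S → ℂ}
    (hv : ContMDiff (𝓡 n) 𝓘(ℝ, ℂ) ∞ v) {c : S}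
    (hs : tsupport v ⊆ (extChartAt (𝓡 n) c).source) :
    integral g (fun p => d v p (X p) + (fieldDiv g X p : ℂ) * v p) = 0 := by
  set T := (extChartAt (𝓡 n) c).target with hT
  have hTo : IsOpen T := isOpen_extChartAt_target c
  set V : 𝔼 → ℂ := fun z => v ((extChartAt (𝓡 n) c).symm z) with hV
  have hVs : ContDiffOn ℝ ∞ V T := contDiffOn_comp_chart_symm hv c
  set ρ := density g c with hρ
  have hρs : ContDiffOn ℝ ∞ ρ T := contDiffOn_density g c
  set Y := fieldInChart (𝓡 n) c X with hY
  have hYs : ContDiffOn ℝ ∞ Y T := hX c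
  have hYi : ∀ i, ContDiffOn ℝ ∞ (fun x => Y x i) T := fun i =>
    (EuclideanSpace.proj i : 𝔼 →L[ℝ] ℝ).contDiff.comp_contDiffOn hYs
  have hsupp : tsupport (fun p => d v p (X p) + (fieldDiv g X p : ℂ) * v p) ⊆ tsupport v := by
    refine closure_minimal (fun p hp => ?_) (isClosed_tsupport v)
    by_contra hn
    refine hp ?_
    have h0 : v =ᶠ[nhds p] fun _ => 0 := notMem_tsupport_iff_eventuallyEq.1 hn
    have h1 : d v p = 0 :=
      (h0.mfderiv_eq (I := 𝓡 n) (I' := 𝓘(ℝ, ℂ))).trans mfderiv_const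
    simp [h1, h0.self_of_nhds]
  have hcont : Continuous (fun p => d v p (X p) + (fieldDiv g X p : ℂ) * v p) :=
    (contMDiff_d_apply_field hX hv).continuous.add
      ((Complex.continuous_ofReal.comp (contMDiff_fieldDiv g hX).continuous).mul hv.continuous)
  rw [integral_eq_chartIntegral g (hsupp.trans hs) hcont, chartIntegral]
  have hW : ∀ i, ContDiffOn ℝ ∞ (fun z => (ρ z * Y z i) • V z) T := fun i =>
    (hρs.mul (hYi i)).smul hVs
  -- Multiplied by the density, dv(X) + v div X is the Euclidean divergence of the field ρ V Y.
  have hpt : ∀ y ∈ T, (ρ y : ℂ) * (d v ((extChartAt (𝓡 n) c).symm y) (X ((extChartAt (𝓡 n) c).symm y))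
      + (fieldDiv g X ((extChartAt (𝓡 n) c).symm y) : ℂ) * v ((extChartAt (𝓡 n) c).symm y)) =
      ∑ i, fderiv ℝ (fun z => (ρ z * Y z i) • V z) y (stdVec i) := by
    intro y hy
    have hN := hTo.mem_nhds hy
    have hd : ∀ i, fderiv ℝ (fun z => (ρ z * Y z i) • V z) y (stdVec i) =
        ((ρ y * Y y i : ℝ) : ℂ) * fderiv ℝ V y (stdVec i)
          + ((fderiv ℝ (fun z => ρ z * Y z i) y (stdVec i) : ℝ) : ℂ) * V y := by
      intro i
      rw [fderiv_fun_smul (((hρs.mul (hYi i)).contDiffAt hN).differentiableAt (by simp))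
        ((hVs.contDiffAt hN).differentiableAt (by simp))]
      simp
    rw [Finset.sum_congr rfl fun i _ => hd i, Finset.sum_add_distrib, ← Finset.sum_mul,
      ← Complex.ofReal_sum, d_apply_field_chart hv hy, fieldDiv_chart g hX hy, divergence]
    have h1 : fderiv ℝ V y (Y y) = ∑ i, (Y y i : ℂ) * fderiv ℝ V y (stdVec i) := by
      conv_lhs => rw [← sum_coord_smul_stdVec (Y y)]
      simp
    have h2 : (ρ y : ℂ) ≠ 0 := Complex.ofReal_ne_zero.2 (density_pos g hy).ne'
    rw [h1, mul_add, Finset.mul_sum]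
    congr 1
    · refine Finset.sum_congr rfl fun i _ => ?_
      push_cast
      ring
    · push_cast
      rw [← mul_assoc, ← mul_assoc, mul_inv_cancel₀ h2, one_mul]
  have h0 : ∀ i, ∀ y ∈ T, y ∉ chartSupport n c v → (ρ y * Y y i) • V y = 0 := by
    intro i y hy hn
    have : V y = 0 :=
      image_eq_zero_of_notMem_tsupport (f := v) (notMem_tsupport_of_notMem_chartSupport hy hn)
    rw [this, smul_zero]
  have hK := isCompact_chartSupport hs
  have hKT := chartSupport_subset hs
  have hint : ∀ i, IntegrableOn (fun y => fderiv ℝ (fun z => (ρ z * Y z i) • V z) y (stdVec i)) T := by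
    intro i
    have hc : ContinuousOn (fun y => fderiv ℝ (fun z => (ρ z * Y z i) • V z) y (stdVec i)) T :=
      (((hW i).fderiv_of_isOpen (m := ∞) hTo (by simp)).clm_apply contDiffOn_const).continuousOn
    refine ((hc.mono hKT).integrableOn_compact hK).of_forall_sdiff_eq_zero hTo.measurableSet
      fun y hy => ?_
    have : (fun z => (ρ z * Y z i) • V z) =ᶠ[nhds y] fun _ => 0 := by
      filter_upwards [hTo.mem_nhds hy.1, hK.isClosed.isOpen_compl.mem_nhds hy.2] with x hx hx2
      exact h0 i x hx hx2
    rw [this.fderiv_eq]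
    simp
  rw [setIntegral_congr_fun hTo.measurableSet hpt, integral_finsetSum _ fun i _ => hint i]
  exact Finset.sum_eq_zero fun i _ => setIntegral_fderiv_eq_zero hTo hK hKT (hW i) (h0 i) _

/-- The divergence theorem: `∫ dv(X) = -∫ v div X`. -/
theorem integral_d_field (hX : IsSmoothField X) {v : S → ℂ}
    (hv : ContMDiff (𝓡 n) 𝓘(ℝ, ℂ) ∞ v) :
    integral g (fun p => d v p (X p)) = -integral g (fun p => (fieldDiv g X p : ℂ) * v p) := by
  have hcv : Continuous fun p => (fieldDiv g X p : ℂ) * v p :=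
    (Complex.continuous_ofReal.comp (contMDiff_fieldDiv g hX).continuous).mul hv.continuous
  rw [eq_neg_iff_add_eq_zero, ← integral_add g (contMDiff_d_apply_field hX hv).continuous hcv]
  have hvc : ∀ c, ContMDiff (𝓡 n) 𝓘(ℝ, ℂ) ∞ (chartPart n c v) := fun c => contMDiff_chartPart c hv
  -- The expression is linear in v, so v is cut up by the partition while X stays whole; the
  -- derivatives of the partition functions recombine because they sum to 1.
  have h1 : ∀ p, d v p (X p) + (fieldDiv g X p : ℂ) * v p = ∑ c ∈ partitionIndices n S,
      (d (chartPart n c v) p (X p) + (fieldDiv g X p : ℂ) * chartPart n c v p) := by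
    intro p
    rw [Finset.sum_add_distrib, ← Finset.mul_sum, sum_chartPart]
    congr 1
    rw [← d_apply_field_sum _ fun c _ => hvc c]
    exact congrArg (fun f => d f p (X p)) (funext fun q => (sum_chartPart v q).symm)
  rw [funext h1, integral_sum g _ (f := fun c p =>
    d (chartPart n c v) p (X p) + (fieldDiv g X p : ℂ) * chartPart n c v p) fun c _ => (contMDiff_d_apply_field hX (hvc c)).continuous.add
      ((Complex.continuous_ofReal.comp (contMDiff_fieldDiv g hX).continuous).mul (hvc c).continuous)]
  exact Finset.sum_eq_zero fun c _ =>
    integral_d_field_of_tsupport g hX (hvc c) (tsupport_chartPart c v)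

end DivergenceTheorem

end Sasaki


namespace Sasaki

/-! ### The Riemannian gradient -/

section Gradient

variable {n : ℕ} {S : Type*} [TopologicalSpace S] [ChartedSpace (EuclideanSpace ℝ (Fin n)) S]
  [IsManifold (𝓡 n) ∞ S]

local notation "𝔼" => EuclideanSpace ℝ (Fin n)

/-- The components of the gradient of a function in the chart at `c`. -/
noncomputable def gradInChart (g : Metric n S) (c : S) (u : S → ℝ)
    (y : EuclideanSpace ℝ (Fin n)) : EuclideanSpace ℝ (Fin n) :=
  ∑ i, (∑ j, (gram g c y)⁻¹ i j *
    fderiv ℝ (fun z => u ((extChartAt (𝓡 n) c).symm z)) y (stdVec j)) • stdVec i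

theorem gradInChart_coord (g : Metric n S) (c : S) (u : S → ℝ) (y : 𝔼) (i : Fin n) :
    gradInChart g c u y i = ∑ j, (gram g c y)⁻¹ i j *
      fderiv ℝ (fun z => u ((extChartAt (𝓡 n) c).symm z)) y (stdVec j) := by
  simp [gradInChart, stdVec, Pi.single_apply]

theorem metricInChart_gradInChart (g : Metric n S) (u : S → ℝ) {c : S} {y : 𝔼}
    (hy : y ∈ (extChartAt (𝓡 n) c).target) (w : 𝔼) :
    metricInChart g c y (gradInChart g c u y) w =
      fderiv ℝ (fun z => u ((extChartAt (𝓡 n) c).symm z)) y w := by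
  rw [form_apply_right, form_apply_right (fderiv ℝ _ y)]
  refine Finset.sum_congr rfl fun k _ => congrArg _ ?_
  have hG : IsUnit (gram g c y).det := (gram_det_pos g hy).ne'.isUnit
  have h1 : ∀ i, metricInChart g c y (stdVec i) (stdVec k) = gram g c y k i := fun i =>
    metricInChart_symm g c y _ _
  rw [form_apply_left]
  simp only [gradInChart_coord, h1, Finset.sum_mul]
  rw [Finset.sum_comm]
  have h2 : ∀ j, ∑ i, (gram g c y)⁻¹ i j *
      fderiv ℝ (fun z => u ((extChartAt (𝓡 n) c).symm z)) y (stdVec j) * gram g c y k i =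
      (gram g c y * (gram g c y)⁻¹) k j *
        fderiv ℝ (fun z => u ((extChartAt (𝓡 n) c).symm z)) y (stdVec j) := by
    intro j
    rw [Matrix.mul_apply, Finset.sum_mul]
    exact Finset.sum_congr rfl fun i _ => by ring
  rw [Finset.sum_congr rfl fun j _ => h2 j, Matrix.mul_nonsing_inv _ hG]
  simp [Matrix.one_apply]

theorem contDiffOn_gradInChart (g : Metric n S) {u : S → ℝ} (hu : ContMDiff (𝓡 n) 𝓘(ℝ, ℝ) ∞ u)
    (c : S) : ContDiffOn ℝ ∞ (gradInChart g c u) (extChartAt (𝓡 n) c).target :=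
  ContDiffOn.sum fun i _ => (ContDiffOn.sum fun j _ =>
    (contDiffOn_matrix_inv (contDiffOn_gram g c) (fun _ hy => (gram_det_pos g hy).ne') i j).mul
      (((contDiffOn_comp_chart_symm hu c).fderiv_of_isOpen (m := ∞) (isOpen_extChartAt_target c)
        (by simp)).clm_apply contDiffOn_const)).smul contDiffOn_const

/-- The gradient of a function. -/
noncomputable def gradient (g : Metric n S) (u : S → ℝ) (p : S) : TangentSpace (𝓡 n) p :=
  haveI : Nonempty (TangentSpace (𝓡 n) p) := ⟨0⟩
  Classical.epsilon fun b : TangentSpace (𝓡 n) p =>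
    ∀ w, g.inner p b w = mfderiv (𝓡 n) 𝓘(ℝ, ℝ) u p w

variable (g : Metric n S) {u : S → ℝ} (hu : ContMDiff (𝓡 n) 𝓘(ℝ, ℝ) ∞ u)
include hu

/-- The inverse Gram matrix in the chart at p provides a representing vector, so the choice made in
`gradient` has the required property. -/
theorem inner_gradient (p : S) (w : TangentSpace (𝓡 n) p) :
    g.inner p (gradient g u p) w = mfderiv (𝓡 n) 𝓘(ℝ, ℝ) u p w := by
  have key : ∀ y ∈ (extChartAt (𝓡 n) p).target,
      ∃ b : TangentSpace (𝓡 n) ((extChartAt (𝓡 n) p).symm y), ∀ w,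
        g.inner _ b w = mfderiv (𝓡 n) 𝓘(ℝ, ℝ) u ((extChartAt (𝓡 n) p).symm y) w := by
    intro y hy
    refine ⟨chartDeriv (𝓡 n) p y (gradInChart g p u y), fun w => ?_⟩
    rw [← chartDeriv_chartDerivInv hy w, ← fderiv_comp_chart_symm hy (hu.mdifferentiable (by simp) _),
      ← metricInChart_gradInChart g u hy]
    rfl
  have h := key _ (mem_extChartAt_target p)
  rw [extChartAt_to_inv p] at h
  exact Classical.epsilon_spec h w

/-- Positive definiteness leaves only one vector representing du, so the pointwise choice agrees
with the smooth formula in every chart. -/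
theorem fieldInChart_gradient {c : S} {y : 𝔼} (hy : y ∈ (extChartAt (𝓡 n) c).target) :
    fieldInChart (𝓡 n) c (gradient g u) y = gradInChart g c u y := by
  by_contra hne
  have h1 := metricInChart_pos g hy _ (sub_ne_zero.2 hne)
  have h2 : ∀ w, metricInChart g c y (fieldInChart (𝓡 n) c (gradient g u) y) w =
      metricInChart g c y (gradInChart g c u y) w := by
    intro w
    rw [metricInChart_gradInChart g u hy, metricInChart_apply, chartDeriv_fieldInChart hy,
      inner_gradient g hu, fderiv_comp_chart_symm hy (hu.mdifferentiable (by simp) _)]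
  rw [map_sub (metricInChart g c y), sub_apply, h2, sub_self] at h1
  exact lt_irrefl _ h1

theorem isSmoothField_gradient : IsSmoothField (gradient g u) := fun c =>
  (contDiffOn_gradInChart g hu c).congr fun _ hy => fieldInChart_gradient g hu hy

end Gradient

/-! ### The Laplace-Beltrami operator as a divergence -/

section Laplacian

variable {n : ℕ} {S : Type*} [TopologicalSpace S] [ChartedSpace (EuclideanSpace ℝ (Fin n)) S]
  [IsManifold (𝓡 n) ∞ S]

local notation "𝔼" => EuclideanSpace ℝ (Fin n)

theorem fderiv_ofReal_add_I_mul {A B : 𝔼 → ℝ} {y : 𝔼} (hA : DifferentiableAt ℝ A y)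
    (hB : DifferentiableAt ℝ B y) (v : 𝔼) :
    fderiv ℝ (fun y => (A y : ℂ) + Complex.I * (B y : ℂ)) y v =
      (fderiv ℝ A y v : ℂ) + Complex.I * (fderiv ℝ B y v : ℂ) := by
  have h1 := Complex.ofRealCLM.hasFDerivAt.comp y hA.hasFDerivAt
  have h2 := (Complex.ofRealCLM.hasFDerivAt.comp y hB.hasFDerivAt).const_mul Complex.I
  exact congrArg (fun L : 𝔼 →L[ℝ] ℂ => L v) (h1.add h2).fderiv

omit [IsManifold (𝓡 n) ∞ S] in
theorem contMDiff_re {u : S → ℂ} (hu : ContMDiff (𝓡 n) 𝓘(ℝ, ℂ) ∞ u) :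
    ContMDiff (𝓡 n) 𝓘(ℝ, ℝ) ∞ (fun p => (u p).re) :=
  Complex.reCLM.contMDiff.comp hu

omit [IsManifold (𝓡 n) ∞ S] in
theorem contMDiff_im {u : S → ℂ} (hu : ContMDiff (𝓡 n) 𝓘(ℝ, ℂ) ∞ u) :
    ContMDiff (𝓡 n) 𝓘(ℝ, ℝ) ∞ (fun p => (u p).im) :=
  Complex.imCLM.contMDiff.comp hu

omit [IsManifold (𝓡 n) ∞ S] in
theorem mfderiv_re {u : S → ℂ} (hu : ContMDiff (𝓡 n) 𝓘(ℝ, ℂ) ∞ u) (p : S)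
    (w : TangentSpace (𝓡 n) p) :
    mfderiv (𝓡 n) 𝓘(ℝ, ℝ) (fun p => (u p).re) p w = (d u p w).re :=
  congrArg (fun L : 𝔼 →L[ℝ] ℝ => L w)
    ((Complex.reCLM.hasMFDerivAt (x := u p)).comp p
      (hu.mdifferentiable (by simp) p).hasMFDerivAt).mfderiv

omit [IsManifold (𝓡 n) ∞ S] in
theorem mfderiv_im {u : S → ℂ} (hu : ContMDiff (𝓡 n) 𝓘(ℝ, ℂ) ∞ u) (p : S)
    (w : TangentSpace (𝓡 n) p) :
    mfderiv (𝓡 n) 𝓘(ℝ, ℝ) (fun p => (u p).im) p w = (d u p w).im :=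
  congrArg (fun L : 𝔼 →L[ℝ] ℝ => L w)
    ((Complex.imCLM.hasMFDerivAt (x := u p)).comp p
      (hu.mdifferentiable (by simp) p).hasMFDerivAt).mfderiv

/-- The Laplacian is minus the divergence of the gradient. -/
theorem laplacian_eq (g : Metric n S) {u : S → ℂ} (hu : ContMDiff (𝓡 n) 𝓘(ℝ, ℂ) ∞ u) (p : S) :
    laplacian g u p = -((fieldDiv g (gradient g fun q => (u q).re) p : ℂ)
      + Complex.I * (fieldDiv g (gradient g fun q => (u q).im) p : ℂ)) := by
  have hT : IsOpen (extChartAt (𝓡 n) p).target := isOpen_extChartAt_target p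
  have hN := hT.mem_nhds (mem_extChartAt_target (I := 𝓡 n) p)
  set y₀ : 𝔼 := extChartAt (𝓡 n) p p with hy₀
  have hdiff : ∀ {u : S → ℝ}, ContMDiff (𝓡 n) 𝓘(ℝ, ℝ) ∞ u → ∀ y ∈ (extChartAt (𝓡 n) p).target,
      DifferentiableAt ℝ (fun z => u ((extChartAt (𝓡 n) p).symm z)) y := fun hu y hy =>
    ((contDiffOn_comp_chart_symm hu p).contDiffAt (hT.mem_nhds hy)).differentiableAt (by simp)
  -- Gradient and divergence are defined for real data, so u is split into real and imaginary parts.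
  have h1 : ∀ y ∈ (extChartAt (𝓡 n) p).target, ∀ v,
      fderiv ℝ (fun z => u ((extChartAt (𝓡 n) p).symm z)) y v =
        (fderiv ℝ (fun z => (u ((extChartAt (𝓡 n) p).symm z)).re) y v : ℂ)
          + Complex.I * (fderiv ℝ (fun z => (u ((extChartAt (𝓡 n) p).symm z)).im) y v : ℂ) := by
    intro y hy v
    rw [← fderiv_ofReal_add_I_mul (hdiff (contMDiff_re hu) y hy) (hdiff (contMDiff_im hu) y hy)]
    congr 2
    funext z
    rw [mul_comm, Complex.re_add_im]
  have h2 : ∀ i, ∀ y ∈ (extChartAt (𝓡 n) p).target,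
      ∑ j : Fin n, ((density g p y * (gram g p y)⁻¹ i j : ℝ) : ℂ) *
        fderiv ℝ (fun z => u ((extChartAt (𝓡 n) p).symm z)) y (EuclideanSpace.single j (1 : ℝ)) =
      ((density g p y * fieldInChart (𝓡 n) p (gradient g fun q => (u q).re) y i : ℝ) : ℂ)
        + Complex.I *
        ((density g p y * fieldInChart (𝓡 n) p (gradient g fun q => (u q).im) y i : ℝ) : ℂ) := by
    intro i y hy
    rw [fieldInChart_gradient g (contMDiff_re hu) hy, fieldInChart_gradient g (contMDiff_im hu) hy,
      gradInChart_coord, gradInChart_coord]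
    simp only [h1 y hy, Finset.mul_sum, Complex.ofReal_sum]
    rw [← Finset.sum_add_distrib]
    refine Finset.sum_congr rfl fun j _ => ?_
    simp only [stdVec]
    push_cast
    ring
  have hsm : ∀ {u : S → ℝ}, ContMDiff (𝓡 n) 𝓘(ℝ, ℝ) ∞ u → ∀ i, DifferentiableAt ℝ
      (fun y => density g p y * fieldInChart (𝓡 n) p (gradient g u) y i) y₀ := fun hu i =>
    (((contDiffOn_density g p).contDiffAt hN).differentiableAt (by simp)).mul
      (differentiableAt_coord (((isSmoothField_gradient g hu p).contDiffAt hN).differentiableAt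
        (by simp)) i)
  have h3 : ∀ i, fderiv ℝ (fun y => ∑ j : Fin n, ((density g p y * (gram g p y)⁻¹ i j : ℝ) : ℂ) *
        fderiv ℝ (fun z => u ((extChartAt (𝓡 n) p).symm z)) y (EuclideanSpace.single j (1 : ℝ)))
        y₀ (EuclideanSpace.single i (1 : ℝ)) =
      (fderiv ℝ (fun y => density g p y *
          fieldInChart (𝓡 n) p (gradient g fun q => (u q).re) y i) y₀ (stdVec i) : ℂ)
        + Complex.I * (fderiv ℝ (fun y => density g p y *
          fieldInChart (𝓡 n) p (gradient g fun q => (u q).im) y i) y₀ (stdVec i) : ℂ) := by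
    intro i
    rw [← fderiv_ofReal_add_I_mul (hsm (contMDiff_re hu) i) (hsm (contMDiff_im hu) i)]
    refine congrArg (fun L : 𝔼 →L[ℝ] ℂ => L (stdVec i)) (Filter.EventuallyEq.fderiv_eq ?_)
    filter_upwards [hN] with y hy using h2 i y hy
  simp only [laplacian, fieldDiv, divergence]
  rw [Finset.sum_congr rfl fun i _ => h3 i, Finset.sum_add_distrib, ← Finset.mul_sum]
  push_cast
  ring

end Laplacian

end Sasaki


namespace Sasaki

/-! ### Hermitian pairing of covectors through dual vectors -/

section CovectorInner

variable {W : Type*} [AddCommGroup W] [Module ℝ W] (B : LinearMap.BilinForm ℝ W)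

theorem posDef_gram (hs : ∀ v w, B v w = B w v) (hp : ∀ v, v ≠ 0 → 0 < B v v) {k : ℕ}
    (b : Module.Basis (Fin k) ℝ W) : (Matrix.of fun i j => B (b i) (b j)).PosDef := by
  refine Matrix.PosDef.of_dotProduct_mulVec_pos ?_ fun x hx => ?_
  · ext i j
    simp [hs (b j)]
  · have h1 : b.equivFun.symm x ≠ 0 := fun h => hx (b.equivFun.symm.map_eq_zero_iff.1 h)
    refine (hp _ h1).trans_eq ?_
    rw [b.equivFun_symm_apply]
    simp only [map_sum, LinearMap.sum_apply, map_smul, LinearMap.smul_apply, smul_eq_mul,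
      dotProduct, Matrix.mulVec, Matrix.of_apply, Finset.mul_sum, star_trivial]
    rw [Finset.sum_comm]
    refine Finset.sum_congr rfl fun i _ => Finset.sum_congr rfl fun j _ => ?_
    ring

/-- The numbers B(x, b_j) are the Gram matrix applied to the coordinates of x, so its inverse
recovers them. -/
theorem sum_inv_gram_mul (hs : ∀ v w, B v w = B w v) (hp : ∀ v, v ≠ 0 → 0 < B v v) {k : ℕ}
    (b : Module.Basis (Fin k) ℝ W) (x : W) (i : Fin k) :
    ∑ j, (Matrix.of fun i j => B (b i) (b j))⁻¹ i j * B x (b j) = b.repr x i := by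
  set M : Matrix (Fin k) (Fin k) ℝ := Matrix.of fun i j => B (b i) (b j) with hM
  have hu : IsUnit M.det := (posDef_gram B hs hp b).det_pos.ne'.isUnit
  have h1 : (fun j => B x (b j)) = M *ᵥ (b.repr x) := by
    funext j
    conv_lhs => rw [← b.sum_repr x]
    simp only [map_sum, LinearMap.sum_apply, map_smul, LinearMap.smul_apply, smul_eq_mul,
      dotProduct, Matrix.mulVec, hM, Matrix.of_apply]
    exact Finset.sum_congr rfl fun l _ => by rw [hs (b l), mul_comm]
  have h2 := congrFun (Matrix.mulVec_mulVec (b.repr x) M⁻¹ M) i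
  rw [← h1, Matrix.nonsing_inv_mul _ hu, Matrix.one_mulVec] at h2
  exact h2

/-- The Hermitian inner product of covectors in terms of dual vectors. -/
theorem covectorInner_eq [FiniteDimensional ℝ W] (hs : ∀ v w, B v w = B w v)
    (hp : ∀ v, v ≠ 0 → 0 < B v v) {C : W → W → ℝ} (hC : ∀ v w, C v w = B v w)
    (α : W →ₗ[ℝ] ℂ) {α' β : W → ℂ} (hα : ∀ w, α' w = α w) {b₁ b₂ : W}
    (hβ : ∀ w, β w = (B b₁ w : ℂ) + Complex.I * (B b₂ w : ℂ)) :
    covectorInner C α' β = α b₁ - Complex.I * α b₂ := by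
  set b := Module.finBasis ℝ W with hb
  have hM : (Matrix.of fun k l => C (b k) (b l)) = Matrix.of fun k l => B (b k) (b l) := by
    ext k l
    exact hC _ _
  -- Pairing α with the covector B(x, ·) evaluates α at x; the second slot is conjugated, whence the
  -- minus sign before √-1 in the result.
  have hsum : ∀ x : W, ∑ i, ∑ j, (((Matrix.of fun k l => B (b k) (b l))⁻¹ i j : ℝ) : ℂ) *
      α (b i) * (B x (b j) : ℂ) = α x := by
    intro x
    conv_rhs => rw [← b.sum_repr x]
    rw [map_sum]
    refine Finset.sum_congr rfl fun i _ => ?_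
    rw [map_smul, ← sum_inv_gram_mul B hs hp b x i, Complex.real_smul, Complex.ofReal_sum,
      Finset.sum_mul]
    refine Finset.sum_congr rfl fun j _ => ?_
    push_cast
    ring
  rw [covectorInner, ← hb]
  simp only [hM, hα, hβ]
  rw [← hsum b₁, ← hsum b₂, Finset.mul_sum, ← Finset.sum_sub_distrib]
  refine Finset.sum_congr rfl fun i _ => ?_
  rw [Finset.mul_sum, ← Finset.sum_sub_distrib]
  refine Finset.sum_congr rfl fun j _ => ?_
  simp only [map_add, map_mul, Complex.conj_ofReal, Complex.conj_I]
  ring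

end CovectorInner

/-! ### The integrands of the two L² pairings -/

namespace SasakianStructure

variable {m : ℕ} {S : Type*} [TopologicalSpace S]
    [ChartedSpace (EuclideanSpace ℝ (Fin (2 * m + 1))) S] [IsManifold (𝓡 (2 * m + 1)) ∞ S]
    (𝓢 : SasakianStructure m S)

local notation "𝔼" => EuclideanSpace ℝ (Fin (2 * m + 1))
local notation "𝕁" => 𝓡 (2 * m + 1)

/-- The algebraic identities of the transverse complex structure. -/
theorem exists_transverseJ (p : S) : ∃ L : TangentSpace 𝕁 p →L[ℝ] TangentSpace 𝕁 p,
    (∀ v, 𝓢.transverseJ p v = L v) ∧ (∀ v w, 𝓢.g.inner p (L v) w = -𝓢.g.inner p v (L w)) ∧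
    L (𝓢.reeb p) = 0 ∧ ∀ v, L (L v) = -v + 𝓢.g.inner p (𝓢.reeb p) v • 𝓢.reeb p := by
  -- Proved at all points `symm y` of the chart domain and only then specialised: p is one of them
  -- only up to a propositional equality, which can be rewritten in a closed statement.
  have key : ∀ y ∈ (extChartAt 𝕁 p).target,
      ∃ L : TangentSpace 𝕁 ((extChartAt 𝕁 p).symm y) →L[ℝ] TangentSpace 𝕁 ((extChartAt 𝕁 p).symm y),
      (∀ v, 𝓢.transverseJ _ v = L v) ∧ (∀ v w, 𝓢.g.inner _ (L v) w = -𝓢.g.inner _ v (L w)) ∧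
      L (𝓢.reeb _) = 0 ∧ ∀ v, L (L v) = -v + 𝓢.g.inner _ (𝓢.reeb _) v • 𝓢.reeb _ := by
    intro y hy
    have hL := 𝓢.isLocalSasaki p
    have hr := 𝓢.chartDeriv_reebInChart hy
    let L : TangentSpace 𝕁 ((extChartAt 𝕁 p).symm y) →L[ℝ]
        TangentSpace 𝕁 ((extChartAt 𝕁 p).symm y) :=
      (chartDeriv 𝕁 p y).comp ((𝓢.transverseJInChart p y).comp (chartDerivInv 𝕁 p y))
    have hLc : ∀ v : 𝔼, L (chartDeriv 𝕁 p y v) = chartDeriv 𝕁 p y (𝓢.transverseJInChart p y v) := by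
      intro v
      change chartDeriv 𝕁 p y (𝓢.transverseJInChart p y (chartDerivInv 𝕁 p y (chartDeriv 𝕁 p y v))) = _
      rw [chartDerivInv_chartDeriv hy]
    have hsurj : ∀ v : TangentSpace 𝕁 ((extChartAt 𝕁 p).symm y), ∃ v' : 𝔼, chartDeriv 𝕁 p y v' = v :=
      fun v => ⟨_, chartDeriv_chartDerivInv hy v⟩
    refine ⟨L, fun v => ?_, fun v w => ?_, ?_, fun v => ?_⟩
    · obtain ⟨v, rfl⟩ := hsurj v
      rw [hLc, chartDeriv_transverseJInChart 𝓢 hy]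
    · obtain ⟨v, rfl⟩ := hsurj v
      obtain ⟨w, rfl⟩ := hsurj w
      rw [hLc, hLc]
      exact hL.skew y hy v w
    · rw [← hr, hLc, hL.Φ_ξ y hy, map_zero]
    · obtain ⟨v, rfl⟩ := hsurj v
      rw [hLc, hLc, hL.Φ_sq y hy, map_add, map_neg, map_smul, hr, metricInChart_apply, hr]
  have h := key _ (mem_extChartAt_target p)
  rwa [extChartAt_to_inv p] at h

/-- The transverse metric as a bilinear form. -/
noncomputable def transverseForm (p : S) : LinearMap.BilinForm ℝ (𝓢.contact p) :=
  LinearMap.mk₂ ℝ (𝓢.transverseMetric p) (fun _ _ _ => by simp [transverseMetric])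
    (fun _ _ _ => by simp [transverseMetric]) (fun _ _ _ => by simp [transverseMetric])
    (fun _ _ _ => by simp [transverseMetric])

theorem transverseForm_symm (p : S) (v w : 𝓢.contact p) :
    𝓢.transverseForm p v w = 𝓢.transverseForm p w v := 𝓢.g.symm _ _ _

theorem transverseForm_pos (p : S) (v : 𝓢.contact p) (hv : v ≠ 0) : 0 < 𝓢.transverseForm p v v :=
  𝓢.g.pos _ _ fun h => hv (Subtype.ext h)

variable {𝓢} {u : S → ℂ} (hu : 𝓢.IsBasic u)
include hu

theorem d_eq_inner_gradient (p : S) (w : TangentSpace 𝕁 p) :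
    d u p w = (𝓢.g.inner p (gradient 𝓢.g (fun q => (u q).re) p) w : ℂ)
      + Complex.I * (𝓢.g.inner p (gradient 𝓢.g (fun q => (u q).im) p) w : ℂ) := by
  rw [inner_gradient 𝓢.g (contMDiff_re hu.1), inner_gradient 𝓢.g (contMDiff_im hu.1),
    mfderiv_re hu.1, mfderiv_im hu.1, mul_comm Complex.I, Complex.re_add_im]

/-- For a basic function, du(ξ) = 0 says that the gradient is orthogonal to ξ. This is why the
transverse pairing sees the full Riemannian gradient. -/
theorem gradient_re_mem_contact (p : S) : gradient 𝓢.g (fun q => (u q).re) p ∈ 𝓢.contact p := by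
  have h := inner_gradient 𝓢.g (contMDiff_re hu.1) p (𝓢.reeb p)
  rw [mfderiv_re hu.1, hu.2, 𝓢.g.symm] at h
  exact h

theorem gradient_im_mem_contact (p : S) : gradient 𝓢.g (fun q => (u q).im) p ∈ 𝓢.contact p := by
  have h := inner_gradient 𝓢.g (contMDiff_im hu.1) p (𝓢.reeb p)
  rw [mfderiv_im hu.1, hu.2, 𝓢.g.symm] at h
  exact h

/-- The integrand of `⟨d_B v, d_B u⟩`. -/
theorem covectorInner_dB (v : S → ℂ) (p : S) :
    covectorInner (𝓢.transverseMetric p) (fun w : 𝓢.contact p => 𝓢.dB v p w)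
      (fun w : 𝓢.contact p => 𝓢.dB u p w) =
      d v p (gradient 𝓢.g (fun q => (u q).re) p)
        - Complex.I * d v p (gradient 𝓢.g (fun q => (u q).im) p) :=
  covectorInner_eq (𝓢.transverseForm p) (𝓢.transverseForm_symm p) (𝓢.transverseForm_pos p)
    (fun _ _ => rfl) ((d (n := 2 * m + 1) v p).toLinearMap.comp (𝓢.contact p).subtype)
    (fun _ => rfl) (b₁ := ⟨_, gradient_re_mem_contact hu p⟩) (b₂ := ⟨_, gradient_im_mem_contact hu p⟩)
    fun w => d_eq_inner_gradient hu p w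

/-- The integrand of `⟨∂̄_B v, ∂̄_B u⟩`. -/
theorem covectorInner_dbar (v : S → ℂ) (p : S) :
    covectorInner (𝓢.transverseMetric p) (fun w : 𝓢.contact p => 𝓢.dbar v p w)
      (fun w : 𝓢.contact p => 𝓢.dbar u p w) =
      (d v p (gradient 𝓢.g (fun q => (u q).re) p)
        - Complex.I * d v p (gradient 𝓢.g (fun q => (u q).im) p)
        + d v p (𝓢.transverseJ p (gradient 𝓢.g (fun q => (u q).im) p))
        + Complex.I * d v p (𝓢.transverseJ p (gradient 𝓢.g (fun q => (u q).re) p))) / 2 := by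
  obtain ⟨L, hL, hskew, hξ, hsq⟩ := 𝓢.exists_transverseJ p
  set Z₁ := gradient 𝓢.g (fun q => (u q).re) p with hZ₁
  set Z₂ := gradient 𝓢.g (fun q => (u q).im) p with hZ₂
  have h1 : 𝓢.g.inner p (𝓢.reeb p) Z₁ = 0 := gradient_re_mem_contact hu p
  have h2 : 𝓢.g.inner p (𝓢.reeb p) Z₂ = 0 := gradient_im_mem_contact hu p
  have hmem : ∀ z, 𝓢.g.inner p (𝓢.reeb p) (L z) = 0 := by
    intro z
    have := hskew (𝓢.reeb p) z
    rw [hξ, map_zero] at this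
    simpa using this.symm
  have hL1 : L (L Z₁) = -Z₁ := by rw [hsq, h1, zero_smul, add_zero]
  have hL2 : L (L Z₂) = -Z₂ := by rw [hsq, h2, zero_smul, add_zero]
  -- The vectors (Z₁ + LZ₂)/2 and (Z₂ - LZ₁)/2 are dual to the real and imaginary parts of ∂̄_B u,
  -- by skewness of L.
  have hb₁ : (2⁻¹ : ℝ) • (Z₁ + L Z₂) ∈ 𝓢.contact p := by
    change 𝓢.g.inner p (𝓢.reeb p) _ = 0
    rw [map_smul, map_add, h1, hmem, add_zero, smul_zero]
  have hb₂ : (2⁻¹ : ℝ) • (Z₂ - L Z₁) ∈ 𝓢.contact p := by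
    change 𝓢.g.inner p (𝓢.reeb p) _ = 0
    rw [map_smul, map_sub, h2, hmem, sub_zero, smul_zero]
  let α : 𝓢.contact p →ₗ[ℝ] ℂ := ((2⁻¹ : ℝ) • ((d (n := 2 * m + 1) v p).toLinearMap
    + (LinearMap.mulLeft ℝ Complex.I).comp ((d (n := 2 * m + 1) v p).comp L).toLinearMap)).comp
      (𝓢.contact p).subtype
  have hα : ∀ w : 𝓢.contact p, α w =
      (d (n := 2 * m + 1) v p w + Complex.I * d (n := 2 * m + 1) v p (L w)) / 2 := by
    intro w
    change (2⁻¹ : ℝ) • (d (n := 2 * m + 1) v p w + Complex.I * d (n := 2 * m + 1) v p (L w)) = _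
    rw [Complex.real_smul]
    push_cast
    ring
  have hβ : ∀ w : 𝓢.contact p, 𝓢.dbar u p w =
      (𝓢.transverseForm p ⟨_, hb₁⟩ w : ℂ) + Complex.I * (𝓢.transverseForm p ⟨_, hb₂⟩ w : ℂ) := by
    intro w
    change (d (n := 2 * m + 1) u p w + Complex.I * d (n := 2 * m + 1) u p (𝓢.transverseJ p w)) / 2 =
      (𝓢.g.inner p ((2⁻¹ : ℝ) • (Z₁ + L Z₂)) w : ℂ)
        + Complex.I * (𝓢.g.inner p ((2⁻¹ : ℝ) • (Z₂ - L Z₁)) w : ℂ)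
    rw [hL, d_eq_inner_gradient hu, d_eq_inner_gradient hu, ← hZ₁, ← hZ₂, map_smul, map_smul,
      map_add, map_sub]
    simp only [smul_apply, add_apply, sub_apply, hskew, smul_eq_mul]
    push_cast
    linear_combination (1 / 2 : ℂ) * (𝓢.g.inner p Z₂ (L w) : ℂ) * Complex.I_sq
  refine (covectorInner_eq (𝓢.transverseForm p) (𝓢.transverseForm_symm p) (𝓢.transverseForm_pos p)
    (fun _ _ => rfl) α (fun w => (congrArg (fun z =>
      (d (n := 2 * m + 1) v p w + Complex.I * d (n := 2 * m + 1) v p z) / 2)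
      (hL w)).trans (hα w).symm) hβ).trans ?_
  -- Since L² = -1 on Z₁ and Z₂, each of the four terms occurs twice with coefficient 1/4, which
  -- gives the overall factor 1/2.
  rw [hα, hα, hL, hL]
  simp only [map_smul, map_add, map_sub, hL1, hL2, map_neg, Complex.real_smul]
  push_cast
  linear_combination (-(1 / 4) : ℂ) * (d (n := 2 * m + 1) v p (L Z₂) + d (n := 2 * m + 1) v p Z₁) *
    Complex.I_sq

end SasakianStructure

end Sasaki


namespace Sasaki

/-! ### Basic functions, Green's formula and values of the adjoints -/

namespace SasakianStructure

variable {m : ℕ} {S : Type*} [TopologicalSpace S]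
    [ChartedSpace (EuclideanSpace ℝ (Fin (2 * m + 1))) S] [IsManifold (𝓡 (2 * m + 1)) ∞ S]
    {𝓢 : SasakianStructure m S}

local notation "𝔼" => EuclideanSpace ℝ (Fin (2 * m + 1))
local notation "𝕁" => 𝓡 (2 * m + 1)

theorem isBasic_of_charts {f : S → ℂ}
    (hs : ∀ c : S, ContDiffOn ℝ ∞ (fun y => f ((extChartAt 𝕁 c).symm y)) (extChartAt 𝕁 c).target)
    (h : ∀ c : S, ∀ y ∈ (extChartAt 𝕁 c).target,
      fderiv ℝ (fun y => f ((extChartAt 𝕁 c).symm y)) y (𝓢.reebInChart c y) = 0) :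
    𝓢.IsBasic f := by
  have hf := contMDiff_of_charts hs
  refine ⟨hf, fun p => ?_⟩
  have key : ∀ y ∈ (extChartAt 𝕁 p).target,
      d f ((extChartAt 𝕁 p).symm y) (𝓢.reeb ((extChartAt 𝕁 p).symm y)) = 0 := by
    intro y hy
    rw [← h p y hy, fderiv_comp_chart_symm hy (hf.mdifferentiable (by simp) _),
      chartDeriv_reebInChart 𝓢 hy]
    rfl
  have h2 := key _ (mem_extChartAt_target p)
  rwa [extChartAt_to_inv p] at h2

theorem IsBasic.fderiv_reebInChart {f : S → ℂ} (hf : 𝓢.IsBasic f) {c : S} {y : 𝔼}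
    (hy : y ∈ (extChartAt 𝕁 c).target) :
    fderiv ℝ (fun y => f ((extChartAt 𝕁 c).symm y)) y (𝓢.reebInChart c y) = 0 := by
  rw [fderiv_comp_chart_symm hy (hf.1.mdifferentiable (by simp) _), chartDeriv_reebInChart 𝓢 hy]
  exact hf.2 _

theorem differentiableAt_comp_chart_symm {F : Type*} [NormedAddCommGroup F] [NormedSpace ℝ F]
    {f : S → F} (hf : ContMDiff 𝕁 𝓘(ℝ, F) ∞ f) {c : S} {y : 𝔼}
    (hy : y ∈ (extChartAt 𝕁 c).target) :
    DifferentiableAt ℝ (fun y => f ((extChartAt 𝕁 c).symm y)) y :=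
  ((contDiffOn_comp_chart_symm hf c).contDiffAt
    ((isOpen_extChartAt_target c).mem_nhds hy)).differentiableAt (by simp)

theorem IsBasic.const_mul {f : S → ℂ} (hf : 𝓢.IsBasic f) (a : ℂ) :
    𝓢.IsBasic (fun p => a * f p) := by
  refine isBasic_of_charts (fun c => contDiffOn_const.mul (contDiffOn_comp_chart_symm hf.1 c))
    fun c y hy => ?_
  rw [fderiv_const_mul (differentiableAt_comp_chart_symm hf.1 hy), smul_apply,
    hf.fderiv_reebInChart hy, smul_zero]

theorem IsBasic.sub {f₁ f₂ : S → ℂ} (h₁ : 𝓢.IsBasic f₁) (h₂ : 𝓢.IsBasic f₂) :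
    𝓢.IsBasic (fun p => f₁ p - f₂ p) := by
  refine isBasic_of_charts (fun c => (contDiffOn_comp_chart_symm h₁.1 c).sub
    (contDiffOn_comp_chart_symm h₂.1 c)) fun c y hy => ?_
  rw [fderiv_fun_sub (differentiableAt_comp_chart_symm h₁.1 hy)
    (differentiableAt_comp_chart_symm h₂.1 hy), sub_apply, h₁.fderiv_reebInChart hy,
    h₂.fderiv_reebInChart hy, sub_zero]

/-- Real basic functions. -/
structure IsRealBasic (𝓢 : SasakianStructure m S) (u : S → ℝ) : Prop where
  smooth : ContMDiff 𝕁 𝓘(ℝ, ℝ) ∞ u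
  reeb : ∀ c : S, ∀ y ∈ (extChartAt 𝕁 c).target,
    fderiv ℝ (fun y => u ((extChartAt 𝕁 c).symm y)) y (𝓢.reebInChart c y) = 0

theorem IsBasic.re {u : S → ℂ} (hu : 𝓢.IsBasic u) : 𝓢.IsRealBasic (fun p => (u p).re) where
  smooth := contMDiff_re hu.1
  reeb c y hy := by
    rw [fderiv_comp_chart_symm (f := fun p => (u p).re) hy
      ((contMDiff_re hu.1).mdifferentiable (by simp) _), chartDeriv_reebInChart 𝓢 hy,
      mfderiv_re hu.1, hu.2, Complex.zero_re]

theorem IsBasic.im {u : S → ℂ} (hu : 𝓢.IsBasic u) : 𝓢.IsRealBasic (fun p => (u p).im) where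
  smooth := contMDiff_im hu.1
  reeb c y hy := by
    rw [fderiv_comp_chart_symm (f := fun p => (u p).im) hy
      ((contMDiff_im hu.1).mdifferentiable (by simp) _), chartDeriv_reebInChart 𝓢 hy,
      mfderiv_im hu.1, hu.2, Complex.zero_im]

namespace IsRealBasic

variable {u : S → ℝ} (hu : 𝓢.IsRealBasic u)
include hu

/-- The divergence of the gradient of a basic function is basic. -/
theorem fieldDiv_gradient : 𝓢.IsRealBasic (fieldDiv 𝓢.g (gradient 𝓢.g u)) where
  smooth := contMDiff_fieldDiv 𝓢.g (isSmoothField_gradient 𝓢.g hu.smooth)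
  reeb c y hy := by
    have hL := 𝓢.isLocalSasaki c
    have hZ := isSmoothField_gradient 𝓢.g hu.smooth
    rw [hL.fderiv_congr (fun x hx => fieldDiv_chart 𝓢.g hZ hx) hy]
    refine hL.fderiv_divergence_gradient_reeb (contDiffOn_density 𝓢.g c)
      (fun y hy => density_pos 𝓢.g hy) (fun y hy => det_metricInChart 𝓢.g hy)
      (contDiffOn_comp_chart_symm hu.smooth c) (hZ c) (fun y hy w => ?_) (hu.reeb c) hy
    rw [fieldInChart_gradient 𝓢.g hu.smooth hy, metricInChart_gradInChart 𝓢.g u hy]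

omit hu in
theorem fieldInChart_transverseJ (X : ∀ p : S, TangentSpace 𝕁 p) {c : S} {y : 𝔼}
    (hy : y ∈ (extChartAt 𝕁 c).target) :
    fieldInChart 𝕁 c (fun p => 𝓢.transverseJ p (X p)) y =
      𝓢.transverseJInChart c y (fieldInChart 𝕁 c X y) := by
  apply chartDeriv_injective (I := 𝕁) hy
  rw [chartDeriv_fieldInChart hy, chartDeriv_transverseJInChart 𝓢 hy, chartDeriv_fieldInChart hy]

theorem isSmoothField_transverseJ_gradient :
    IsSmoothField (fun p => 𝓢.transverseJ p (gradient 𝓢.g u p)) := fun c =>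
  (𝓢.contDiffOn_transverseJInChart.clm_apply (isSmoothField_gradient 𝓢.g hu.smooth c)).congr
    fun _ hy => fieldInChart_transverseJ _ hy

/-- The rotated gradient of a basic function is divergence free. -/
theorem fieldDiv_transverseJ_gradient (p : S) :
    fieldDiv 𝓢.g (fun p => 𝓢.transverseJ p (gradient 𝓢.g u p)) p = 0 := by
  have hL := 𝓢.isLocalSasaki p
  have hp := mem_extChartAt_target (I := 𝕁) p
  have hZ := isSmoothField_gradient 𝓢.g hu.smooth
  have h1 := hL.divergence_Φ_gradient (contDiffOn_density 𝓢.g p)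
    (fun y hy => density_pos 𝓢.g hy) (fun y hy => det_metricInChart 𝓢.g hy)
    (contDiffOn_comp_chart_symm hu.smooth p) (hZ p) (fun y hy w => by
      rw [fieldInChart_gradient 𝓢.g hu.smooth hy, metricInChart_gradInChart 𝓢.g u hy])
    (hu.reeb p) hp
  rw [← h1, fieldDiv, divergence, divergence]
  refine congrArg _ (Finset.sum_congr rfl fun i _ => hL.fderiv_congr (fun x hx => ?_) hp _)
  rw [fieldInChart_transverseJ _ hx]

end IsRealBasic

/-- A value of the adjoint has to be basic. This reduces to the invariance under ξ of the
divergences of the two gradients, that is, to the Killing property. -/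
theorem isBasic_laplacian {u : S → ℂ} (hu : 𝓢.IsBasic u) : 𝓢.IsBasic (laplacian 𝓢.g u) := by
  have h1 := hu.re.fieldDiv_gradient
  have h2 := hu.im.fieldDiv_gradient
  have h : 𝓢.IsBasic (fun p => (fieldDiv 𝓢.g (gradient 𝓢.g fun q => (u q).re) p : ℂ)
      + Complex.I * (fieldDiv 𝓢.g (gradient 𝓢.g fun q => (u q).im) p : ℂ)) := by
    refine isBasic_of_charts (fun c => ?_) fun c y hy => ?_
    · exact (Complex.ofRealCLM.contDiff.comp_contDiffOn (contDiffOn_comp_chart_symm h1.smooth c)).add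
        (contDiffOn_const.mul
          (Complex.ofRealCLM.contDiff.comp_contDiffOn (contDiffOn_comp_chart_symm h2.smooth c)))
    · rw [fderiv_ofReal_add_I_mul (differentiableAt_comp_chart_symm h1.smooth hy)
        (differentiableAt_comp_chart_symm h2.smooth hy), h1.reeb c y hy, h2.reeb c y hy]
      simp
  have e : laplacian 𝓢.g u = fun p => -1 * ((fieldDiv 𝓢.g (gradient 𝓢.g fun q => (u q).re) p : ℂ)
      + Complex.I * (fieldDiv 𝓢.g (gradient 𝓢.g fun q => (u q).im) p : ℂ)) := by
    funext p
    rw [laplacian_eq 𝓢.g hu.1, neg_one_mul]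
  rw [e]
  exact h.const_mul _

variable [T2Space S] [CompactSpace S]

theorem integral_add_const_mul {n : ℕ} {S : Type*} [TopologicalSpace S]
    [ChartedSpace (EuclideanSpace ℝ (Fin n)) S] [IsManifold (𝓡 n) ∞ S] [T2Space S] [CompactSpace S]
    (g : Metric n S) {f₁ f₂ : S → ℂ} (h₁ : Continuous f₁) (h₂ : Continuous f₂) (a b : ℂ) :
    integral g (fun p => a * f₁ p + b * f₂ p) = a * integral g f₁ + b * integral g f₂ := by
  rw [← integral_const_mul, ← integral_const_mul]
  exact integral_add g (continuous_const.mul h₁) (continuous_const.mul h₂)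

/-- Green's formula for basic functions. -/
theorem integral_d_gradient {u v : S → ℂ} (hu : 𝓢.IsBasic u) (hv : 𝓢.IsBasic v) :
    integral 𝓢.g (fun p => d v p (gradient 𝓢.g (fun q => (u q).re) p)
      - Complex.I * d v p (gradient 𝓢.g (fun q => (u q).im) p)) =
      𝓢.functionInner v (laplacian 𝓢.g u) := by
  have hZ₁ := isSmoothField_gradient 𝓢.g hu.re.smooth
  have hZ₂ := isSmoothField_gradient 𝓢.g hu.im.smooth
  have hc₁ := (contMDiff_d_apply_field hZ₁ hv.1).continuous
  have hc₂ := (contMDiff_d_apply_field hZ₂ hv.1).continuous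
  have hd₁ : Continuous fun p => (fieldDiv 𝓢.g (gradient 𝓢.g fun q => (u q).re) p : ℂ) * v p :=
    (Complex.continuous_ofReal.comp (contMDiff_fieldDiv 𝓢.g hZ₁).continuous).mul hv.1.continuous
  have hd₂ : Continuous fun p => (fieldDiv 𝓢.g (gradient 𝓢.g fun q => (u q).im) p : ℂ) * v p :=
    (Complex.continuous_ofReal.comp (contMDiff_fieldDiv 𝓢.g hZ₂).continuous).mul hv.1.continuous
  have e1 : (fun p => d v p (gradient 𝓢.g (fun q => (u q).re) p)
      - Complex.I * d v p (gradient 𝓢.g (fun q => (u q).im) p)) =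
      fun p => 1 * d v p (gradient 𝓢.g (fun q => (u q).re) p)
        + -Complex.I * d v p (gradient 𝓢.g (fun q => (u q).im) p) := by
    funext p
    ring
  have e2 : (fun p => v p * (starRingEnd ℂ) (laplacian 𝓢.g u p)) =
      fun p => -1 * ((fieldDiv 𝓢.g (gradient 𝓢.g fun q => (u q).re) p : ℂ) * v p)
        + Complex.I * ((fieldDiv 𝓢.g (gradient 𝓢.g fun q => (u q).im) p : ℂ) * v p) := by
    funext p
    rw [laplacian_eq 𝓢.g hu.1]
    simp only [map_neg, map_add, map_mul, Complex.conj_ofReal, Complex.conj_I]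
    ring
  rw [functionInner, e1, e2, integral_add_const_mul 𝓢.g hc₁ hc₂, integral_add_const_mul 𝓢.g hd₁ hd₂,
    integral_d_field 𝓢.g hZ₁ hv.1,
    integral_d_field 𝓢.g hZ₂ hv.1]
  ring

/-- The divergence theorem for the divergence-free field Φ grad u; these are the cross terms of the
∂̄_B pairing. -/
theorem integral_d_transverseJ_gradient {u : S → ℝ} (hu : 𝓢.IsRealBasic u) {v : S → ℂ}
    (hv : 𝓢.IsBasic v) :
    integral 𝓢.g (fun p => d v p (𝓢.transverseJ p (gradient 𝓢.g u p))) = 0 := by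
  have h := integral_d_field 𝓢.g hu.isSmoothField_transverseJ_gradient hv.1
  rw [h, neg_eq_zero]
  -- Zero is written as a product so that the integral of the zero function follows from
  -- homogeneity.
  have e : (fun p => (fieldDiv 𝓢.g (fun p => 𝓢.transverseJ p (gradient 𝓢.g u p)) p : ℂ) * v p) =
      fun _ => (0 : ℂ) * 0 := by
    funext p
    rw [hu.fieldDiv_transverseJ_gradient]
    simp
  rw [e, integral_const_mul 𝓢.g 0 fun _ => 0, zero_mul]

theorem isAdjointValue_dB {u : S → ℂ} (hu : 𝓢.IsBasic u) :
    𝓢.IsAdjointValue 𝓢.dB (𝓢.dB u) (laplacian 𝓢.g u) := by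
  refine ⟨isBasic_laplacian hu, fun v hv => ?_⟩
  rw [← integral_d_gradient hu hv, formInner]
  exact congrArg _ (funext fun p => covectorInner_dB hu v p)

/-- The integrand is half the one for d_B plus cross terms along Φ grad Re u and Φ grad Im u, whose
integrals vanish. -/
theorem isAdjointValue_dbar {u : S → ℂ} (hu : 𝓢.IsBasic u) :
    𝓢.IsAdjointValue 𝓢.dbar (𝓢.dbar u) (fun p => 1 / 2 * laplacian 𝓢.g u p) := by
  refine ⟨(isBasic_laplacian hu).const_mul _, fun v hv => ?_⟩
  have hZ₁ := isSmoothField_gradient 𝓢.g hu.re.smooth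
  have hZ₂ := isSmoothField_gradient 𝓢.g hu.im.smooth
  have hc₁ := (contMDiff_d_apply_field hZ₁ hv.1).continuous
  have hc₂ := (contMDiff_d_apply_field hZ₂ hv.1).continuous
  have hk₁ := (contMDiff_d_apply_field hu.re.isSmoothField_transverseJ_gradient hv.1).continuous
  have hk₂ := (contMDiff_d_apply_field hu.im.isSmoothField_transverseJ_gradient hv.1).continuous
  have hQ : Continuous fun p => d v p (gradient 𝓢.g (fun q => (u q).re) p)
      - Complex.I * d v p (gradient 𝓢.g (fun q => (u q).im) p) := hc₁.sub (continuous_const.mul hc₂)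
  have hK : Continuous fun p => 1 * d v p (𝓢.transverseJ p (gradient 𝓢.g (fun q => (u q).im) p))
      + Complex.I * d v p (𝓢.transverseJ p (gradient 𝓢.g (fun q => (u q).re) p)) :=
    (continuous_const.mul hk₂).add (continuous_const.mul hk₁)
  have e1 : (fun p => covectorInner (𝓢.transverseMetric p) (fun w : 𝓢.contact p => 𝓢.dbar v p w)
      (fun w : 𝓢.contact p => 𝓢.dbar u p w)) = fun p =>
      1 / 2 * (d v p (gradient 𝓢.g (fun q => (u q).re) p)
        - Complex.I * d v p (gradient 𝓢.g (fun q => (u q).im) p))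
        + 1 / 2 * (1 * d v p (𝓢.transverseJ p (gradient 𝓢.g (fun q => (u q).im) p))
        + Complex.I * d v p (𝓢.transverseJ p (gradient 𝓢.g (fun q => (u q).re) p))) := by
    funext p
    rw [covectorInner_dbar hu]
    ring
  have e2 : (fun p => v p * (starRingEnd ℂ) (1 / 2 * laplacian 𝓢.g u p)) =
      fun p => 1 / 2 * (v p * (starRingEnd ℂ) (laplacian 𝓢.g u p)) := by
    funext p
    simp only [map_mul, map_div₀, map_one, map_ofNat]
    ring
  rw [formInner, functionInner, e1, e2, integral_const_mul, integral_add_const_mul 𝓢.g hQ hK,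
    integral_add_const_mul 𝓢.g hk₂ hk₁,
    integral_d_transverseJ_gradient hu.re hv, integral_d_transverseJ_gradient hu.im hv,
    integral_d_gradient hu hv, functionInner]
  ring

/-- Values of adjoint operators are unique. -/
theorem IsAdjointValue.unique {T : (S → ℂ) → ∀ p : S, TangentSpace (𝓡 (2 * m + 1)) p → ℂ}
    {α : ∀ p : S, TangentSpace (𝓡 (2 * m + 1)) p → ℂ} {f f' : S → ℂ} (h : 𝓢.IsAdjointValue T α f)
    (h' : 𝓢.IsAdjointValue T α f') : f' = f := by
  -- The difference of two values is itself basic, hence an admissible test function.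
  set w : S → ℂ := fun p => f' p - f p with hw
  have hwb : 𝓢.IsBasic w := h'.1.sub h.1
  have hwc := hwb.1.continuous
  have h1 : 𝓢.functionInner w f' = 𝓢.functionInner w f := (h'.2 w hwb).symm.trans (h.2 w hwb)
  have e : (fun p => w p * (starRingEnd ℂ) (f' p)) =
      fun p => w p * (starRingEnd ℂ) (w p) + w p * (starRingEnd ℂ) (f p) := by
    funext p
    simp only [hw, map_sub]
    ring
  have hw1 : Continuous fun p => w p * (starRingEnd ℂ) (w p) :=
    hwc.mul (Complex.continuous_conj.comp hwc)
  have hw2 : Continuous fun p => w p * (starRingEnd ℂ) (f p) :=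
    hwc.mul (Complex.continuous_conj.comp h.1.1.continuous)
  rw [functionInner, functionInner, e, integral_add _ hw1 hw2, add_eq_right] at h1
  have h2 := eq_zero_of_integral_mul_conj_eq_zero 𝓢.g hwc h1
  funext p
  exact sub_eq_zero.1 (congrFun h2 p)

theorem IsAdjointValue.existsUnique {T : (S → ℂ) → ∀ p : S, TangentSpace (𝓡 (2 * m + 1)) p → ℂ}
    {α : ∀ p : S, TangentSpace (𝓡 (2 * m + 1)) p → ℂ} {f : S → ℂ}
    (h : 𝓢.IsAdjointValue T α f) :
    ∃! f : S → ℂ, 𝓢.IsAdjointValue T α f :=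
  ⟨f, h, fun _ h' => h.unique h'⟩

/-- `adjoint` is an arbitrary choice: existence makes it a value, and uniqueness identifies it. -/
theorem IsAdjointValue.adjoint_eq {T : (S → ℂ) → ∀ p : S, TangentSpace (𝓡 (2 * m + 1)) p → ℂ}
    {α : ∀ p : S, TangentSpace (𝓡 (2 * m + 1)) p → ℂ} {f : S → ℂ}
    (h : 𝓢.IsAdjointValue T α f) : 𝓢.adjoint T α = f :=
  h.unique (Classical.epsilon_spec (p := 𝓢.IsAdjointValue T α) ⟨f, h⟩)

end SasakianStructure

end Sasaki

theorem mainTheorem10 (m : ℕ) {S : Type*} [TopologicalSpace S] [T2Space S] [CompactSpace S]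
    [ChartedSpace (EuclideanSpace ℝ (Fin (2 * m + 1))) S] [IsManifold (𝓡 (2 * m + 1)) ∞ S]
    (𝓢 : Sasaki.SasakianStructure m S) (u : S → ℂ) (hu : 𝓢.IsBasic u) :
    (∃! f : S → ℂ, 𝓢.IsAdjointValue 𝓢.dB (𝓢.dB u) f) ∧
    (∃! f : S → ℂ, 𝓢.IsAdjointValue 𝓢.dbar (𝓢.dbar u) f) ∧
    Sasaki.laplacian 𝓢.g u = 𝓢.basicLaplacian u ∧
    𝓢.basicLaplacian u = fun p => 2 * 𝓢.basicDolbeaultLaplacian u p := by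
  have h1 := Sasaki.SasakianStructure.isAdjointValue_dB hu
  have h2 := Sasaki.SasakianStructure.isAdjointValue_dbar hu
  refine ⟨h1.existsUnique, h2.existsUnique, h1.adjoint_eq.symm, ?_⟩
  rw [Sasaki.SasakianStructure.basicLaplacian, Sasaki.SasakianStructure.basicDolbeaultLaplacian,
    h1.adjoint_eq, h2.adjoint_eq]
  funext p
  ring
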